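/- **Setting.** There are $N$ arms and $M$ players, $1\le M<N$. Let $\{P_\theta\}_{\theta\in H}$ be a family of probability distributions on $\mathbb R$ (for example given by densities $f(\cdot;\theta)$), with mean $\mu(\theta)$ and Kullback–Leibler distance $I(\theta,\theta')=\mathbb E_\theta[\log (f(y;\theta)/f(y;\theta'))]$, such that (C1) $\mu(\theta)$ exists for all $\theta$; (C2) $0<I(\theta,\theta')<\infty$ whenever $\mu(\theta)<\mu(\theta')$; (C3) for all $\epsilon>0$ and $\mu(\theta)<\mu(\theta')$ there is $d>0$ with $|I(\theta,\theta')-I(\theta,\theta'')|<\epsilon$ whenever $\mu(\theta')\le\mu(\theta'')\le\mu(\theta')+d$; (C4) for all $\theta$ and $d>0$ there is $\theta'$ with $\mu(\theta)<\mu(\theta')<\mu(\theta)+d$. Let $h_k$ (point estimates, real) and $g_{t,k}$ (confidence upper bounds, with values in $(-\infty,+\infty]$) be measurable functions of the first $k$ observations of an arm such that (C5), for i.i.d. observations from $P_\theta$ and every $\theta$: (i) $\Pr_\theta\{g_{t,k}\ge r\ \forall k<t\}=1-o(t^{-1})$ for every $r<\mu(\theta)$; (ii) $\lim_{\epsilon\downarrow0}\limsup_{t\to\infty}\frac1{\log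 t}\sum_{k=1}^{t-1}\Pr_\theta\{g_{t,k}\ge\mu(\theta')-\epsilon\}\le 1/I(\theta,\theta')$ whenever $\mu(\theta')>\mu(\theta)$; (iii) $g_{t,k}$ is nondecreasing in $t$; (iv) $g_{t,k}\ge h_k$; (v) $\Pr_\theta\{\max_{dt\le k\le t}|h_k-\mu(\theta)|>\epsilon\}=o(t^{-1})$ for all $\epsilon>0$, $0<d<1$. Arm $n$ has parameter $\theta_n$. Its state $S_n(t)$ in slot $t=1,2,\dots$ has law $P_{\theta_n}$, and the states are independent over time. Let $\sigma$ be a permutation with $\mu(\theta_{\sigma(1)})\ge\dots\ge\mu(\theta_{\sigma(N)})$. Assume that the $M$ best arms have distinct nonnegative means, with no tie at the $M$-th largest mean, that is, $\mu(\theta_{\sigma(1)})>\dots>\mu(\theta_{\sigma(M)})>\mu(\theta_{\sigma(M+1)})$ and $\mu(\theta_{\sigma(M)})\ge0$. Assume moreover that $I(\theta_n,\theta_{\sigma(M)})<I(\theta_n,\theta_{\sigma(j)})$ for every $j<M$ and every arm $n$ with $\mu(\theta_n)<\mu(\theta_{\sigma(M)})$ (which holds whenever $I(\theta,\theta')$ is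 strictly increasing in $\mu(\theta')$ on $\{\theta':\mu(\theta')>\mu(\theta)\}$, e.g. for Gaussian, Bernoulli, Poisson and exponential rewards). **TDFS policy** $\pi_F^*$. Write $k\oslash l=((k-1)\bmod l)+1$ and fix $\delta\in(0,1/N)$. In every slot $t$ each player $i$ chooses an arm $a_i(t)$ from its own past actions and observations only and then observes the state of that arm. Slot $t$ belongs to the subsequence $k=t\oslash M$; let $m_k(t)$ be the number of slots of this subsequence up to and including $t$. If $m_k(t)\le N$, the player plays arm $m_k(t)$. Otherwise it targets at the $j$-th best arm, $j=(k-i+M+1)\oslash M$: let $\mathcal N_t$ be the set of arms that it did not play in the previous $j-1$ slots. Let $m=m_k(t)$ if $j=1$; if $j>1$, let $m$ be the number of slots $s\le t$ of the subsequence $k$ with $m_k(s)>N$ and $\mathcal N_s=\mathcal N_t$. The leader $l_t$ is an arm with the largest point estimate among the arms of $\mathcal N_t$ that the player has played at least $(m-1)\delta$ times before $t$ (ties are broken by a fixed rule), and the round-robin candidate $r_t$ is the arm in position $m\oslash|\mathcal N_t|$ of $\mathcal N_t$. The player plays $l_t$ if its point estimate is larger than the confidence upper bound $g_{t,\tau}$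 of $r_t$, where $\tau$ is the number of past plays of $r_t$ by this player, and it plays $r_t$ otherwise. Estimates and bounds are computed from all past observations that the player has of the arm. **Rewards.** Under collision model 1 the players on the same arm share the reward given by the state of the arm, so that the total reward in slot $t$ is $Y(t)=\sum_n\mathbb I_n(t)S_n(t)$, where $\mathbb I_n(t)$ indicates that at least one player plays arm $n$. Under collision model 2 colliding players obtain nothing, so that $Y(t)=\sum_n\hat{\mathbb I}_n(t)S_n(t)$, where $\hat{\mathbb I}_n(t)$ indicates that exactly one player plays arm $n$. Let $Y_i(t)$ be the (integrable) immediate reward of player $i$. The collision model is fair if, conditionally on the actions of all players in slot $t$, all players on the same arm have the same expected reward. **Theorem 3.** Let the system regret and the local regret of player $i$ under $\pi_F^*$ be $$R_T(\Theta)=T\sum_{j=1}^M\mu(\theta_{\sigma(j)})-\mathbb E\Big[\sum_{t=1}^TY(t)\Big],\qquad R_{T,i}(\Theta)=\frac1M\,T\sum_{j=1}^M\mu(\theta_{\sigma(j)})-\mathbb E\Big[\sum_{t=1}^TY_i(t)\Big].$$ Under a fair collision model (of either kind), for every player $i$, $$\limsup_{T\to\infty}\frac{R_{T,i}(\Theta)}{\log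 T}=\frac1M\limsup_{T\to\infty}\frac{R_T(\Theta)}{\log T}.$$ -/

import Mathlib

open MeasureTheory ProbabilityTheory Filter Topology Asymptotics

noncomputable section

namespace DecMAB

/-! ### Reward models -/

section Model

variable {H : Type*} (law : H → Measure ℝ)

/-- The mean `μ(θ)` of the reward distribution with parameter `θ`. -/
def mean (θ : H) : ℝ := ∫ s, s ∂(law θ)

/-- The Kullback-Leibler distance `I(θ, θ')`, i.e. the mean under `θ` of the logarithm of the
density ratio; it is used where it is finite. -/
def kl (θ θ' : H) : ℝ := (InformationTheory.klDiv (law θ) (law θ')).toReal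

/-- Regularity of the family of reward distributions: existence of the mean, positive and finite
distance, continuity of the distance in its second argument, denseness of the parameter set. -/
structure RegularModel : Prop where
  integrable_id : ∀ θ, Integrable (fun s : ℝ => s) (law θ)
  kl_pos : ∀ θ θ', mean law θ < mean law θ' → 0 < InformationTheory.klDiv (law θ) (law θ')
  kl_finite : ∀ θ θ', mean law θ < mean law θ' → InformationTheory.klDiv (law θ) (law θ') < ⊤
  kl_continuous : ∀ ε : ℝ, 0 < ε → ∀ θ θ', mean law θ < mean law θ' →
    ∃ d : ℝ, 0 < d ∧ ∀ θ'', mean law θ' ≤ mean law θ'' → mean law θ'' ≤ mean law θ' + d →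
      |kl law θ θ' - kl law θ θ''| < ε
  dense : ∀ θ, ∀ d : ℝ, 0 < d → ∃ θ', mean law θ < mean law θ' ∧ mean law θ' < mean law θ + d

/-- The law of a sequence of independent observations `S(1), S(2), …` from the distribution with
parameter `θ` (the observation `S(k)` is the coordinate `k - 1`). -/
def sampleLaw [∀ θ, IsProbabilityMeasure (law θ)] (θ : H) : Measure (ℕ → ℝ) :=
  Measure.infinitePi (fun _ : ℕ => law θ)

/-- The first `k` observations of a sequence. -/
def firstObs (k : ℕ) (s : ℕ → ℝ) : Fin k → ℝ := fun i => s i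

/-- The conditions on the point estimates `h k` and the confidence upper bounds `g t k`, both
functions of the first `k` observations of an arm. The bounds may take the value `+∞`. -/
structure AdmissibleStatistics [∀ θ, IsProbabilityMeasure (law θ)]
    (h : (k : ℕ) → (Fin k → ℝ) → ℝ) (g : ℕ → (k : ℕ) → (Fin k → ℝ) → EReal) : Prop where
  measurable_h : ∀ k, Measurable (h k)
  measurable_g : ∀ t k, Measurable (g t k)
  upper : ∀ θ, ∀ r : ℝ, r < mean law θ →
    (fun t : ℕ => 1 - (sampleLaw law θ).real
      {s | ∀ k, 1 ≤ k → k < t → (r : EReal) ≤ g t k (firstObs k s)})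
      =o[atTop] (fun t : ℕ => (t : ℝ)⁻¹)
  sharp : ∀ θ θ', mean law θ < mean law θ' →
    ∃ L : EReal,
      Tendsto (fun ε : ℝ => limsup (fun t : ℕ =>
        (((∑ k ∈ Finset.Ico 1 t, (sampleLaw law θ).real
          {s | ((mean law θ' - ε : ℝ) : EReal) ≤ g t k (firstObs k s)}) / Real.log t : ℝ) : EReal))
          atTop) (𝓝[>] 0) (𝓝 L) ∧
      L ≤ ((1 / kl law θ θ' : ℝ) : EReal)
  mono : ∀ k, 1 ≤ k → ∀ x : Fin k → ℝ, ∀ t t', 1 ≤ t → t ≤ t' → g t k x ≤ g t' k x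
  le_upper : ∀ t k, 1 ≤ t → 1 ≤ k → ∀ x : Fin k → ℝ, ((h k x : ℝ) : EReal) ≤ g t k x
  consistent : ∀ θ, ∀ ε : ℝ, 0 < ε → ∀ d : ℝ, 0 < d → d < 1 →
    (fun t : ℕ => (sampleLaw law θ).real
      {s | ∃ k : ℕ, d * t ≤ k ∧ k ≤ t ∧ ε < |h k (firstObs k s) - mean law θ|})
      =o[atTop] (fun t : ℕ => (t : ℝ)⁻¹)

end Model

/-! ### Local policies

Slots are numbered `1, 2, …`. Players are `Fin M` and arms are `Fin N`; the player and the arm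
with index `i` are the ones numbered `i + 1`. -/

/-- A local history: the pairs (arm played, observed state) of the past slots, newest first.
A history of length `t - 1` is the one available in slot `t`. -/
abbrev History (N : ℕ) := List (Fin N × ℝ)

/-- A local policy maps the past decisions and observations of a player to the next arm. -/
abbrev LocalPolicy (N : ℕ) := History N → Fin N

/-- The local history after `t` slots of a player who uses the policy `π`, when the state of arm
`n` in slot `s` is `x s n`. -/
def localHistory {N : ℕ} (π : LocalPolicy N) (x : ℕ → Fin N → ℝ) : ℕ → History N
  | 0 => []
  | t + 1 => (π (localHistory π x t), x (t + 1) (π (localHistory π x t))) :: localHistory π x t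

/-- The arm played in slot `t ≥ 1`. -/
def action {N : ℕ} (π : LocalPolicy N) (x : ℕ → Fin N → ℝ) (t : ℕ) : Fin N :=
  π (localHistory π x (t - 1))

/-- The past observations of arm `n`, oldest first; their number is the number of plays. -/
def obs {N : ℕ} (F : History N) (n : Fin N) : List ℝ :=
  ((F.filter (fun p => p.1 = n)).map Prod.snd).reverse

/-! ### The time division fair sharing policy -/

/-- `k ⊘ l = ((k - 1) mod l) + 1`. -/
def oslash (k l : ℕ) : ℕ := (k - 1) % l + 1

/-- The rank `j ∈ {1, …, M}` of the arm that the player with index `i` targets at in slot `t`: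
`j = (k - i' + M + 1) ⊘ M`, where `k = t ⊘ M` is the subsequence of slot `t` and `i' = i + 1` is
the number of the player. -/
def targetRank {M : ℕ} (i : Fin M) (t : ℕ) : ℕ := oslash (oslash t M + M + 1 - (i + 1)) M

/-- The number of slots up to (and including) `t` in the subsequence that contains `t`. -/
def seqCount (M t : ℕ) : ℕ := ((Finset.Icc 1 t).filter (fun s => oslash s M = oslash t M)).card

/-- The arms that remain after removing those played in the last `j - 1` slots of a history. -/
def armSet {N : ℕ} (F : History N) (j : ℕ) : Finset (Fin N) :=
  Finset.univ \ ((F.take (j - 1)).map Prod.fst).toFinset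

/-- The number of slots up to (and including) the current slot `t` that are in the same
mini-sequence: the slots `s` of the same subsequence, after the `N` initial slots of that
subsequence, whose arm set is the same. The history in slot `s` is `F.drop (t - s)`. -/
def miniCount {N : ℕ} (M : ℕ) (F : History N) (j : ℕ) : ℕ :=
  ((Finset.Icc 1 (F.length + 1)).filter (fun s =>
    oslash s M = oslash (F.length + 1) M ∧ N < seqCount M s ∧
      armSet (F.drop (F.length + 1 - s)) j = armSet F j)).card

/-- One decision in a Lai-Robbins procedure on the set `A` of arms, in slot `F.length + 1`, which
is the `m`-th slot of the procedure. The leader is an arm with the largest point estimate among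
the arms of `A` played at least `(m - 1) δ` times (`tie` selects one of the maximizers), the
candidate is the arm in position `m ⊘ |A|` of `A`. -/
def laiRobbins {N : ℕ} [NeZero N] (δ : ℝ) (h : (k : ℕ) → (Fin k → ℝ) → ℝ)
    (g : ℕ → (k : ℕ) → (Fin k → ℝ) → EReal) (tie : Finset (Fin N) → Fin N)
    (A : Finset (Fin N)) (m : ℕ) (F : History N) : Fin N :=
  let est : Fin N → ℝ := fun n => h (obs F n).length (obs F n).get
  let eligible := A.filter (fun n => ((m : ℝ) - 1) * δ ≤ (obs F n).length)
  let leader := tie (eligible.filter (fun n => ∀ n' ∈ eligible, est n' ≤ est n))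
  let cand := (A.sort (· ≤ ·)).getD (oslash m A.card - 1) 0
  if g (F.length + 1) (obs F cand).length (obs F cand).get < ((est leader : ℝ) : EReal)
  then leader else cand

/-- The local policy of player `i` under the time division fair sharing policy. In the first `N`
slots of each subsequence every arm is played once. Afterwards, if the target is the best arm, the
Lai-Robbins procedure runs on all arms along the subsequence; if the target is the `j`-th best
arm, `j ≥ 2`, it runs along the current mini-sequence. -/
def tdfs {M N : ℕ} [NeZero N] (δ : ℝ) (h : (k : ℕ) → (Fin k → ℝ) → ℝ)
    (g : ℕ → (k : ℕ) → (Fin k → ℝ) → EReal) (tie : Finset (Fin N) → Fin N) (i : Fin M) :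
    LocalPolicy N := fun F =>
  let t := F.length + 1
  let j := targetRank i t
  if seqCount M t ≤ N then Fin.ofNat N (seqCount M t - 1)
  else if j = 1 then laiRobbins δ h g tie Finset.univ (seqCount M t) F
  else laiRobbins δ h g tie (armSet F j) (miniCount M F j) F

/-! ### Collisions, rewards and regret -/

/-- The two collision models: colliding players share the reward of the arm, or none of them
obtains any reward. -/
inductive CollisionModel
  | share
  | none

/-- The number of players that play arm `n` under the action profile `b`. -/
def load {M N : ℕ} (b : Fin M → Fin N) (n : Fin N) : ℕ :=
  (Finset.univ.filter (fun i => b i = n)).card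

/-- The reward accrued by all players in a slot with action profile `b` and arm states `y`. -/
def totalReward {M N : ℕ} : CollisionModel → (Fin M → Fin N) → (Fin N → ℝ) → ℝ
  | .share, b, y => ∑ n, if 1 ≤ load b n then y n else 0
  | .none, b, y => ∑ n, if load b n = 1 then y n else 0

/-- The rewards `z i` of the individual players are a division of the rewards that is allowed by
the collision model, given the action profile `b` and the arm states `y`. -/
def IsDivision {M N : ℕ} : CollisionModel → (Fin M → Fin N) → (Fin N → ℝ) → (Fin M → ℝ) → Prop
  | .share, b, y, z => ∀ n, 1 ≤ load b n → ∑ i with b i = n, z i = y n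
  | .none, b, y, z => ∀ i, z i = if load b (b i) = 1 then y (b i) else 0

section Regret

variable {Ω : Type*} [MeasurableSpace Ω] (P : Measure Ω) {M N : ℕ}

/-- `Y i t` are immediate rewards of the players under a fair collision model, for the action
profiles `a t` and the states `S t`: in each slot, whatever the action profile, players on the
same arm have the same (conditional) expected reward. -/
structure FairRewards (c : CollisionModel) (a : ℕ → Ω → Fin M → Fin N) (S : ℕ → Ω → Fin N → ℝ)
    (Y : Fin M → ℕ → Ω → ℝ) : Prop where
  integrable : ∀ i t, 1 ≤ t → Integrable (Y i t) P
  division : ∀ t, 1 ≤ t → ∀ᵐ ω ∂P, IsDivision c (a t ω) (S t ω) (fun i => Y i t ω)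
  fair : ∀ t, 1 ≤ t → ∀ (b : Fin M → Fin N) (i i' : Fin M), b i = b i' →
    ∫ ω in {ω | a t ω = b}, Y i t ω ∂P = ∫ ω in {ω | a t ω = b}, Y i' t ω ∂P

/-- The system regret up to time `T`, relative to the ideal expected reward `best` per slot. -/
def systemRegret (c : CollisionModel) (a : ℕ → Ω → Fin M → Fin N) (S : ℕ → Ω → Fin N → ℝ)
    (best : ℝ) (T : ℕ) : ℝ :=
  T * best - ∫ ω, ∑ t ∈ Finset.Icc 1 T, totalReward c (a t ω) (S t ω) ∂P

/-- The local regret of player `i` up to time `T`, relative to the share `1 / M` of `best`. -/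
def localRegret (Y : Fin M → ℕ → Ω → ℝ) (best : ℝ) (i : Fin M) (T : ℕ) : ℝ :=
  1 / M * T * best - ∫ ω, ∑ t ∈ Finset.Icc 1 T, Y i t ω ∂P

end Regret

end DecMAB

end

/-! Both sides are governed by one constant. Let `n₀` be the `M`-th best arm and let `C` be the sum
of (μ(n₀) - μ(n)) / I(θ_n, θ_{n₀}) over the arms `n` outside the `M` best. Every local regret
divided by `log T` converges to `C` (`System.tendsto_localRegret_div_log`). The system regret is the
sum of the `M` local regrets (`FairRewards.systemRegret_eq_sum`), so divided by `log T` it converges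
to `M * C`.

The targets of a player rotate through the ranks `0, …, M - 1`, and different players always have
different targets. What has to be counted is how often a player misses its target.

The observations that a player has of an arm, continued by unused future states, are an i.i.d.
sequence whatever the policy does (`map_sample`), so the conditions on the statistics apply to them.
If the statistics of all arms are accurate from level `G` on, the right arm is the leader from slot
number constant times `G` of the procedure on (`IsLaiRobbinsRun.action_eq_of_isMature`). Level `m`
is bad with probability `o(1/m)`, so the expected number of bad levels is `o(log T)`. Afterwards a
worse arm is played only while its upper bound still reaches the target mean, and each observation
count is charged at most once. A wrong play at a smaller rank spoils at most one slot at each larger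
rank, so induction on the rank yields `O(log T)` wrong plays (`System.isBigO_wrong`).

The sharp rates use that a player pools its observations of an arm over all its targets. A change of
measure (`tendsto_prob_exists_upper_lt`) keeps the upper bound of an inferior arm above a target
mean while there are fewer than about `log T / I` observations, `I` being the distance to the
target. Hence the arm is played at least about that often, with probability tending to one
(`System.tendsto_prob_plays_le`). For an arm outside the `M` best, the distance to the `M`-th best
is the smallest, so the exploration done for that target exceeds what the better targets require.
The better targets therefore cause only `o(log T)` wrong plays (`System.isLittleO_playsAt`,
`System.isLittleO_wrong`), and the last target causes `log T / I` plays of each such arm to first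
order (`System.tendsto_playsAt_div_log`). Arms among the `M` best are observed often enough as
targets.

A collision requires that some player misses its target in one of the negligible ways, so collisions
cost `o(log T)`. Fairness fixes the expected reward of each player given the action profile. What
remains to order `log T` is the loss at the last target, which is the same for all players. -/

namespace DecMAB

/-! ### Counting along a subsequence -/

section Counting

/-- The number of indices in `[1, t]` that satisfy `Q`. -/
def idx (Q : ℕ → Prop) [DecidablePred Q] (t : ℕ) : ℕ := ((Finset.Icc 1 t).filter Q).card

variable (Q : ℕ → Prop) [DecidablePred Q]

lemma idx_succ (t : ℕ) : idx Q (t + 1) = idx Q t + if Q (t + 1) then 1 else 0 := by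
  unfold idx
  rw [← Finset.insert_Icc_right_eq_Icc_add_one (by omega), Finset.filter_insert]
  split_ifs with h
  · rw [Finset.card_insert_of_notMem (by simp)]
  · rfl

lemma idx_mono : Monotone (idx Q) :=
  monotone_nat_of_le_succ fun t => by rw [idx_succ]; omega

lemma idx_le (t : ℕ) : idx Q t ≤ t := by
  induction t with
  | zero => simp [idx]
  | succ t ih => rw [idx_succ]; split_ifs <;> omega

lemma idx_pos {t : ℕ} (ht : 1 ≤ t) (h : Q t) : 1 ≤ idx Q t := by
  obtain ⟨s, rfl⟩ : ∃ s, t = s + 1 := ⟨t - 1, by omega⟩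
  rw [idx_succ, if_pos h]; omega

/-- The indices that satisfy `Q` are numbered consecutively by `idx Q`. -/
lemma card_filter_idx (R : ℕ → Prop) [DecidablePred R] (t : ℕ) :
    ((Finset.Icc 1 t).filter (fun s => Q s ∧ R (idx Q s))).card =
      ((Finset.Icc 1 (idx Q t)).filter R).card := by
  induction t with
  | zero => simp [idx]
  | succ t ih =>
    rw [← Finset.insert_Icc_right_eq_Icc_add_one (by omega : 1 ≤ t + 1), Finset.filter_insert]
    by_cases h : Q (t + 1)
    · have h1 : idx Q (t + 1) = idx Q t + 1 := by rw [idx_succ, if_pos h]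
      rw [h1, ← Finset.insert_Icc_right_eq_Icc_add_one (by omega : 1 ≤ idx Q t + 1),
        Finset.filter_insert]
      by_cases h2 : R (idx Q t + 1)
      · rw [if_pos ⟨h, h2⟩, if_pos h2, Finset.card_insert_of_notMem (by simp),
          Finset.card_insert_of_notMem (by simp), ih]
      · rw [if_neg (fun h3 => h2 h3.2), if_neg h2, ih]
    · rw [if_neg (fun h3 => h h3.1), ih, idx_succ, if_neg h, add_zero]

/-- The counting identity `card_filter_idx` with `R` the singleton `{m}` shows that exactly one
index carries the number `m`. -/
lemma exists_idx_eq {t m : ℕ} (hm : 1 ≤ m) (hmt : m ≤ idx Q t) :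
    ∃ s, 1 ≤ s ∧ s ≤ t ∧ Q s ∧ idx Q s = m := by
  have h := card_filter_idx Q (fun k => k = m) t
  have h1 : ((Finset.Icc 1 (idx Q t)).filter (fun k => k = m)).card = 1 := by
    refine Finset.card_eq_one.2 ⟨m, ?_⟩
    ext k
    simp only [Finset.mem_filter, Finset.mem_Icc, Finset.mem_singleton]
    omega
  rw [h1] at h
  obtain ⟨s, hs⟩ := Finset.card_eq_one.1 h
  replace hs := hs.symm ▸ Finset.mem_singleton_self s
  simp only [Finset.mem_filter, Finset.mem_Icc] at hs
  exact ⟨s, hs.1.1, hs.1.2, hs.2.1, hs.2.2⟩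

/-- Every window of `L` consecutive numbers meets each residue class modulo `L`. -/
lemma div_le_card_residue {L r : ℕ} (c a b : ℕ) (hr : r < L) :
    (b - a) / L ≤ ((Finset.Ioc a b).filter (fun m => (m - 1 + c) % L = r)).card := by
  have hL : 0 < L := by omega
  -- The first member of the class after `a` is `a + d + 1`. The members `a + d + 1 + k * L` with `k
  -- < (b - a) / L` stay below `b + 1` because `d < L`.
  obtain ⟨d, hd, hdr⟩ : ∃ d, d < L ∧ (a + d + c) % L = r := by
    refine ⟨(r + (L - (a + c) % L)) % L, Nat.mod_lt _ hL, ?_⟩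
    have h1 : (a + c) % L < L := Nat.mod_lt _ hL
    have h2 : (a + (r + (L - (a + c) % L)) % L + c) % L =
        ((a + c) % L + (r + (L - (a + c) % L))) % L := by
      rw [Nat.add_right_comm, Nat.add_mod, Nat.mod_mod, ← Nat.add_mod, Nat.mod_add_mod]
    rw [h2, show (a + c) % L + (r + (L - (a + c) % L)) = r + L by omega, Nat.add_mod_right,
      Nat.mod_eq_of_lt hr]
  calc (b - a) / L = (Finset.range ((b - a) / L)).card := by simp
    _ ≤ _ := by
      refine Finset.card_le_card_of_injOn (fun k => a + d + 1 + k * L) ?_ ?_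
      · intro k hk
        have hk' : k + 1 ≤ (b - a) / L := by simpa using hk
        have h3 : (k + 1) * L ≤ b - a := (Nat.mul_le_mul_right _ hk').trans (Nat.div_mul_le_self _ _)
        rw [add_mul, one_mul] at h3
        simp only [Finset.coe_filter, Finset.mem_Ioc, Set.mem_ofPred_eq]
        refine ⟨⟨by omega, by omega⟩, ?_⟩
        rw [show a + d + 1 + k * L - 1 + c = a + d + c + k * L by omega, Nat.add_mul_mod_self_right,
          hdr]
      · intro k _ l _ h
        have : k * L = l * L := by simpa using h
        exact Nat.eq_of_mul_eq_mul_right hL this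

end Counting

/-! ### Ranks and subsequences -/

section Ranks

variable {M : ℕ}

/-- The rank, counted from `0`, of the arm that player `i` targets at in slot `t`. -/
def rank (i : Fin M) (t : ℕ) : ℕ := (t - 1 + (M - i)) % M

lemma rank_lt (i : Fin M) (t : ℕ) : rank i t < M := Nat.mod_lt _ (Fin.pos i)

lemma targetRank_eq (i : Fin M) (t : ℕ) : targetRank i t = rank i t + 1 := by
  have hi := i.isLt
  unfold targetRank oslash rank
  rw [show (t - 1) % M + 1 + M + 1 - ((i : ℕ) + 1) - 1 = (t - 1) % M + (M - i) by omega,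
    Nat.mod_add_mod]

lemma oslash_eq_iff (i : Fin M) (s t : ℕ) : oslash s M = oslash t M ↔ rank i s = rank i t := by
  unfold oslash rank
  constructor
  · intro h
    exact Nat.ModEq.add_right _ (by simpa using h : (s - 1) % M = (t - 1) % M)
  · intro h
    have h' : (s - 1) % M = (t - 1) % M := Nat.ModEq.add_right_cancel' _ h
    rw [h']

/-- The target rank advances by one per slot and wraps around only after `M - 1`. Hence the `q`
slots before a slot with target `q` were aimed at `0, …, q - 1`, which is what makes removing the
recently played arms meaningful. -/
lemma rank_sub (i : Fin M) {t d : ℕ} (hd : d ≤ rank i t) (ht : d < t) :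
    rank i (t - d) = rank i t - d := by
  have h1 : (t - 1 + (M - i)) = (t - d - 1 + (M - i)) + d := by omega
  have h0 := rank_lt i t
  unfold rank at *
  have h2 := Nat.div_add_mod (t - 1 + (M - i)) M
  set r := (t - 1 + (M - ↑i)) % M
  set k := (t - 1 + (M - ↑i)) / M
  rw [show t - d - 1 + (M - ↑i) = (r - d) + M * k by omega, Nat.add_mul_mod_self_left,
    Nat.mod_eq_of_lt (by omega)]

lemma seqCount_eq_idx (i : Fin M) (t : ℕ) :
    seqCount M t = idx (fun s => rank i s = rank i t) t := by
  unfold seqCount idx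
  congr 1
  exact Finset.filter_congr fun s _ => oslash_eq_iff i s t

/-- Ensures that looking back fewer than `M` slots never leaves the range of genuine slots, where
natural subtraction would truncate. -/
lemma lt_of_one_lt_seqCount {t : ℕ} (h : 1 < seqCount M t) : M < t := by
  by_contra! hle
  have h4 : seqCount M t ≤ 1 := by
    unfold seqCount
    refine Finset.card_le_one.2 fun s hs s' hs' => ?_
    rw [Finset.mem_filter, Finset.mem_Icc] at hs hs'
    unfold oslash at hs hs'
    obtain ⟨⟨h1, h2⟩, h3⟩ := hs
    obtain ⟨⟨h1', h2'⟩, h3'⟩ := hs'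
    rw [← h3, Nat.mod_eq_of_lt (by omega), Nat.mod_eq_of_lt (by omega)] at h3'
    omega
  omega

end Ranks

/-! ### Histories -/

section Histories

variable {N : ℕ} (π : LocalPolicy N) (x : ℕ → Fin N → ℝ)

@[simp] lemma localHistory_length (t : ℕ) : (localHistory π x t).length = t := by
  induction t with
  | zero => rfl
  | succ t ih => simp [localHistory, ih]

lemma localHistory_succ (t : ℕ) : localHistory π x (t + 1) =
    (action π x (t + 1), x (t + 1) (action π x (t + 1))) :: localHistory π x t := rfl

lemma localHistory_congr {x y : ℕ → Fin N → ℝ} {t : ℕ} (h : ∀ s, 1 ≤ s → s ≤ t → x s = y s) :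
    localHistory π x t = localHistory π y t := by
  induction t with
  | zero => rfl
  | succ t ih =>
    have := ih fun s h1 h2 => h s h1 (by omega)
    simp only [localHistory, this, h (t + 1) (by omega) le_rfl]

/-- The number of plays of arm `n` in the first `t` slots. -/
def plays (n : Fin N) (t : ℕ) : ℕ := (obs (localHistory π x t) n).length

lemma obs_succ (n : Fin N) (t : ℕ) : obs (localHistory π x (t + 1)) n =
    if action π x (t + 1) = n then obs (localHistory π x t) n ++ [x (t + 1) n]
    else obs (localHistory π x t) n := by
  rw [localHistory_succ]
  unfold obs
  split_ifs with h
  · rw [List.filter_cons_of_pos (by simpa using h)]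
    simp [h]
  · rw [List.filter_cons_of_neg (by simpa using h)]

lemma plays_succ (n : Fin N) (t : ℕ) :
    plays π x n (t + 1) = plays π x n t + if action π x (t + 1) = n then 1 else 0 := by
  unfold plays
  rw [obs_succ]
  split_ifs <;> simp

lemma plays_eq_idx (n : Fin N) (t : ℕ) :
    plays π x n t = idx (fun s => action π x s = n) t := by
  induction t with
  | zero => rfl
  | succ t ih => rw [plays_succ, idx_succ, ih]

lemma plays_mono (n : Fin N) : Monotone (plays π x n) :=
  monotone_nat_of_le_succ fun t => by rw [plays_succ]; omega

lemma drop_localHistory {s t : ℕ} (h : s ≤ t) :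
    (localHistory π x t).drop (t - s) = localHistory π x s := by
  induction t with
  | zero => obtain rfl : s = 0 := by omega
            rfl
  | succ t ih =>
    rcases Nat.lt_or_ge t s with h1 | h1
    · obtain rfl : s = t + 1 := by omega
      simp
    · rw [localHistory_succ, show t + 1 - s = (t - s) + 1 by omega, List.drop_succ_cons, ih h1]

lemma mem_take_localHistory (n : Fin N) (t q : ℕ) :
    n ∈ ((localHistory π x t).take q).map Prod.fst ↔
      ∃ s, 1 ≤ s ∧ s ≤ t ∧ t < s + q ∧ action π x s = n := by
  induction t generalizing q with
  | zero =>
    simp [localHistory]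
  | succ t ih =>
    cases q with
    | zero =>
      simp
      try omega
    | succ q =>
      rw [localHistory_succ, List.take_succ_cons, List.map_cons, List.mem_cons, ih]
      constructor
      · rintro (h | ⟨s, h1, h2, h3, h4⟩)
        · exact ⟨t + 1, by omega, le_rfl, by omega, h.symm⟩
        · exact ⟨s, h1, by omega, by omega, h4⟩
      · rintro ⟨s, h1, h2, h3, h4⟩
        rcases Nat.lt_or_ge t s with h5 | h5
        · obtain rfl : s = t + 1 := by omega
          exact Or.inl h4.symm
        · exact Or.inr ⟨s, h1, h5, by omega, h4⟩

lemma mem_armSet (n : Fin N) (t q : ℕ) :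
    n ∈ armSet (localHistory π x t) (q + 1) ↔
      ∀ s, 1 ≤ s → s ≤ t → t < s + q → action π x s ≠ n := by
  have := mem_take_localHistory π x n t q
  unfold armSet
  rw [Finset.mem_sdiff, List.mem_toFinset, Nat.add_sub_cancel, this]
  simp

/-- The observations of arm `n` up to slot `T`, continued by the states of arm `n` in the slots
after `T`. -/
def sample (n : Fin N) (T : ℕ) : ℕ → ℝ := fun k =>
  (obs (localHistory π x T) n).getD k (x (T + 1 + (k - plays π x n T)) n)

lemma obs_prefix (n : Fin N) {t T : ℕ} (h : t ≤ T) :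
    obs (localHistory π x t) n <+: obs (localHistory π x T) n := by
  induction T, h using Nat.le_induction with
  | base => exact List.prefix_refl _
  | succ T _ ih =>
    rw [obs_succ]
    split_ifs
    · exact ih.trans (List.prefix_append _ _)
    · exact ih

/-- All observation lists up to the horizon `T` are prefixes of one fixed sequence per arm.
Statistics computed at different times thus become functions of a single random sequence, to which
the i.i.d. conditions apply. -/
lemma obs_get_eq (n : Fin N) {t T : ℕ} (h : t ≤ T) :
    (obs (localHistory π x t) n).get = firstObs (plays π x n t) (sample π x n T) := by
  funext k
  have hp := obs_prefix π x n h
  have hk : (k : ℕ) < (obs (localHistory π x T) n).length := k.isLt.trans_le hp.length_le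
  unfold firstObs sample
  rw [List.getD_eq_getElem _ _ hk, List.get_eq_getElem]
  exact hp.getElem k.isLt

lemma sum_plays (A : Finset (Fin N)) (t : ℕ) :
    ∑ n ∈ A, plays π x n t = idx (fun s => action π x s ∈ A) t := by
  unfold idx
  rw [Finset.card_eq_sum_card_fiberwise (f := action π x) (t := A)
    (by intro s hs; simpa using (Finset.mem_filter.1 hs).2)]
  refine Finset.sum_congr rfl fun n hn => ?_
  rw [plays_eq_idx, idx, Finset.filter_filter]
  congr 1
  refine Finset.filter_congr fun s _ => ⟨fun h => ⟨h ▸ hn, h⟩, fun h => h.2⟩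

end Histories

/-! ### The Lai-Robbins procedure along a subsequence -/

section LaiRobbins

variable {N : ℕ} [NeZero N]

/-- The round-robin candidate of the `m`-th slot of the procedure. -/
def candidate (A : Finset (Fin N)) (m : ℕ) : Fin N :=
  (A.sort (· ≤ ·)).getD (oslash m A.card - 1) 0

lemma candidate_mem {A : Finset (Fin N)} (hA : A.Nonempty) (m : ℕ) : candidate A m ∈ A := by
  have h1 : oslash m A.card - 1 < (A.sort (· ≤ ·)).length := by
    rw [Finset.length_sort, oslash, Nat.add_sub_cancel]
    exact Nat.mod_lt _ hA.card_pos
  unfold candidate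
  rw [List.getD_eq_getElem _ _ h1]
  exact (Finset.mem_sort _).1 (List.getElem_mem h1)

lemma exists_candidate_eq {A : Finset (Fin N)} {n : Fin N} (hn : n ∈ A) :
    ∃ r, r < A.card ∧ ∀ m, (m - 1) % A.card = r → candidate A m = n := by
  obtain ⟨r, hr, h⟩ := List.getElem_of_mem ((Finset.mem_sort (· ≤ ·)).2 hn)
  refine ⟨r, by simpa using hr, fun m hm => ?_⟩
  unfold candidate
  rw [oslash, Nat.add_sub_cancel, hm, List.getD_eq_getElem _ _ hr, h]

variable {δ : ℝ} {h : (k : ℕ) → (Fin k → ℝ) → ℝ} {g : ℕ → (k : ℕ) → (Fin k → ℝ) → EReal}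
  {tie : Finset (Fin N) → Fin N}

lemma laiRobbins_spec (htie : ∀ A : Finset (Fin N), A.Nonempty → tie A ∈ A)
    {A : Finset (Fin N)} {m : ℕ} {F : History N}
    (hne : ∃ n ∈ A, ((m : ℝ) - 1) * δ ≤ (obs F n).length) :
    ∃ l ∈ A, ((m : ℝ) - 1) * δ ≤ (obs F l).length ∧
      (∀ n ∈ A, ((m : ℝ) - 1) * δ ≤ (obs F n).length →
        h _ (obs F n).get ≤ h _ (obs F l).get) ∧
      laiRobbins δ h g tie A m F =
        if g (F.length + 1) _ (obs F (candidate A m)).get < ((h _ (obs F l).get : ℝ) : EReal)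
        then l else candidate A m := by
  set E := A.filter (fun n => ((m : ℝ) - 1) * δ ≤ (obs F n).length) with hE
  set D := E.filter (fun n => ∀ n' ∈ E, h _ (obs F n').get ≤ h _ (obs F n).get) with hD
  have hEne : E.Nonempty := by
    obtain ⟨n, hn, h1⟩ := hne
    exact ⟨n, Finset.mem_filter.2 ⟨hn, h1⟩⟩
  have hDne : D.Nonempty := by
    obtain ⟨n, hn, h1⟩ := E.exists_max_image (fun n => h _ (obs F n).get) hEne
    exact ⟨n, Finset.mem_filter.2 ⟨hn, h1⟩⟩
  have hl := htie D hDne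
  obtain ⟨hlE, hmax⟩ := Finset.mem_filter.1 hl
  obtain ⟨hlA, hlen⟩ := Finset.mem_filter.1 hlE
  exact ⟨tie D, hlA, hlen, fun n hn hn' => hmax n (Finset.mem_filter.2 ⟨hn, hn'⟩), rfl⟩

variable (π : LocalPolicy N) (x : ℕ → Fin N → ℝ)

variable (δ h g tie) in
/-- In the slots that satisfy `Q`, except for the first `b` of them, the policy applies the
Lai-Robbins procedure to the set `A` of arms; in the first `b` slots it plays arms of `A`. -/
structure IsLaiRobbinsRun (A : Finset (Fin N)) (Q : ℕ → Prop) [DecidablePred Q] (b : ℕ) :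
    Prop where
  nonempty : A.Nonempty
  step : ∀ t, 1 ≤ t → Q t → b < idx Q t →
    action π x t = laiRobbins δ h g tie A (idx Q t) (localHistory π x (t - 1))
  init : ∀ t, 1 ≤ t → Q t → idx Q t ≤ b → action π x t ∈ A

namespace IsLaiRobbinsRun

variable {π x} {A : Finset (Fin N)} {Q : ℕ → Prop} [DecidablePred Q] {b : ℕ}

/-- Pigeonhole: the `m - 1` earlier slots of the run all went to arms of `A`, and `|A| δ ≤ N δ < 1`,
so not every arm of `A` can have fewer than `(m - 1) δ` plays. -/
lemma exists_eligible_of_mem (hA : A.Nonempty) (hδ : 0 < δ) (hδN : δ < 1 / N) {t : ℕ}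
    (ht : 1 ≤ t) (hQ : Q t) (hmem : ∀ s, 1 ≤ s → s < t → Q s → action π x s ∈ A) :
    ∃ n ∈ A, ((idx Q t : ℝ) - 1) * δ ≤ (obs (localHistory π x (t - 1)) n).length := by
  by_contra! hcon
  have h1 := Finset.sum_lt_sum_of_nonempty hA hcon
  rw [Finset.sum_const, nsmul_eq_mul] at h1
  have h2 : idx Q (t - 1) ≤ ∑ n ∈ A, plays π x n (t - 1) := by
    rw [sum_plays]
    refine Finset.card_le_card fun s hs => ?_
    simp only [Finset.mem_filter, Finset.mem_Icc] at hs ⊢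
    exact ⟨hs.1, hmem s hs.1.1 (by omega) hs.2⟩
  have h3 : idx Q t = idx Q (t - 1) + 1 := by
    obtain ⟨s, rfl⟩ : ∃ s, t = s + 1 := ⟨t - 1, by omega⟩
    rw [idx_succ, if_pos hQ]; rfl
  have h4 : ((idx Q (t - 1) : ℕ) : ℝ) ≤
      ∑ n ∈ A, ((obs (localHistory π x (t - 1)) n).length : ℝ) := by
    exact_mod_cast h2
  rw [h3] at h1
  push_cast at h1
  have hN : (0 : ℝ) < N := by exact_mod_cast Nat.pos_of_ne_zero (NeZero.ne N)
  have hcard : (A.card : ℝ) ≤ N := by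
    exact_mod_cast (Finset.card_le_univ A).trans (by simp)
  have h5 : (N : ℝ) * δ < 1 := by
    rw [lt_div_iff₀ hN] at hδN; linarith
  have h6 : (A.card : ℝ) * δ ≤ 1 := (mul_le_mul_of_nonneg_right hcard hδ.le).trans h5.le
  have h7 : (0 : ℝ) ≤ idx Q (t - 1) := Nat.cast_nonneg _
  nlinarith

/-- The leader lies in `A` only if some arm is eligible, and eligibility relies on the earlier plays
of the run being in `A`. Strong induction on the slot resolves this dependence. -/
lemma action_mem (hrun : IsLaiRobbinsRun δ h g tie π x A Q b) (hδ : 0 < δ) (hδN : δ < 1 / N)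
    (htie : ∀ A : Finset (Fin N), A.Nonempty → tie A ∈ A) {t : ℕ} (ht : 1 ≤ t) (hQ : Q t) :
    action π x t ∈ A := by
  induction t using Nat.strong_induction_on with
  | _ t ih =>
    rcases Nat.lt_or_ge b (idx Q t) with hb | hb
    · obtain ⟨l, hl, -, -, h1⟩ := laiRobbins_spec (h := h) (g := g) htie
        (exists_eligible_of_mem hrun.nonempty hδ hδN ht hQ fun s h1 h2 h3 => ih s h2 h1 h3)
      rw [hrun.step t ht hQ hb, h1]
      split_ifs
      · exact hl
      · exact candidate_mem hrun.nonempty _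
    · exact hrun.init t ht hQ hb

lemma spec (hrun : IsLaiRobbinsRun δ h g tie π x A Q b) (hδ : 0 < δ) (hδN : δ < 1 / N)
    (htie : ∀ A : Finset (Fin N), A.Nonempty → tie A ∈ A) {t T : ℕ} (ht : 1 ≤ t) (htT : t ≤ T + 1)
    (hQ : Q t) (hb : b < idx Q t) :
    ∃ l ∈ A, ((idx Q t : ℝ) - 1) * δ ≤ plays π x l (t - 1) ∧
      (∀ n ∈ A, ((idx Q t : ℝ) - 1) * δ ≤ plays π x n (t - 1) →
        h (plays π x n (t - 1)) (firstObs _ (sample π x n T)) ≤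
          h (plays π x l (t - 1)) (firstObs _ (sample π x l T))) ∧
      action π x t =
        if g t (plays π x (candidate A (idx Q t)) (t - 1))
            (firstObs _ (sample π x (candidate A (idx Q t)) T)) <
          ((h (plays π x l (t - 1)) (firstObs _ (sample π x l T)) : ℝ) : EReal)
        then l else candidate A (idx Q t) := by
  obtain ⟨l, hl, h1, h2, h3⟩ := laiRobbins_spec (h := h) (g := g) htie
    (exists_eligible_of_mem hrun.nonempty hδ hδN ht hQ
      fun s h1 _ h3 => hrun.action_mem hδ hδN htie h1 h3)
  rw [localHistory_length, Nat.sub_add_cancel ht] at h3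
  simp only [obs_get_eq π x _ (show t - 1 ≤ T by omega)] at h2 h3
  exact ⟨l, hl, h1, h2, (hrun.step t ht hQ hb).trans h3⟩

end IsLaiRobbinsRun

/-- From level `G` on, the point estimates are within `ε` of the means, and the upper bounds
exceed the means minus `ε`. -/
structure ConcentratedFrom (h : (k : ℕ) → (Fin k → ℝ) → ℝ)
    (g : ℕ → (k : ℕ) → (Fin k → ℝ) → EReal) (μ : Fin N → ℝ) (ξ : Fin N → ℕ → ℝ) (ε : ℝ) (G : ℕ) :
    Prop where
  est : ∀ n k, G ≤ k → |h k (firstObs k (ξ n)) - μ n| ≤ ε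
  upper : ∀ n t k, G ≤ t → 1 ≤ k → ((μ n - ε : ℝ) : EReal) ≤ g t k (firstObs k (ξ n))

/-- Constants for which the best arm is the leader: `m` is the number of a slot, and the
estimates are accurate from the slot with number `m₁` on. -/
structure IsMature (N : ℕ) (δ : ℝ) (G m₁ m : ℕ) : Prop where
  lt : N < m₁
  le : m₁ ≤ m
  level_le : G ≤ m₁
  level : (G : ℝ) ≤ (m₁ - 1) * δ
  share : ∀ L : ℕ, 1 ≤ L → L ≤ N → ((m : ℝ) - 1) * δ ≤ ((m - m₁) / L : ℕ)

/-- With `m₁` of order `G / δ`, eligibility from slot number `m₁` on forces at least `G` plays.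
Between `m₁` and `m` each arm is the round-robin candidate about `(m - m₁) / L` times with `L ≤ N`,
and since `δ < 1 / N` this exceeds `(m - 1) δ` once `m` is a fixed multiple of `G`. Linearity in `G`
matters: an expected `o(log T)` of bad levels then costs only `o(log T)` slots. -/
lemma exists_isMature (hδ : 0 < δ) (hδN : δ < 1 / N) :
    ∃ C : ℕ, 1 ≤ C ∧ ∀ G m, 1 ≤ G → C * G ≤ m → ∃ m₁, IsMature N δ G m₁ m := by
  have hN : (1 : ℝ) ≤ N := by exact_mod_cast Nat.one_le_iff_ne_zero.2 (NeZero.ne N)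
  have hN0 : (0 : ℝ) < N := by linarith
  have hd : 0 < 1 - N * δ := by
    rw [lt_div_iff₀ hN0] at hδN; linarith
  have hδ1 : δ ≤ 1 := hδN.le.trans (by rw [div_le_one hN0]; exact hN)
  -- Since `G ≥ 1`, the bracket times `G` dominates `m₁ = ⌈G / δ⌉ + 1 + N`, and the last `N` pays
  -- for rounding in the division by `L`. The inequality needed at the end is `m₁ + N ≤ m (1 - N
  -- δ)`.
  set K : ℝ := (1 / δ + 2 + N) + N with hK
  have hKpos : 0 < K := by positivity
  have hdle : 1 - N * δ ≤ 1 := by nlinarith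
  refine ⟨⌈K / (1 - N * δ)⌉₊ + 1, by omega, fun G m hG hm => ⟨⌈G / δ⌉₊ + 1 + N, ?_⟩⟩
  have hG' : (1 : ℝ) ≤ G := by exact_mod_cast hG
  have hc0 : (G : ℝ) / δ ≤ ⌈G / δ⌉₊ := Nat.le_ceil _
  have hc1 : (⌈G / δ⌉₊ : ℝ) < G / δ + 1 := Nat.ceil_lt_add_one (by positivity)
  have hm' : K / (1 - N * δ) * G ≤ m := by
    have h1 : K / (1 - N * δ) ≤ ((⌈K / (1 - N * δ)⌉₊ + 1 : ℕ) : ℝ) := by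
      push_cast; exact (Nat.le_ceil _).trans (by linarith)
    calc K / (1 - N * δ) * G ≤ ((⌈K / (1 - N * δ)⌉₊ + 1 : ℕ) : ℝ) * G := by gcongr
      _ ≤ m := by exact_mod_cast hm
  have hm2 : K * G ≤ m * (1 - N * δ) := by
    rw [div_mul_eq_mul_div, div_le_iff₀ hd] at hm'; exact hm'
  have hm1 : ((⌈G / δ⌉₊ + 1 + N : ℕ) : ℝ) + N ≤ K * G := by
    push_cast
    have : K * G = G / δ + 2 * G + N * G + N * G := by rw [hK]; ring
    nlinarith
  have hle : ⌈G / δ⌉₊ + 1 + N ≤ m := by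
    have : ((⌈G / δ⌉₊ + 1 + N : ℕ) : ℝ) ≤ m := by
      have : (0 : ℝ) ≤ m := Nat.cast_nonneg _
      nlinarith
    exact_mod_cast this
  have hGle : (G : ℝ) ≤ G / δ := by
    rw [le_div_iff₀ hδ]; nlinarith
  refine ⟨by omega, hle, ?_, ?_, fun L hL hLN => ?_⟩
  · have : (G : ℝ) ≤ ⌈G / δ⌉₊ := hGle.trans hc0
    have : G ≤ ⌈G / δ⌉₊ := by exact_mod_cast this
    omega
  · push_cast
    have h1 : (G : ℝ) = G / δ * δ := by field_simp
    have h2 : (G : ℝ) / δ * δ ≤ (⌈G / δ⌉₊ + 1 + N - 1) * δ := by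
      apply mul_le_mul_of_nonneg_right _ hδ.le
      linarith
    linarith
  · set m₁ := ⌈G / δ⌉₊ + 1 + N
    have hL0 : (0 : ℝ) < L := by exact_mod_cast hL
    have hLN' : (L : ℝ) ≤ N := by exact_mod_cast hLN
    have h1 : ((m - m₁ : ℕ) : ℝ) / L - 1 < ((m - m₁) / L : ℕ) := by
      have := Nat.lt_div_mul_add (a := m - m₁) hL
      have h2 : ((m - m₁ : ℕ) : ℝ) < ((m - m₁) / L : ℕ) * L + L := by exact_mod_cast this
      rw [sub_lt_iff_lt_add, div_lt_iff₀ hL0]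
      linarith
    refine le_trans ?_ h1.le
    rw [Nat.cast_sub hle]
    have h3 : ((m : ℝ) - m₁) / N ≤ ((m : ℝ) - m₁) / L := by
      apply div_le_div_of_nonneg_left _ hL0 hLN'
      rw [sub_nonneg]; exact_mod_cast hle
    have h4 : (m : ℝ) * δ ≤ ((m : ℝ) - m₁) / N - 1 := by
      rw [le_sub_iff_add_le, le_div_iff₀ hN0]
      nlinarith
    nlinarith

namespace IsLaiRobbinsRun

variable {π x} {A : Finset (Fin N)} {Q : ℕ → Prop} [DecidablePred Q] {b : ℕ}

/-- Once the procedure is mature, the best arm of the set is the leader. -/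
lemma action_eq_of_isMature (hrun : IsLaiRobbinsRun δ h g tie π x A Q b) (hδ : 0 < δ)
    (hδN : δ < 1 / N) (htie : ∀ A : Finset (Fin N), A.Nonempty → tie A ∈ A)
    {μ : Fin N → ℝ} {ε : ℝ} {G m₁ t T : ℕ}
    (hconc : ConcentratedFrom h g μ (fun n => sample π x n T) ε G)
    {n₀ : Fin N} (hn₀ : n₀ ∈ A) (hbest : ∀ n ∈ A, n ≠ n₀ → μ n + ε < μ n₀ - ε)
    (hbN : b ≤ N) (ht : 1 ≤ t) (htT : t ≤ T) (hQ : Q t) (hmat : IsMature N δ G m₁ (idx Q t))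
    (hplays : ∀ s, 1 ≤ s → s ≤ t → Q s → N < idx Q s → 1 ≤ plays π x n₀ (s - 1)) :
    G ≤ plays π x n₀ (t - 1) ∧ action π x t =
        if g t (plays π x (candidate A (idx Q t)) (t - 1))
            (firstObs _ (sample π x (candidate A (idx Q t)) T)) <
          ((h (plays π x n₀ (t - 1)) (firstObs _ (sample π x n₀ T)) : ℝ) : EReal)
        then n₀ else candidate A (idx Q t) := by
  -- Any arm eligible in a slot with number at least `m₁` has reached the level at which its
  -- estimate is accurate.
  have hlev : ∀ m : ℕ, m₁ ≤ m → ∀ k : ℕ, ((m : ℝ) - 1) * δ ≤ k → G ≤ k := by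
    intro m hm k hk
    have h1 : (m₁ : ℝ) ≤ m := by exact_mod_cast hm
    have h2 : (G : ℝ) ≤ k :=
      hmat.level.trans ((mul_le_mul_of_nonneg_right (by linarith) hδ.le).trans hk)
    exact_mod_cast h2
  -- The best arm is played at each of its turns as candidate: another leader has an estimate below
  -- `μ n₀ - ε`, which the upper bound of `n₀` reaches.
  have hcand : ∀ s, 1 ≤ s → s ≤ t → Q s → m₁ ≤ idx Q s → candidate A (idx Q s) = n₀ →
      action π x s = n₀ := by
    intro s hs hst hQs hms hc
    obtain ⟨l, hl, hl1, -, hact⟩ := hrun.spec hδ hδN htie hs (show s ≤ T + 1 by omega) hQs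
      (by have := hmat.lt; omega)
    rw [hc] at hact
    rw [hact]
    split_ifs with hlt
    · by_contra hne
      have h1 := hconc.est l _ (hlev _ hms _ hl1)
      have h2 := hconc.upper n₀ s _ (hmat.level_le.trans (hms.trans (idx_le Q s)))
        (hplays s hs hst hQs (by have := hmat.lt; omega))
      have h3 := EReal.coe_lt_coe_iff.1 (h2.trans_lt hlt)
      have h4 := hbest l hl hne
      have h5 := (abs_le.1 h1).2
      linarith
    · rfl
  -- The turns as candidate from number `m₁` on suffice to make `n₀` eligible in slot `t`. They form
  -- a residue class modulo the number of arms.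
  have hcount : ((idx Q t : ℝ) - 1) * δ ≤ plays π x n₀ (t - 1) := by
    obtain ⟨r, hr, hr'⟩ := exists_candidate_eq hn₀
    refine (hmat.share A.card hrun.nonempty.card_pos
      ((Finset.card_le_univ A).trans (by simp))).trans ?_
    have h1 := div_le_card_residue 0 (m₁ - 1) (idx Q t - 1) hr
    have h2 := card_filter_idx Q (fun m => m₁ ≤ m ∧ m < idx Q t ∧ candidate A m = n₀) t
    have hm1 := hmat.lt
    have h3 : ((Finset.Ioc (m₁ - 1) (idx Q t - 1)).filter
        (fun m => (m - 1 + 0) % A.card = r)).card ≤ ((Finset.Icc 1 (idx Q t)).filter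
        (fun m => m₁ ≤ m ∧ m < idx Q t ∧ candidate A m = n₀)).card := by
      refine Finset.card_le_card fun m hm => ?_
      rw [Finset.mem_filter, Finset.mem_Ioc] at hm
      rw [Finset.mem_filter, Finset.mem_Icc]
      exact ⟨by omega, by omega, by omega, hr' m hm.2⟩
    have h4 : ((Finset.Icc 1 t).filter (fun s => Q s ∧ (m₁ ≤ idx Q s ∧ idx Q s < idx Q t ∧
        candidate A (idx Q s) = n₀))).card ≤ plays π x n₀ (t - 1) := by
      rw [plays_eq_idx]
      refine Finset.card_le_card fun s hs => ?_
      rw [Finset.mem_filter, Finset.mem_Icc] at hs ⊢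
      obtain ⟨⟨hs1, hs2⟩, hs3, hs4, hs5, hs6⟩ := hs
      have hne : s ≠ t := by rintro rfl; omega
      exact ⟨by omega, hcand s hs1 hs2 hs3 hs4 hs6⟩
    rw [show idx Q t - 1 - (m₁ - 1) = idx Q t - m₁ by omega] at h1
    exact_mod_cast h1.trans (h3.trans (h2.symm.le.trans h4))
  refine ⟨hlev _ hmat.le _ hcount, ?_⟩
  obtain ⟨l, hl, hl1, hl2, hact⟩ := hrun.spec hδ hδN htie ht (show t ≤ T + 1 by omega) hQ
    (by have := hmat.lt; have := hmat.le; omega)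
  -- Both `l` and `n₀` are eligible with accurate estimates, so an inferior `l` could not have the
  -- larger estimate.
  suffices l = n₀ by subst this; exact hact
  by_contra hne
  have h1 := (abs_le.1 (hconc.est l _ (hlev _ hmat.le _ hl1))).2
  have h2 := (abs_le.1 (hconc.est n₀ _ (hlev _ hmat.le _ hcount))).1
  have h3 := hl2 n₀ hn₀ hcount
  have h4 := hbest l hl hne
  linarith

end IsLaiRobbinsRun

end LaiRobbins

/-! ### Sample paths of the time division fair sharing policy -/

section TDFS

variable {M N : ℕ} [NeZero N] (δ : ℝ) (h : (k : ℕ) → (Fin k → ℝ) → ℝ)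
  (g : ℕ → (k : ℕ) → (Fin k → ℝ) → EReal) (tie : Finset (Fin N) → Fin N) (i : Fin M)
  (x : ℕ → Fin N → ℝ) (σ : Equiv.Perm (Fin N))

/-- The arms whose rank, counted from `0`, is at least `q`. -/
def remaining (σ : Equiv.Perm (Fin N)) (q : ℕ) : Finset (Fin N) :=
  Finset.univ.filter (fun n => q ≤ (σ.symm n : ℕ))

omit [NeZero N] in
lemma mem_remaining {q : ℕ} {n : Fin N} : n ∈ remaining σ q ↔ q ≤ (σ.symm n : ℕ) := by
  simp [remaining]

/-- The slots in which the target has rank `q` and another arm is played. -/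
def Wrong (q t : ℕ) : Prop :=
  rank i t = q ∧ (σ.symm (action (tdfs δ h g tie i) x t) : ℕ) ≠ q

noncomputable instance (q : ℕ) : DecidablePred (Wrong δ h g tie i x σ q) := fun t => by
  unfold Wrong; infer_instance

/-- The slots in which the target has rank `q` and the arms of smaller rank have been removed. -/
def ProcSlot (q t : ℕ) : Prop :=
  rank i t = q ∧ (q = 0 ∨ (N < seqCount M t ∧
    armSet (localHistory (tdfs δ h g tie i) x (t - 1)) (q + 1) = remaining σ q))

noncomputable instance (q : ℕ) : DecidablePred (ProcSlot δ h g tie i x σ q) := fun t => by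
  unfold ProcSlot; infer_instance

/-- The slots of the procedure with target of rank `q` from slot number `m` on. -/
def LateSlot (q m t : ℕ) : Prop :=
  ProcSlot δ h g tie i x σ q t ∧ N < seqCount M t ∧ m ≤ idx (ProcSlot δ h g tie i x σ q) t

noncomputable instance (q m : ℕ) : DecidablePred (LateSlot δ h g tie i x σ q m) := fun t => by
  unfold LateSlot; infer_instance

lemma tdfs_eq (F : History N) : tdfs δ h g tie i F =
    if seqCount M (F.length + 1) ≤ N then Fin.ofNat N (seqCount M (F.length + 1) - 1)
    else if rank i (F.length + 1) = 0 then
      laiRobbins δ h g tie Finset.univ (seqCount M (F.length + 1)) F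
    else laiRobbins δ h g tie (armSet F (rank i (F.length + 1) + 1))
      (miniCount M F (rank i (F.length + 1) + 1)) F := by
  unfold tdfs
  simp only [targetRank_eq, Nat.add_eq_right]

lemma action_of_seqCount_le {t : ℕ} (ht : 1 ≤ t) (hs : seqCount M t ≤ N) :
    action (tdfs δ h g tie i) x t = Fin.ofNat N (seqCount M t - 1) := by
  rw [action, tdfs_eq, localHistory_length, Nat.sub_add_cancel ht, if_pos hs]

/-- The first `N` slots of the subsequence that contains `t` visit every arm once. The conditions on
the upper bounds concern counts `k ≥ 1` only. -/
lemma one_le_plays {t : ℕ} (ht : 1 ≤ t) (hs : N < seqCount M t) (n : Fin N) :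
    1 ≤ plays (tdfs δ h g tie i) x n (t - 1) := by
  rw [seqCount_eq_idx i] at hs
  obtain ⟨s, hs1, hst, hr, hsi⟩ := exists_idx_eq (fun s => rank i s = rank i t)
    (show 1 ≤ (n : ℕ) + 1 by omega) (t := t) (by have := n.isLt; omega)
  have hsc : seqCount M s = n + 1 := by
    rw [seqCount_eq_idx i, hr]; exact hsi
  have hne : s ≠ t := by
    rintro rfl
    have := n.isLt
    omega
  have hact : action (tdfs δ h g tie i) x s = n := by
    rw [action_of_seqCount_le δ h g tie i x hs1 (by rw [hsc]; exact n.isLt), hsc]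
    ext
    simp
  rw [plays_eq_idx]
  exact Finset.card_pos.2 ⟨s, Finset.mem_filter.2 ⟨Finset.mem_Icc.2 ⟨hs1, by omega⟩, hact⟩⟩

/-- If none of the preceding `q` slots missed its target, the removed arms are exactly those of rank
`0, …, q - 1`. -/
lemma armSet_eq_remaining {q t : ℕ} (hs : N < seqCount M t) (hr : rank i t = q)
    (hw : ∀ q' < q, ¬ Wrong δ h g tie i x σ q' (t - (q - q'))) :
    armSet (localHistory (tdfs δ h g tie i) x (t - 1)) (q + 1) = remaining σ q := by
  have hMt : M < t := lt_of_one_lt_seqCount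
    ((Nat.one_le_iff_ne_zero.2 (NeZero.ne N)).trans_lt hs)
  have hqM : q < M := hr ▸ rank_lt i t
  have hact : ∀ q' < q, (σ.symm (action (tdfs δ h g tie i) x (t - (q - q'))) : ℕ) = q' := by
    intro q' hq'
    by_contra hne
    refine hw q' hq' ⟨?_, hne⟩
    rw [rank_sub i (by omega) (by omega)]
    omega
  ext n
  rw [mem_armSet, mem_remaining]
  constructor
  · intro hn
    by_contra! hlt
    refine hn (t - (q - (σ.symm n : ℕ))) (by omega) (by omega) (by omega) ?_
    exact σ.symm.injective (Fin.ext (hact _ hlt))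
  · rintro hn s hs1 hs2 hs3 rfl
    have := hact (q - (t - s)) (by omega)
    rw [show t - (q - (q - (t - s))) = s by omega] at this
    omega

lemma idx_procSlot_zero {t : ℕ} (hr : rank i t = 0) :
    idx (ProcSlot δ h g tie i x σ 0) t = seqCount M t := by
  rw [seqCount_eq_idx i]
  unfold idx
  congr 1
  refine Finset.filter_congr fun s _ => ?_
  simp [ProcSlot, hr]

/-- In a slot whose arm set is the correct one, the earlier slots of the same mini-sequence are
exactly those in which the arm set was correct. The counter of the policy is therefore the index
along `ProcSlot`. -/
lemma idx_procSlot_pos {q t : ℕ} (hq : q ≠ 0) (ht : 1 ≤ t) (hp : ProcSlot δ h g tie i x σ q t) :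
    miniCount M (localHistory (tdfs δ h g tie i) x (t - 1)) (q + 1) =
      idx (ProcSlot δ h g tie i x σ q) t := by
  unfold miniCount idx
  rw [localHistory_length, Nat.sub_add_cancel ht]
  congr 1
  refine Finset.filter_congr fun s hs => ?_
  rw [Finset.mem_Icc] at hs
  rw [show t - s = t - 1 - (s - 1) by omega, drop_localHistory _ _ (by omega),
    oslash_eq_iff i, hp.1]
  rw [(hp.2.resolve_left hq).2]
  simp [ProcSlot, hq]

/-- Along its subsequence the policy follows the Lai-Robbins procedure on the remaining arms. -/
lemma isLaiRobbinsRun {q : ℕ} (hq : q < N) :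
    IsLaiRobbinsRun δ h g tie (tdfs δ h g tie i) x (remaining σ q) (ProcSlot δ h g tie i x σ q)
      (if q = 0 then N else 0) where
  nonempty := ⟨σ ⟨q, hq⟩, by simp [mem_remaining]⟩
  step := by
    intro t ht hp hb
    have hr := hp.1
    rw [action, tdfs_eq, localHistory_length, Nat.sub_add_cancel ht, hr]
    -- For the best target the counter of the procedure includes the `N` initial slots, which is why
    -- the run has an initial stretch of length `N`. Mini-sequences start after these slots and have
    -- none.
    by_cases hq0 : q = 0
    · subst hq0
      rw [if_pos rfl] at hb
      rw [idx_procSlot_zero δ h g tie i x σ hr] at hb ⊢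
      rw [if_neg (by omega), if_pos rfl]
      congr 1
      ext n
      simp [remaining]
    · have h2 := hp.2.resolve_left hq0
      rw [if_neg (by omega), if_neg hq0, idx_procSlot_pos δ h g tie i x σ hq0 ht hp, h2.2]
  init := by
    intro t ht hp hb
    split_ifs at hb with hq0
    · subst hq0
      simp [remaining]
    · have := idx_pos _ ht hp
      omega

lemma lt_seqCount_of_procSlot {q t : ℕ} (hp : ProcSlot δ h g tie i x σ q t)
    (hN : N < idx (ProcSlot δ h g tie i x σ q) t) : N < seqCount M t := by
  by_cases hq0 : q = 0
  · subst hq0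
    rwa [idx_procSlot_zero δ h g tie i x σ hp.1] at hN
  · exact (hp.2.resolve_left hq0).1

omit [NeZero N] in
lemma idx_rank_seqCount_le (q T : ℕ) :
    idx (fun t => rank i t = q ∧ seqCount M t ≤ N) T ≤ N := by
  have h1 := card_filter_idx (fun t => rank i t = q) (fun m => m ≤ N) T
  have h2 : idx (fun t => rank i t = q ∧ seqCount M t ≤ N) T =
      ((Finset.Icc 1 T).filter
        (fun t => rank i t = q ∧ idx (fun t => rank i t = q) t ≤ N)).card := by
    unfold idx
    congr 1
    refine Finset.filter_congr fun s _ => and_congr_right fun hs => ?_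
    rw [seqCount_eq_idx i, hs]; rfl
  rw [h2, h1]
  calc _ ≤ (Finset.Icc 1 N).card := Finset.card_le_card fun m hm => by
        rw [Finset.mem_filter, Finset.mem_Icc] at hm
        exact Finset.mem_Icc.2 ⟨hm.1.1, hm.2⟩
    _ = N := by simp

/-- A spoiled arm set at rank `q` is charged to a wrong play at some rank `q' < q` exactly `q - q'`
slots earlier. For fixed `q'` this shift is injective, so each wrong play is charged at most once.
-/
lemma card_wrong_armSet_le {q : ℕ} (hq : q < M) (T : ℕ) :
    ((Finset.Icc 1 T).filter (fun t => N < seqCount M t ∧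
      ∃ q' < q, Wrong δ h g tie i x σ q' (t - (q - q')))).card ≤
      ∑ q' ∈ Finset.range q, idx (Wrong δ h g tie i x σ q') T := by
  classical
  calc _ ≤ ((Finset.range q).biUnion fun q' => (Finset.Icc 1 T).filter
        (fun t => N < seqCount M t ∧ rank i (t - (q - q')) = q' ∧
          Wrong δ h g tie i x σ q' (t - (q - q')))).card := by
        refine Finset.card_le_card fun t ht => ?_
        rw [Finset.mem_filter] at ht
        obtain ⟨ht1, ht2, q', hq', hw⟩ := ht
        exact Finset.mem_biUnion.2 ⟨q', Finset.mem_range.2 hq',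
          Finset.mem_filter.2 ⟨ht1, ht2, hw.1, hw⟩⟩
    _ ≤ _ := Finset.card_biUnion_le
    _ ≤ _ := by
        refine Finset.sum_le_sum fun q' hq' => ?_
        have hq' := Finset.mem_range.1 hq'
        have hqM : q - q' ≤ M := by omega
        · refine Finset.card_le_card_of_injOn (fun t => t - (q - q')) ?_ ?_
          · intro t ht
            rw [Finset.mem_coe, Finset.mem_filter, Finset.mem_Icc] at ht
            obtain ⟨ht1, ht2, -, hw⟩ := ht
            have hMt : M < t := lt_of_one_lt_seqCount
              ((Nat.one_le_iff_ne_zero.2 (NeZero.ne N)).trans_lt ht2)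
            exact Finset.mem_coe.2 (Finset.mem_filter.2
              ⟨Finset.mem_Icc.2 ⟨by simp only; omega, by simp only; omega⟩, hw⟩)
          · intro s hs t ht hst
            rw [Finset.mem_coe, Finset.mem_filter] at hs ht
            have hMt : M < t := lt_of_one_lt_seqCount
              ((Nat.one_le_iff_ne_zero.2 (NeZero.ne N)).trans_lt ht.2.1)
            have hMs : M < s := lt_of_one_lt_seqCount
              ((Nat.one_le_iff_ne_zero.2 (NeZero.ne N)).trans_lt hs.2.1)
            simp only at hst
            omega


/-- A slot aimed at rank `q` is an initial slot, or comes after a wrong play in its cycle, or is an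
early slot of the procedure, or is late. Only in the last case does `R` have to be examined. -/
lemma idx_rank_le {q : ℕ} (hq : q < M) (m T : ℕ) (R : ℕ → Prop) [DecidablePred R] :
    idx (fun t => rank i t = q ∧ R t) T ≤
      N + ∑ q' ∈ Finset.range q, idx (Wrong δ h g tie i x σ q') T + m +
        idx (fun t => LateSlot δ h g tie i x σ q m t ∧ R t) T := by
  have h1 := idx_rank_seqCount_le (N := N) i q T
  have h2 := card_wrong_armSet_le δ h g tie i x σ hq T
  have h3 := card_filter_idx (ProcSlot δ h g tie i x σ q) (fun k => k < m) T
  have h4 : ((Finset.Icc 1 (idx (ProcSlot δ h g tie i x σ q) T)).filter (fun k => k < m)).card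
      ≤ m := by
    calc _ ≤ (Finset.range m).card := Finset.card_le_card fun k hk => by
          rw [Finset.mem_filter] at hk
          exact Finset.mem_range.2 hk.2
      _ = m := by simp
  rw [← h3] at h4
  refine le_trans ?_ (Nat.add_le_add (Nat.add_le_add (Nat.add_le_add h1 h2) h4) le_rfl)
  classical
  unfold idx
  refine le_trans (Finset.card_le_card ?_) ((Finset.card_union_le _ _).trans
    (Nat.add_le_add ((Finset.card_union_le _ _).trans
    (Nat.add_le_add (Finset.card_union_le _ _) le_rfl)) le_rfl))
  intro t ht
  obtain ⟨htT, hr, hR⟩ := Finset.mem_filter.1 ht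
  simp only [Finset.mem_union, Finset.mem_filter, htT, true_and]
  by_cases hs : seqCount M t ≤ N
  · exact Or.inl (Or.inl (Or.inl ⟨hr, hs⟩))
  push Not at hs
  by_cases hw : ∃ q' < q, Wrong δ h g tie i x σ q' (t - (q - q'))
  · exact Or.inl (Or.inl (Or.inr ⟨hs, hw⟩))
  have hp : ProcSlot δ h g tie i x σ q t := by
    refine ⟨hr, Or.inr ⟨hs, armSet_eq_remaining δ h g tie i x σ hs hr ?_⟩⟩
    push Not at hw
    exact hw
  rcases Nat.lt_or_ge (idx (ProcSlot δ h g tie i x σ q) t) m with hm | hm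
  · exact Or.inl (Or.inr ⟨hp, hm⟩)
  · exact Or.inr ⟨⟨hp, hs, hm⟩, hR⟩

/-! ### Decisions in late slots -/

section Late

variable {δ h g tie i x σ} {μ : Fin N → ℝ} {ε : ℝ} {C G T q : ℕ} {n₀ : Fin N}

/-- In late slots the arm of rank `q` is the leader, and its point estimate is accurate. -/
lemma exists_action_eq_of_lateSlot (hδ : 0 < δ) (hδN : δ < 1 / N)
    (htie : ∀ A : Finset (Fin N), A.Nonempty → tie A ∈ A)
    (hC : ∀ G m, 1 ≤ G → C * G ≤ m → ∃ m₁, IsMature N δ G m₁ m) (hC1 : 1 ≤ C) (hG : 1 ≤ G)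
    (hconc : G ≤ T → ConcentratedFrom h g μ (fun n => sample (tdfs δ h g tie i) x n T) ε G)
    (hn₀ : (σ.symm n₀ : ℕ) = q) (hbest : ∀ n, q < (σ.symm n : ℕ) → μ n + ε < μ n₀ - ε)
    {t : ℕ} (ht : 1 ≤ t) (htT : t ≤ T) (hl : LateSlot δ h g tie i x σ q (C * G) t) :
    ∃ v : ℝ, |v - μ n₀| ≤ ε ∧ action (tdfs δ h g tie i) x t =
      if g t (plays (tdfs δ h g tie i) x
            (candidate (remaining σ q) (idx (ProcSlot δ h g tie i x σ q) t)) (t - 1))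
          (firstObs _ (sample (tdfs δ h g tie i) x
            (candidate (remaining σ q) (idx (ProcSlot δ h g tie i x σ q) t)) T)) < (v : EReal)
      then n₀ else candidate (remaining σ q) (idx (ProcSlot δ h g tie i x σ q) t) := by
  obtain ⟨hp, hs, hm⟩ := hl
  -- A late slot has number at least `C * G ≥ G` in the procedure, so its existence already supplies
  -- the premise of `hconc`.
  have hGT : G ≤ T := by
    have h1 := idx_le (ProcSlot δ h g tie i x σ q) t
    have h2 : G ≤ C * G := Nat.le_mul_of_pos_left _ hC1
    omega
  have hqN : q < N := hn₀ ▸ (σ.symm n₀).isLt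
  obtain ⟨m₁, hmat⟩ := hC G _ hG hm
  obtain ⟨h1, h2⟩ := (isLaiRobbinsRun δ h g tie i x σ hqN).action_eq_of_isMature hδ hδN htie
    (hconc hGT) (n₀ := n₀) (by rw [mem_remaining, hn₀])
    (fun n hn hne => hbest n (lt_of_le_of_ne ((mem_remaining σ).1 hn) fun heq => hne
      (σ.symm.injective (Fin.ext (heq.symm.trans hn₀.symm)))))
    (by split_ifs <;> omega) ht htT hp hmat
    (fun s hs _ hps hN => one_le_plays δ h g tie i x hs
      (lt_seqCount_of_procSlot δ h g tie i x σ hps hN) n₀)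
  exact ⟨_, (hconc hGT).est n₀ _ h1, h2⟩

/-- With `n₀` as leader, another arm can be played only as the candidate, which belongs to the
remaining arms, and only because its upper bound is not beaten by an estimate that is at least `μ n₀
- ε`. -/
lemma le_upper_of_action_ne (hδ : 0 < δ) (hδN : δ < 1 / N)
    (htie : ∀ A : Finset (Fin N), A.Nonempty → tie A ∈ A)
    (hC : ∀ G m, 1 ≤ G → C * G ≤ m → ∃ m₁, IsMature N δ G m₁ m) (hC1 : 1 ≤ C) (hG : 1 ≤ G)
    (hconc : G ≤ T → ConcentratedFrom h g μ (fun n => sample (tdfs δ h g tie i) x n T) ε G)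
    (hn₀ : (σ.symm n₀ : ℕ) = q) (hbest : ∀ n, q < (σ.symm n : ℕ) → μ n + ε < μ n₀ - ε)
    {t : ℕ} (ht : 1 ≤ t) (htT : t ≤ T) (hl : LateSlot δ h g tie i x σ q (C * G) t) {n : Fin N}
    (hact : action (tdfs δ h g tie i) x t = n) (hn : n ≠ n₀) :
    q < (σ.symm n : ℕ) ∧ ((μ n₀ - ε : ℝ) : EReal) ≤
      g t (plays (tdfs δ h g tie i) x n (t - 1))
        (firstObs _ (sample (tdfs δ h g tie i) x n T)) := by
  obtain ⟨v, hv, h1⟩ := exists_action_eq_of_lateSlot hδ hδN htie hC hC1 hG hconc hn₀ hbest ht htT hl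
  rw [hact] at h1
  split_ifs at h1 with hlt
  · exact absurd h1 hn
  · rw [← h1] at hlt
    have hqN : q < N := hn₀ ▸ (σ.symm n₀).isLt
    have hmem := candidate_mem (isLaiRobbinsRun δ h g tie i x σ hqN).nonempty
      (idx (ProcSlot δ h g tie i x σ q) t)
    rw [← h1, mem_remaining] at hmem
    refine ⟨lt_of_le_of_ne hmem fun heq => hn
      (σ.symm.injective (Fin.ext (heq.symm.trans hn₀.symm))), ?_⟩
    refine le_trans ?_ (not_lt.1 hlt)
    rw [EReal.coe_le_coe_iff]
    linarith [(abs_le.1 hv).1]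

/-- The counterpart for lower bounds: the estimate of the leader is at most `μ n₀ + ε`, so it cannot
beat an upper bound that reaches this value. -/
lemma action_eq_candidate (hδ : 0 < δ) (hδN : δ < 1 / N)
    (htie : ∀ A : Finset (Fin N), A.Nonempty → tie A ∈ A)
    (hC : ∀ G m, 1 ≤ G → C * G ≤ m → ∃ m₁, IsMature N δ G m₁ m) (hC1 : 1 ≤ C) (hG : 1 ≤ G)
    (hconc : G ≤ T → ConcentratedFrom h g μ (fun n => sample (tdfs δ h g tie i) x n T) ε G)
    (hn₀ : (σ.symm n₀ : ℕ) = q) (hbest : ∀ n, q < (σ.symm n : ℕ) → μ n + ε < μ n₀ - ε)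
    {t : ℕ} (ht : 1 ≤ t) (htT : t ≤ T) (hl : LateSlot δ h g tie i x σ q (C * G) t) {n : Fin N}
    (hcand : candidate (remaining σ q) (idx (ProcSlot δ h g tie i x σ q) t) = n)
    (hup : ((μ n₀ + ε : ℝ) : EReal) ≤ g t (plays (tdfs δ h g tie i) x n (t - 1))
        (firstObs _ (sample (tdfs δ h g tie i) x n T))) :
    action (tdfs δ h g tie i) x t = n := by
  obtain ⟨v, hv, h1⟩ := exists_action_eq_of_lateSlot hδ hδN htie hC hC1 hG hconc hn₀ hbest ht htT hl
  rw [hcand] at h1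
  rw [h1, if_neg]
  refine not_lt.2 (le_trans ?_ hup)
  rw [EReal.coe_le_coe_iff]
  linarith [(abs_le.1 hv).2]

/-- Plays of an inferior arm in late slots are charged to the number of its past observations. -/
lemma card_lateSlot_le (hδ : 0 < δ) (hδN : δ < 1 / N)
    (htie : ∀ A : Finset (Fin N), A.Nonempty → tie A ∈ A)
    (hmono : ∀ k, 1 ≤ k → ∀ y : Fin k → ℝ, ∀ t t', 1 ≤ t → t ≤ t' → g t k y ≤ g t' k y)
    (hC : ∀ G m, 1 ≤ G → C * G ≤ m → ∃ m₁, IsMature N δ G m₁ m) (hC1 : 1 ≤ C) (hG : 1 ≤ G)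
    (hconc : G ≤ T → ConcentratedFrom h g μ (fun n => sample (tdfs δ h g tie i) x n T) ε G)
    (hn₀ : (σ.symm n₀ : ℕ) = q) (hbest : ∀ n, q < (σ.symm n : ℕ) → μ n + ε < μ n₀ - ε)
    {n : Fin N} (hn : n ≠ n₀) (T₁ : ℕ) [DecidablePred fun k => ((μ n₀ - ε : ℝ) : EReal) ≤
        g T k (firstObs k (sample (tdfs δ h g tie i) x n T))] :
    ((Finset.Ioc T₁ T).filter (fun t => LateSlot δ h g tie i x σ q (C * G) t ∧
      action (tdfs δ h g tie i) x t = n)).card ≤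
    ((Finset.Ico (max 1 (plays (tdfs δ h g tie i) x n T₁)) T).filter
      (fun k => ((μ n₀ - ε : ℝ) : EReal) ≤
        g T k (firstObs k (sample (tdfs δ h g tie i) x n T)))).card := by
  have hlt : ∀ s t, s < t → action (tdfs δ h g tie i) x t = n → 1 ≤ s →
      action (tdfs δ h g tie i) x s = n →
      plays (tdfs δ h g tie i) x n (s - 1) < plays (tdfs δ h g tie i) x n (t - 1) := by
    intro s t hst _ hs hacts
    have h1 := plays_succ (tdfs δ h g tie i) x n (s - 1)
    rw [Nat.sub_add_cancel hs, if_pos hacts] at h1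
    have h2 := plays_mono (tdfs δ h g tie i) x n (show s ≤ t - 1 by omega)
    omega
  -- Each play of `n` increases its count, so different plays see different counts. Monotonicity in
  -- time moves the condition on the upper bound from slot `t` to the horizon `T`.
  refine Finset.card_le_card_of_injOn (fun t => plays (tdfs δ h g tie i) x n (t - 1)) ?_ ?_
  · intro t ht
    rw [Finset.mem_coe, Finset.mem_filter, Finset.mem_Ioc] at ht
    obtain ⟨⟨ht1, htT⟩, hl, hact⟩ := ht
    have h1 := one_le_plays δ h g tie i x (show 1 ≤ t by omega) hl.2.1 n
    have h2 := plays_mono (tdfs δ h g tie i) x n (show T₁ ≤ t - 1 by omega)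
    have h3 : plays (tdfs δ h g tie i) x n (t - 1) ≤ t - 1 := by
      rw [plays_eq_idx]; exact idx_le _ _
    refine Finset.mem_coe.2 (Finset.mem_filter.2 ⟨Finset.mem_Ico.2 ⟨max_le h1 h2, by
      simp only; omega⟩, ?_⟩)
    exact (le_upper_of_action_ne hδ hδN htie hC hC1 hG hconc hn₀ hbest (by omega) htT hl
      hact hn).2.trans (hmono _ h1 _ _ _ (by omega) htT)
  · intro s hs t ht hst
    rw [Finset.mem_coe, Finset.mem_filter, Finset.mem_Ioc] at hs ht
    simp only at hst
    rcases lt_trichotomy s t with h1 | h1 | h1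
    · have := hlt s t h1 ht.2.2 (by omega) hs.2.2
      omega
    · exact h1
    · have := hlt t s h1 hs.2.2 (by omega) ht.2.2
      omega

/-- An inferior arm whose upper bound stays large is played at every opportunity. -/
lemma lt_plays_or_div_le (hδ : 0 < δ) (hδN : δ < 1 / N)
    (htie : ∀ A : Finset (Fin N), A.Nonempty → tie A ∈ A)
    (hC : ∀ G m, 1 ≤ G → C * G ≤ m → ∃ m₁, IsMature N δ G m₁ m) (hC1 : 1 ≤ C) (hG : 1 ≤ G)
    (hconc : G ≤ T → ConcentratedFrom h g μ (fun n => sample (tdfs δ h g tie i) x n T) ε G)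
    (hn₀ : (σ.symm n₀ : ℕ) = q) (hbest : ∀ n, q < (σ.symm n : ℕ) → μ n + ε < μ n₀ - ε)
    (hqM : q < M) {n : Fin N} (hn : q < (σ.symm n : ℕ)) {K T₁ : ℕ}
    (hforce : ∀ t, T₁ < t → t ≤ T → ∀ k, 1 ≤ k → k ≤ K → ((μ n₀ + ε : ℝ) : EReal) ≤
        g t k (firstObs k (sample (tdfs δ h g tie i) x n T))) :
    K < plays (tdfs δ h g tie i) x n T ∨
      ((T - T₁) / M - (2 * N + ∑ q' ∈ Finset.range q, idx (Wrong δ h g tie i x σ q') T + C * G)) / N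
        ≤ K := by
  by_contra! hcon
  obtain ⟨hK, hlarge⟩ := hcon
  have hTT : T₁ ≤ T := by
    by_contra! hlt
    rw [Nat.sub_eq_zero_of_le hlt.le, Nat.zero_div] at hlarge
    simp at hlarge
  set Q := ProcSlot δ h g tie i x σ q with hQ
  set c : ℕ → Fin N := candidate (remaining σ q) with hc
  -- The turns of `n` as candidate after `T₁` in late slots. As long as `n` has at most `K` plays,
  -- each of these turns is a play of `n`.
  set D := (Finset.Icc 1 T).filter
    (fun t => Q t ∧ (idx Q T₁ < idx Q t ∧ C * G ≤ idx Q t ∧ N < idx Q t ∧ c (idx Q t) = n)) with hD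
  have hDK : D.card ≤ K := by
    refine le_trans ?_ hK
    rw [plays_eq_idx]
    refine Finset.card_le_card fun t ht => ?_
    obtain ⟨htT, hp, hT₁, hCG, hN, hcand⟩ := Finset.mem_filter.1 ht
    rw [Finset.mem_Icc] at htT
    have hs := lt_seqCount_of_procSlot δ h g tie i x σ hp hN
    have hlt : T₁ < t := by
      by_contra! hle
      exact absurd (idx_mono Q hle) (by omega)
    refine Finset.mem_filter.2 ⟨Finset.mem_Icc.2 htT, ?_⟩
    exact action_eq_candidate hδ hδN htie hC hC1 hG hconc hn₀ hbest htT.1 htT.2 ⟨hp, hs, hCG⟩ hcand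
      (hforce t hlt htT.2 _ (one_le_plays δ h g tie i x htT.1 hs n)
        ((plays_mono _ x n (show t - 1 ≤ T by omega)).trans hK))
  obtain ⟨r, hr, hr'⟩ := exists_candidate_eq ((mem_remaining σ).2 hn.le)
  have h1 := div_le_card_residue 0 (max (idx Q T₁) (C * G + N)) (idx Q T) hr
  have h2 : ((Finset.Ioc (max (idx Q T₁) (C * G + N)) (idx Q T)).filter
      (fun m => (m - 1 + 0) % (remaining σ q).card = r)).card ≤ D.card := by
    rw [hD, card_filter_idx Q
      (fun m => idx Q T₁ < m ∧ C * G ≤ m ∧ N < m ∧ c m = n) T]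
    refine Finset.card_le_card fun m hm => ?_
    rw [Finset.mem_filter, Finset.mem_Ioc] at hm
    rw [Finset.mem_filter, Finset.mem_Icc]
    exact ⟨by omega, by omega, by omega, by omega, hr' m hm.2⟩
  -- At least `(T - T₁) / M` slots after `T₁` are aimed at rank `q`. Apart from initial slots and
  -- slots with a spoiled arm set, all of them belong to the procedure.
  have h3 : (T - T₁) / M ≤ N + ∑ q' ∈ Finset.range q, idx (Wrong δ h g tie i x σ q') T +
      (idx Q T - idx Q T₁) := by
    have h4 := div_le_card_residue (M - i) T₁ T hqM
    have h5 := idx_rank_seqCount_le (N := N) i q T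
    have h6 := card_wrong_armSet_le δ h g tie i x σ hqM T
    have h7 : ((Finset.Ioc T₁ T).filter Q).card ≤ idx Q T - idx Q T₁ := by
      rw [Nat.le_sub_iff_add_le (idx_mono Q hTT)]
      unfold idx
      rw [← Finset.card_union_of_disjoint]
      · refine Finset.card_le_card fun t ht => ?_
        rw [Finset.mem_union, Finset.mem_filter, Finset.mem_filter, Finset.mem_Ioc,
          Finset.mem_Icc] at ht
        rw [Finset.mem_filter, Finset.mem_Icc]
        rcases ht with ht | ht
        · exact ⟨by omega, ht.2⟩
        · exact ⟨by omega, ht.2⟩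
      · rw [Finset.disjoint_left]
        intro t ht ht'
        rw [Finset.mem_filter, Finset.mem_Ioc] at ht
        rw [Finset.mem_filter, Finset.mem_Icc] at ht'
        omega
    refine h4.trans ?_
    refine le_trans ?_ (Nat.add_le_add (Nat.add_le_add h5 h6) h7)
    classical
    unfold idx
    refine le_trans (Finset.card_le_card ?_) ((Finset.card_union_le _ _).trans
      (Nat.add_le_add (Finset.card_union_le _ _) le_rfl))
    intro t ht
    obtain ⟨htT, hr⟩ := Finset.mem_filter.1 ht
    have htT' : t ∈ Finset.Icc 1 T := by
      rw [Finset.mem_Ioc] at htT; rw [Finset.mem_Icc]; omega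
    simp only [Finset.mem_union, Finset.mem_filter, htT, htT', true_and]
    by_cases hs : seqCount M t ≤ N
    · exact Or.inl (Or.inl ⟨hr, hs⟩)
    push Not at hs
    by_cases hw : ∃ q' < q, Wrong δ h g tie i x σ q' (t - (q - q'))
    · exact Or.inl (Or.inr ⟨hs, hw⟩)
    push Not at hw
    exact Or.inr ⟨hr, Or.inr ⟨hs, armSet_eq_remaining δ h g tie i x σ hs hr hw⟩⟩
  have h8 : (idx Q T - max (idx Q T₁) (C * G + N)) / N ≤
      (idx Q T - max (idx Q T₁) (C * G + N)) / (remaining σ q).card :=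
    Nat.div_le_div_left ((Finset.card_le_univ _).trans (by simp)) (by omega)
  -- One `N` accounts for the initial slots in `h3`, the other for the threshold `C * G + N` that
  -- was imposed on the slots of `D`.
  have h9 : ((T - T₁) / M -
      (2 * N + ∑ q' ∈ Finset.range q, idx (Wrong δ h g tie i x σ q') T + C * G)) / N ≤
      (idx Q T - max (idx Q T₁) (C * G + N)) / N := by
    refine Nat.div_le_div_right ?_
    omega
  omega

end Late

lemma div_le_wrong_add_plays {q : ℕ} (hq : q < M) {n₀ : Fin N} (hn₀ : (σ.symm n₀ : ℕ) = q)
    (T : ℕ) : T / M ≤ idx (Wrong δ h g tie i x σ q) T + plays (tdfs δ h g tie i) x n₀ T := by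
  have h1 := div_le_card_residue (M - i) 0 T hq
  rw [Nat.sub_zero] at h1
  refine h1.trans ?_
  rw [plays_eq_idx]
  unfold idx
  refine le_trans (Finset.card_le_card ?_) (Finset.card_union_le _ _)
  intro t ht
  obtain ⟨htT, hr⟩ := Finset.mem_filter.1 ht
  have htT' : t ∈ Finset.Icc 1 T := by
    rw [Finset.mem_Ioc] at htT; rw [Finset.mem_Icc]; omega
  simp only [Finset.mem_union, Finset.mem_filter, htT', true_and]
  by_cases hact : (σ.symm (action (tdfs δ h g tie i) x t) : ℕ) = q
  · exact Or.inr (σ.symm.injective (Fin.ext (hact.trans hn₀.symm)))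
  · exact Or.inl ⟨hr, hact⟩

end TDFS

/-! ### Measurability -/

section Measurability

lemma measurable_of_factor {α β κ : Type*} [MeasurableSpace α] [MeasurableSpace β]
    [MeasurableSpace κ] [DiscreteMeasurableSpace κ] {k : α → κ} {f : α → β} (hk : Measurable k)
    (hf : ∀ a b, k a = k b → f a = f b) : Measurable f := by
  intro s _
  have : f ⁻¹' s = k ⁻¹' (k '' (f ⁻¹' s)) := by
    ext a
    constructor
    · exact fun ha => ⟨a, ha, rfl⟩
    · rintro ⟨b, hb, hba⟩
      rw [Set.mem_preimage, ← hf b a hba]; exact hb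
  rw [this]
  exact hk (.of_discrete)

variable {N : ℕ}

lemma measurable_plays {π : LocalPolicy N} {T : ℕ}
    (hπ : ∀ s, 1 ≤ s → s ≤ T → Measurable fun x : ℕ → Fin N → ℝ => action π x s) (n : Fin N) :
    Measurable fun x : ℕ → Fin N → ℝ => plays π x n T := by
  induction T with
  | zero => exact measurable_const
  | succ T ih =>
    simp only [plays_succ]
    refine (ih fun s h1 h2 => hπ s h1 (by omega)).add (Measurable.ite ?_ measurable_const
      measurable_const)
    exact hπ (T + 1) (by omega) le_rfl (measurableSet_singleton n)

lemma measurable_obs_getD {π : LocalPolicy N} {T : ℕ}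
    (hπ : ∀ s, 1 ≤ s → s ≤ T → Measurable fun x : ℕ → Fin N → ℝ => action π x s) (n : Fin N)
    (k : ℕ) : Measurable fun x : ℕ → Fin N → ℝ => (obs (localHistory π x T) n).getD k 0 := by
  induction T with
  | zero => exact measurable_const
  | succ T ih =>
    have hπ' : ∀ s, 1 ≤ s → s ≤ T → Measurable fun x : ℕ → Fin N → ℝ => action π x s :=
      fun s h1 h2 => hπ s h1 (by omega)
    have h1 : (fun x : ℕ → Fin N → ℝ => (obs (localHistory π x (T + 1)) n).getD k 0) = fun x =>
        if action π x (T + 1) = n then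
          (if k < plays π x n T then (obs (localHistory π x T) n).getD k 0
            else if k = plays π x n T then x (T + 1) n else 0)
        else (obs (localHistory π x T) n).getD k 0 := by
      funext x
      rw [obs_succ]
      unfold plays
      split_ifs with h1 h2 h3
      · rw [List.getD_append _ _ _ _ h2]
      · rw [List.getD_append_right _ _ _ _ (by omega), h3]; simp
      · rw [List.getD_append_right _ _ _ _ (by omega), List.getD_eq_default]
        simp; omega
      · rfl
    rw [h1]
    refine Measurable.ite (hπ (T + 1) (by omega) le_rfl (measurableSet_singleton n)) ?_ (ih hπ')
    refine Measurable.ite (measurableSet_lt measurable_const (measurable_plays hπ' n)) (ih hπ') ?_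
    refine Measurable.ite (measurableSet_eq_fun measurable_const (measurable_plays hπ' n)) ?_
      measurable_const
    exact (measurable_pi_apply n).comp (measurable_pi_apply (T + 1))

/-- Padding with `0` removes the dependence of the type on the length: a statistic becomes a
function of a count and a sequence, and is jointly measurable because counts are countable. -/
lemma obs_get_eq_firstObs (F : History N) (n : Fin N) :
    (obs F n).get = firstObs (obs F n).length (fun k => (obs F n).getD k 0) := by
  funext k
  change (obs F n).get k = (obs F n).getD k 0
  rw [List.getD_eq_getElem _ _ k.isLt]; rfl

lemma map_fst_localHistory_congr {π : LocalPolicy N} {x y : ℕ → Fin N → ℝ} {T : ℕ}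
    (h : ∀ s, 1 ≤ s → s ≤ T → action π x s = action π y s) :
    (localHistory π x T).map Prod.fst = (localHistory π y T).map Prod.fst := by
  induction T with
  | zero => rfl
  | succ T ih =>
    rw [localHistory_succ, localHistory_succ, List.map_cons, List.map_cons,
      ih fun s h1 h2 => h s h1 (by omega), h (T + 1) (by omega) le_rfl]

lemma armSet_congr {F F' : History N} (hF : F.map Prod.fst = F'.map Prod.fst) (j : ℕ) :
    armSet F j = armSet F' j := by
  unfold armSet
  rw [List.map_take, List.map_take, hF]

lemma miniCount_congr {F F' : History N} (M : ℕ) (hF : F.map Prod.fst = F'.map Prod.fst) (j : ℕ) :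
    miniCount M F j = miniCount M F' j := by
  have hlen : F.length = F'.length := by simpa using congrArg List.length hF
  unfold miniCount
  rw [hlen, armSet_congr hF]
  congr 1
  refine Finset.filter_congr fun s _ => ?_
  rw [armSet_congr (F := F.drop (F'.length + 1 - s)) (F' := F'.drop (F'.length + 1 - s))
    (by rw [List.map_drop, List.map_drop, hF])]

lemma obs_length_congr {F F' : History N} (hF : F.map Prod.fst = F'.map Prod.fst) (n : Fin N) :
    (obs F n).length = (obs F' n).length := by
  have h1 : ∀ F : History N, (obs F n).length = ((F.map Prod.fst).filter (fun m => m = n)).length := by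
    intro F
    unfold obs
    rw [List.length_reverse, List.length_map, List.filter_map, List.length_map]
    rfl
  rw [h1, h1, hF]

variable [NeZero N] {h : (k : ℕ) → (Fin k → ℝ) → ℝ} {g : ℕ → (k : ℕ) → (Fin k → ℝ) → EReal}

/-- Observed values enter a decision only through comparisons among statistics; everything else
depends on the arms played. -/
lemma laiRobbins_congr {δ : ℝ} {tie : Finset (Fin N) → Fin N} {F F' : History N}
    (hF : F.map Prod.fst = F'.map Prod.fst)
    (hest : ∀ n n', h _ (obs F n).get ≤ h _ (obs F n').get ↔
      h _ (obs F' n).get ≤ h _ (obs F' n').get)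
    (hup : ∀ n n', g (F.length + 1) _ (obs F n).get < ((h _ (obs F n').get : ℝ) : EReal) ↔
      g (F'.length + 1) _ (obs F' n).get < ((h _ (obs F' n').get : ℝ) : EReal))
    (A : Finset (Fin N)) (m : ℕ) :
    laiRobbins δ h g tie A m F = laiRobbins δ h g tie A m F' := by
  have hE : A.filter (fun n => ((m : ℝ) - 1) * δ ≤ (obs F n).length) =
      A.filter (fun n => ((m : ℝ) - 1) * δ ≤ (obs F' n).length) :=
    Finset.filter_congr fun n _ => by rw [obs_length_congr hF]
  have hD : (A.filter (fun n => ((m : ℝ) - 1) * δ ≤ (obs F n).length)).filter (fun n => ∀ n' ∈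
      A.filter (fun n => ((m : ℝ) - 1) * δ ≤ (obs F n).length),
        h _ (obs F n').get ≤ h _ (obs F n).get) =
      (A.filter (fun n => ((m : ℝ) - 1) * δ ≤ (obs F' n).length)).filter (fun n => ∀ n' ∈
      A.filter (fun n => ((m : ℝ) - 1) * δ ≤ (obs F' n).length),
        h _ (obs F' n').get ≤ h _ (obs F' n).get) := by
    rw [hE]
    exact Finset.filter_congr fun n _ => forall₂_congr fun n' _ => hest n' n
  unfold laiRobbins
  dsimp only
  rw [hD]
  simp only [hup]

lemma tdfs_congr {M : ℕ} {δ : ℝ} {tie : Finset (Fin N) → Fin N} (i : Fin M) {F F' : History N}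
    (hF : F.map Prod.fst = F'.map Prod.fst)
    (hest : ∀ n n', h _ (obs F n).get ≤ h _ (obs F n').get ↔
      h _ (obs F' n).get ≤ h _ (obs F' n').get)
    (hup : ∀ n n', g (F.length + 1) _ (obs F n).get < ((h _ (obs F n').get : ℝ) : EReal) ↔
      g (F'.length + 1) _ (obs F' n).get < ((h _ (obs F' n').get : ℝ) : EReal)) :
    tdfs δ h g tie i F = tdfs δ h g tie i F' := by
  have hlen : F.length = F'.length := by simpa using congrArg List.length hF
  rw [tdfs_eq, tdfs_eq, hlen, laiRobbins_congr hF hest hup, laiRobbins_congr hF hest hup,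
    armSet_congr hF, miniCount_congr M hF]

lemma measurable_tdfs_action (hh : ∀ k, Measurable (h k)) (hg : ∀ t k, Measurable (g t k))
    {M : ℕ} (δ : ℝ) (tie : Finset (Fin N) → Fin N) (i : Fin M) (t : ℕ) :
    Measurable fun x : ℕ → Fin N → ℝ => action (tdfs δ h g tie i) x t := by
  induction t using Nat.strong_induction_on with
  | _ t ih =>
  by_cases ht : t = 0
  · subst ht; exact (measurable_const :
      Measurable fun _ : ℕ → Fin N → ℝ => tdfs δ h g tie i [])
  obtain ⟨T, rfl⟩ : ∃ T, t = T + 1 := ⟨t - 1, by omega⟩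
  set π := tdfs δ h g tie i with hπ
  have hmeas : ∀ s, 1 ≤ s → s ≤ T → Measurable fun x : ℕ → Fin N → ℝ => action π x s :=
    fun s _ h2 => ih s (by omega)
  have hpair : ∀ n, Measurable fun x : ℕ → Fin N → ℝ =>
      (plays π x n T, fun k => (obs (localHistory π x T) n).getD k (0 : ℝ)) := fun n =>
    (measurable_plays hmeas n).prodMk (measurable_pi_lambda _ fun k => measurable_obs_getD hmeas n k)
  have hest : ∀ n, Measurable fun x : ℕ → Fin N → ℝ => h _ (obs (localHistory π x T) n).get := by
    intro n
    have h1 : Measurable fun p : ℕ × (ℕ → ℝ) => h p.1 (firstObs p.1 p.2) :=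
      measurable_from_prod_countable_right fun k => (hh k).comp
        (measurable_pi_lambda _ fun j => measurable_pi_apply _)
    simp only [obs_get_eq_firstObs]
    exact h1.comp (hpair n)
  have hup : ∀ n, Measurable fun x : ℕ → Fin N → ℝ =>
      g ((localHistory π x T).length + 1) _ (obs (localHistory π x T) n).get := by
    intro n
    have h1 : Measurable fun p : ℕ × (ℕ → ℝ) => g (T + 1) p.1 (firstObs p.1 p.2) :=
      measurable_from_prod_countable_right fun k => (hg (T + 1) k).comp
        (measurable_pi_lambda _ fun j => measurable_pi_apply _)
    simp only [obs_get_eq_firstObs, localHistory_length]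
    exact h1.comp (hpair n)
  -- The next action factors through a finite summary of the past: the earlier actions, measurable
  -- by induction, and the outcomes of all comparisons of estimates and of bounds with estimates.
  refine measurable_of_factor (κ := (Fin T → Fin N) × (Fin N → Fin N → Prop) ×
    (Fin N → Fin N → Prop)) (k := fun x => (fun s => action π x (s + 1),
      fun n n' => h _ (obs (localHistory π x T) n).get ≤ h _ (obs (localHistory π x T) n').get,
      fun n n' => g ((localHistory π x T).length + 1) _ (obs (localHistory π x T) n).get <
        ((h _ (obs (localHistory π x T) n').get : ℝ) : EReal))) ?_ ?_
  · refine (measurable_pi_lambda _ fun s => hmeas _ (by omega) (by omega)).prodMk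
      ((measurable_pi_lambda _ fun n => measurable_pi_lambda _ fun n' => ?_).prodMk
      (measurable_pi_lambda _ fun n => measurable_pi_lambda _ fun n' => ?_))
    · exact measurableSet_setOfPred.1 (measurableSet_le (hest n) (hest n'))
    · exact measurableSet_setOfPred.1 (measurableSet_lt (hup n)
        (measurable_coe_real_ereal.comp (hest n')))
  · intro x y hxy
    obtain ⟨h1, h2⟩ := Prod.mk.inj hxy
    obtain ⟨h2, h3⟩ := Prod.mk.inj h2
    change π (localHistory π x T) = π (localHistory π y T)
    refine tdfs_congr i (map_fst_localHistory_congr fun s hs1 hs2 => ?_) (fun n n' => ?_)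
      fun n n' => ?_
    · have := congrFun h1 ⟨s - 1, by omega⟩
      simpa [Nat.sub_add_cancel hs1] using this
    · exact iff_of_eq (congrFun (congrFun h2 n) n')
    · exact iff_of_eq (congrFun (congrFun h3 n) n')

end Measurability

/-! ### Observations of an arm under a policy -/

section Sampling

variable {H : Type*} {law : H → Measure ℝ} [∀ θ, IsProbabilityMeasure (law θ)] {N : ℕ}
  {Θ : Fin N → H} {Ω : Type*} [MeasurableSpace Ω] {P : Measure Ω} [IsProbabilityMeasure P]
  {S : ℕ → Ω → Fin N → ℝ}

/-- The arm states up to slot `T`. -/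
def past (T : ℕ) (x : ℕ → Fin N → ℝ) : ℕ → Fin N → ℝ := fun s => if 1 ≤ s ∧ s ≤ T then x s else 0

lemma measurable_past (T : ℕ) : Measurable (past (N := N) T) := by
  refine measurable_pi_lambda _ fun s => ?_
  unfold past
  split_ifs
  · exact measurable_pi_apply s
  · exact measurable_const

lemma past_apply {T s : ℕ} (h1 : 1 ≤ s) (h2 : s ≤ T) (x : ℕ → Fin N → ℝ) : past T x s = x s :=
  if_pos ⟨h1, h2⟩

lemma action_past (π : LocalPolicy N) {T t : ℕ} (h : t ≤ T + 1) (x : ℕ → Fin N → ℝ) :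
    action π (past T x) t = action π x t := by
  unfold action
  rw [localHistory_congr π fun s h1 h2 => past_apply h1 (by omega) x]

omit [IsProbabilityMeasure P] in
lemma indepFun_past_future (hS : ∀ t, Measurable (S t)) (hindep : iIndepFun (fun t => S (t + 1)) P)
    (T : ℕ) : IndepFun (fun ω => past T (fun s => S s ω)) (fun ω k => S (T + 1 + k) ω) P := by
  have h1 := indep_iSup_of_disjoint (S := {t : ℕ | t < T}) (T := {t : ℕ | T ≤ t})
    (fun t => (hS (t + 1)).comap_le) hindep (by
      rw [Set.disjoint_left]; intro t ht ht'; exact absurd (show t < T from ht) (not_lt.2 ht'))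
  rw [IndepFun_iff_Indep]
  refine indep_of_indep_of_le_left (indep_of_indep_of_le_right h1 ?_) ?_
  · refine Measurable.comap_le ?_
    refine @measurable_pi_lambda _ _ _ (_) _ _ fun k => ?_
    have h2 : MeasurableSpace.comap (S (T + k + 1)) inferInstance ≤
        ⨆ t ∈ {t : ℕ | T ≤ t}, MeasurableSpace.comap (S (t + 1)) inferInstance :=
      le_iSup₂_of_le (f := fun (t : ℕ) (_ : t ∈ {t : ℕ | T ≤ t}) =>
        MeasurableSpace.comap (S (t + 1)) inferInstance) (T + k) (by simp) le_rfl
    rw [show T + 1 + k = T + k + 1 by omega]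
    exact (comap_measurable (S (T + k + 1))).mono h2 le_rfl
  · refine Measurable.comap_le ?_
    refine @measurable_pi_lambda _ _ _ (_) _ _ fun s => ?_
    unfold past
    split_ifs with hs
    · have h2 : MeasurableSpace.comap (S (s - 1 + 1)) inferInstance ≤
          ⨆ t ∈ {t : ℕ | t < T}, MeasurableSpace.comap (S (t + 1)) inferInstance :=
        le_iSup₂_of_le (f := fun (t : ℕ) (_ : t ∈ {t : ℕ | t < T}) =>
          MeasurableSpace.comap (S (t + 1)) inferInstance) (s - 1)
          (by change s - 1 < T; omega) le_rfl
      rw [Nat.sub_add_cancel hs.1] at h2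
      exact (comap_measurable (S s)).mono h2 le_rfl
    · exact @measurable_const _ _ _ (_) _

lemma map_future (hS : ∀ t, Measurable (S t)) (hindep : iIndepFun (fun t => S (t + 1)) P)
    (hdist : ∀ t, 1 ≤ t → ∀ n, P.map (fun ω => S t ω n) = law (Θ n)) (n : Fin N) (T : ℕ) :
    P.map (fun ω k => S (T + 1 + k) ω n) = sampleLaw law (Θ n) := by
  have h1 : iIndepFun (fun (k : ℕ) ω => S (T + 1 + k) ω n) P := by
    have h2 := (hindep.precomp (g := fun k : ℕ => T + k) (fun a b hab => by simpa using hab)).comp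
      (fun _ v => v n) (fun _ => measurable_pi_apply n)
    convert h2 using 2 with k
    funext ω
    simp [show T + 1 + k = T + k + 1 by omega]
  have h2 : ∀ k : ℕ, Measurable fun ω => S (T + 1 + k) ω n :=
    fun k => (measurable_pi_apply n).comp (hS _)
  rw [(iIndepFun_iff_map_fun_eq_infinitePi_map h2).1 h1]
  unfold sampleLaw
  congr 1
  funext k
  exact hdist _ (by omega) n

/-- The observations `(obs (localHistory π x T) n)`, continued by the sequence `z`. -/
def splice (π : LocalPolicy N) (n : Fin N) (T : ℕ) (p : (ℕ → Fin N → ℝ) × (ℕ → ℝ)) : ℕ → ℝ :=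
  fun k => if k < plays π p.1 n T then (obs (localHistory π p.1 T) n).getD k 0
    else p.2 (k - plays π p.1 n T)

lemma measurable_splice {π : LocalPolicy N}
    (hπ : ∀ t, Measurable fun x : ℕ → Fin N → ℝ => action π x t) (n : Fin N) (T : ℕ) :
    Measurable (splice π n T) := by
  refine measurable_pi_lambda _ fun k => ?_
  have hp : Measurable fun p : (ℕ → Fin N → ℝ) × (ℕ → ℝ) => plays π p.1 n T :=
    (measurable_plays (fun s _ _ => hπ s) n).comp measurable_fst
  refine Measurable.ite (measurableSet_lt measurable_const hp)
    ((measurable_obs_getD (fun s _ _ => hπ s) n k).comp measurable_fst) ?_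
  have h1 : Measurable fun p : ℕ × (ℕ → ℝ) => p.2 p.1 :=
    measurable_from_prod_countable_right fun k => measurable_pi_apply k
  exact h1.comp (((measurable_from_top (f := fun j : ℕ => k - j)).comp hp).prodMk measurable_snd)

lemma sample_eq_splice (π : LocalPolicy N) (n : Fin N) (T : ℕ) (x : ℕ → Fin N → ℝ) :
    sample π x n T = splice π n T (past T x, fun k => x (T + 1 + k) n) := by
  have h1 : localHistory π (past T x) T = localHistory π x T :=
    localHistory_congr π fun s h1 h2 => past_apply h1 h2 x
  funext k
  unfold sample splice plays
  simp only [h1]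
  split_ifs with hk
  · rw [List.getD_eq_getElem _ _ hk, List.getD_eq_getElem _ _ hk]
  · rw [List.getD_eq_default _ _ (by omega)]

/-- If the arm is played in slot `T + 1`, the new observation is the entry that the continuation
already had at that place, so nothing changes. Otherwise this state is skipped and the continuation
starts one slot later. -/
lemma sample_succ (π : LocalPolicy N) (n : Fin N) (T : ℕ) (x : ℕ → Fin N → ℝ) :
    sample π x n (T + 1) = if action π x (T + 1) = n then sample π x n T
      else splice π n T (past T x, fun k => x (T + 1 + 1 + k) n) := by
  have h1 : localHistory π (past T x) T = localHistory π x T :=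
    localHistory_congr π fun s h1 h2 => past_apply h1 h2 x
  funext k
  unfold splice sample plays
  rw [obs_succ]
  simp only [h1]
  split_ifs with ha
  · dsimp only
    rcases lt_trichotomy k (obs (localHistory π x T) n).length with hk | hk | hk
    · rw [List.getD_append _ _ _ _ hk, List.getD_eq_getElem _ _ hk, List.getD_eq_getElem _ _ hk]
    · rw [List.getD_append_right _ _ _ _ hk.ge, List.getD_eq_default _ _ hk.ge, hk]
      simp
    · rw [List.getD_append_right _ _ _ _ hk.le, List.getD_eq_default _ _ hk.le,
        List.getD_eq_default _ _ (by simp; omega), List.length_append, List.length_singleton]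
      congr 1
      omega
  · dsimp only
    split_ifs with hk
    · rw [List.getD_eq_getElem _ _ hk, List.getD_eq_getElem _ _ hk]
    · rw [List.getD_eq_default _ _ (by omega)]

lemma measurable_path (hS : ∀ t, Measurable (S t)) : Measurable fun ω s => S s ω :=
  measurable_pi_lambda _ hS

lemma measurable_sample (hS : ∀ t, Measurable (S t)) {π : LocalPolicy N}
    (hπ : ∀ t, Measurable fun x : ℕ → Fin N → ℝ => action π x t) (n : Fin N) (T : ℕ) :
    Measurable fun ω => sample π (fun s => S s ω) n T := by
  simp only [sample_eq_splice]
  exact (measurable_splice hπ n T).comp (((measurable_past T).comp (measurable_path hS)).prodMk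
    (measurable_pi_lambda _ fun k => (measurable_pi_apply n).comp (hS _)))

/-- The observations of an arm are a sequence of independent draws from its distribution, whatever
the policy. -/
theorem map_sample (hS : ∀ t, Measurable (S t)) (hindep : iIndepFun (fun t => S (t + 1)) P)
    (hdist : ∀ t, 1 ≤ t → ∀ n, P.map (fun ω => S t ω n) = law (Θ n)) {π : LocalPolicy N}
    (hπ : ∀ t, Measurable fun x : ℕ → Fin N → ℝ => action π x t) (n : Fin N) (T : ℕ) :
    P.map (fun ω => sample π (fun s => S s ω) n T) = sampleLaw law (Θ n) := by
  induction T with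
  | zero =>
    rw [← map_future (T := 0) hS hindep hdist n]
    congr 1
  | succ T ih =>
    rw [← ih]
    set X : Ω → ℕ → Fin N → ℝ := fun ω => past T (fun s => S s ω) with hX
    set Z : ℕ → Ω → ℕ → ℝ := fun T ω k => S (T + 1 + k) ω n with hZ
    have hXm : Measurable X := (measurable_past T).comp (measurable_path hS)
    have hZm : ∀ T, Measurable (Z T) := fun T =>
      measurable_pi_lambda _ fun k => (measurable_pi_apply n).comp (hS _)
    have hlawZ : ∀ T, P.map (Z T) = sampleLaw law (Θ n) := fun T =>
      map_future hS hindep hdist n T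
    have hproj : Measurable fun (y : ℕ → Fin N → ℝ) (k : ℕ) => y k n :=
      measurable_pi_lambda _ fun k => (measurable_pi_apply n).comp (measurable_pi_apply k)
    have hi1 : IndepFun X (Z T) P :=
      (indepFun_past_future hS hindep T).comp measurable_id hproj
    have hi2 : IndepFun X (Z (T + 1)) P := by
      have h2 := (indepFun_past_future hS hindep (T + 1)).comp (measurable_past T) hproj
      have h3 : X = past T ∘ fun ω => past (T + 1) fun s => S s ω := by
        funext ω s
        simp only [hX, Function.comp_apply]
        unfold past
        split_ifs with h3 h4
        · rfl
        · exact absurd ⟨h3.1, by omega⟩ h4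
        · rfl
      rw [h3]
      exact h2
    -- The past up to `T` is independent of the future from slot `T + 1` and of that from slot `T +
    -- 2`, and both futures have the same law.
    have hpair : P.map (fun ω => (X ω, Z (T + 1) ω)) = P.map (fun ω => (X ω, Z T ω)) := by
      rw [(indepFun_iff_map_prod_eq_prod_map_map hXm.aemeasurable (hZm _).aemeasurable).1 hi2,
        (indepFun_iff_map_prod_eq_prod_map_map hXm.aemeasurable (hZm _).aemeasurable).1 hi1,
        hlawZ, hlawZ]
    ext B hB
    rw [Measure.map_apply (measurable_sample hS hπ n _) hB,
      Measure.map_apply (measurable_sample hS hπ n _) hB]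
    set A : Set ((ℕ → Fin N → ℝ) × (ℕ → ℝ)) := {p | action π p.1 (T + 1) = n} with hA
    have hAm : MeasurableSet A := ((hπ (T + 1)).comp measurable_fst) (measurableSet_singleton n)
    have hAX : ∀ ω z, (X ω, z) ∈ A ↔ action π (fun s => S s ω) (T + 1) = n := fun ω z => by
      change action π (past T fun s => S s ω) (T + 1) = n ↔ _
      rw [action_past π le_rfl]
    have hBm := measurable_splice hπ n T hB
    -- Whether the arm is played in slot `T + 1` is determined by the past. On the part where it is
    -- not played, `hpair` allows the later continuation to be exchanged for the earlier one without
    -- changing the probability.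
    have h1 : (fun ω => sample π (fun s => S s ω) n (T + 1)) ⁻¹' B =
        ((fun ω => (X ω, Z T ω)) ⁻¹' (splice π n T ⁻¹' B ∩ A)) ∪
          ((fun ω => (X ω, Z (T + 1) ω)) ⁻¹' (splice π n T ⁻¹' B \ A)) := by
      ext ω
      simp only [Set.mem_preimage, Set.mem_union, Set.mem_inter_iff, Set.mem_sdiff, hAX]
      rw [sample_succ]
      split_ifs with ha
      · simp only [ha, and_true, not_true_eq_false, and_false, or_false]
        rw [sample_eq_splice]
      · simp only [ha, and_false, not_false_eq_true, and_true, false_or]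
        rfl
    have h2 : (fun ω => sample π (fun s => S s ω) n T) ⁻¹' B =
        (fun ω => (X ω, Z T ω)) ⁻¹' (splice π n T ⁻¹' B) := by
      ext ω
      simp only [Set.mem_preimage]
      rw [sample_eq_splice]
    rw [h1, h2, measure_union, ← Measure.map_apply (hXm.prodMk (hZm _)) (hBm.diff hAm), hpair,
      ← Measure.map_apply (hXm.prodMk (hZm _)) (hBm.inter hAm),
      ← Measure.map_apply (hXm.prodMk (hZm _)) hBm, measure_inter_add_sdiff _ hAm]
    · rw [Set.disjoint_left]
      intro ω hω hω'
      exact hω'.2 ((hAX ω _).2 ((hAX ω _).1 hω.2))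
    · exact (hXm.prodMk (hZm _)) (hBm.diff hAm)

end Sampling

/-! ### Change of measure for independent observations -/

section ChangeOfMeasure

/-- Change of measure: the event `A` has probability at most `exp c` times its probability under
`ν`, up to the event that the log-likelihood ratio exceeds `c`. -/
lemma pi_le_exp_mul_pi {μ ν : Measure ℝ} [IsProbabilityMeasure μ] [IsProbabilityMeasure ν]
    (hac : μ ≪ ν) {K : ℕ} {A : Set (Fin K → ℝ)} (hA : MeasurableSet A) (c : ℝ) :
    Measure.pi (fun _ : Fin K => μ) A ≤
      ENNReal.ofReal (Real.exp c) * Measure.pi (fun _ : Fin K => ν) A +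
        Measure.pi (fun _ : Fin K => μ) {y | c < ∑ k, llr μ ν (y k)} := by
  set r : ℝ → ℝ := fun s => (μ.rnDeriv ν s).toReal with hr
  have hrm : Measurable r := (μ.measurable_rnDeriv ν).ennreal_toReal
  have hr0 : ∀ s, 0 ≤ r s := fun s => ENNReal.toReal_nonneg
  have hμ : μ = ν.withDensity (fun s => ENNReal.ofReal (r s)) := by
    refine (Measure.withDensity_rnDeriv_eq μ ν hac).symm.trans (withDensity_congr_ae ?_)
    filter_upwards [μ.rnDeriv_lt_top ν] with s hs
    rw [hr, ENNReal.ofReal_toReal hs.ne]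
  set D : (Fin K → ℝ) → ℝ := fun y => ∏ k, r (y k) with hD
  have hDm : Measurable D := Finset.measurable_prod _ fun k _ => hrm.comp (measurable_pi_apply k)
  -- The product of the densities is the density of the product measures; on boxes the integral
  -- factorizes by independence of the coordinates.
  have hpi : Measure.pi (fun _ : Fin K => μ) =
      (Measure.pi fun _ : Fin K => ν).withDensity (fun y => ENNReal.ofReal (D y)) := by
    refine Measure.pi_eq fun B hB => ?_
    rw [withDensity_apply _ (MeasurableSet.univ_pi hB), ← lintegral_indicator
      (MeasurableSet.univ_pi hB)]
    have h1 : ∀ y : Fin K → ℝ, (Set.univ.pi B).indicator (fun y => ENNReal.ofReal (D y)) y =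
        ∏ k ∈ Finset.univ, (B k).indicator (fun s => ENNReal.ofReal (r s)) (y k) := by
      intro y
      by_cases hy : y ∈ Set.univ.pi B
      · rw [Set.indicator_of_mem hy, hD, ENNReal.ofReal_prod_of_nonneg fun k _ => hr0 _]
        exact Finset.prod_congr rfl fun k _ => (Set.indicator_of_mem (hy k trivial)
          (fun s => ENNReal.ofReal (r s))).symm
      · rw [Set.indicator_of_notMem hy]
        simp only [Set.mem_pi, Set.mem_univ, true_implies, not_forall] at hy
        obtain ⟨k, hk⟩ := hy
        exact (Finset.prod_eq_zero (Finset.mem_univ k) (Set.indicator_of_notMem hk _)).symm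
    simp only [h1]
    have hf : ∀ k, Measurable ((B k).indicator fun s => ENNReal.ofReal (r s)) :=
      fun k => hrm.ennreal_ofReal.indicator (hB k)
    rw [lintegral_prod_eq_prod_lintegral_of_indepFun Finset.univ
      (fun k (y : Fin K → ℝ) => (B k).indicator (fun s => ENNReal.ofReal (r s)) (y k))
      (iIndepFun_pi (X := fun k => (B k).indicator fun s => ENNReal.ofReal (r s))
        fun k => (hf k).aemeasurable) fun k => (hf k).comp (measurable_pi_apply k)]
    refine Finset.prod_congr rfl fun k _ => ?_
    rw [← lintegral_map (hf k) (measurable_pi_apply k), (measurePreserving_eval _ k).map_eq,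
      lintegral_indicator (hB k), ← withDensity_apply _ (hB k), ← hμ]
  -- Where the density exceeds `exp c` it is positive, so no factor vanishes and its logarithm is
  -- the sum of the log-likelihood ratios.
  have hsub : A ⊆ (A ∩ {y | D y ≤ Real.exp c}) ∪ {y | c < ∑ k, llr μ ν (y k)} := by
    intro y hy
    by_cases hDy : D y ≤ Real.exp c
    · exact Or.inl ⟨hy, hDy⟩
    · right
      push Not at hDy
      have hpos : 0 < D y := (Real.exp_pos c).trans hDy
      have hne : ∀ k ∈ Finset.univ, r (y k) ≠ 0 := Finset.prod_ne_zero_iff.1 hpos.ne'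
      change c < ∑ k, Real.log (r (y k))
      rw [← Real.log_prod hne]
      exact (Real.lt_log_iff_exp_lt hpos).2 hDy
  refine (measure_mono hsub).trans ((measure_union_le _ _).trans (add_le_add ?_ le_rfl))
  have hm : MeasurableSet (A ∩ {y | D y ≤ Real.exp c}) :=
    hA.inter (measurableSet_le hDm measurable_const)
  rw [hpi, withDensity_apply _ hm]
  calc _ ≤ ∫⁻ _ in A ∩ {y | D y ≤ Real.exp c}, ENNReal.ofReal (Real.exp c)
          ∂(Measure.pi fun _ : Fin K => ν) := by
        refine setLIntegral_mono' hm fun y hy => ENNReal.ofReal_le_ofReal hy.2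
    _ = ENNReal.ofReal (Real.exp c) * Measure.pi (fun _ : Fin K => ν)
          (A ∩ {y | D y ≤ Real.exp c}) := by rw [setLIntegral_const]
    _ ≤ _ := by gcongr; exact Set.inter_subset_left

end ChangeOfMeasure

/-! ### Likelihood ratios along an i.i.d. sequence -/

section SampleLaw

variable {H : Type*} (law : H → Measure ℝ) [∀ θ, IsProbabilityMeasure (law θ)]

instance (θ : H) : IsProbabilityMeasure (sampleLaw law θ) := by
  unfold sampleLaw; infer_instance

lemma measurable_firstObs (K : ℕ) : Measurable (firstObs K) :=
  measurable_pi_lambda _ fun _ => measurable_pi_apply _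

lemma map_firstObs (θ : H) (K : ℕ) :
    (sampleLaw law θ).map (firstObs K) = Measure.pi (fun _ : Fin K => law θ) := by
  symm
  refine Measure.pi_eq fun B hB => ?_
  rw [Measure.map_apply (measurable_firstObs K) (MeasurableSet.univ_pi hB)]
  have h1 : firstObs K ⁻¹' Set.univ.pi B = Set.pi (Finset.range K)
      (fun k => if h : k < K then B ⟨k, h⟩ else Set.univ) := by
    ext s
    simp only [Set.mem_preimage, Set.mem_pi, Set.mem_univ, true_implies, Finset.coe_range,
      Set.mem_Iio]
    constructor
    · intro h k hk
      rw [dif_pos hk]; exact h ⟨k, hk⟩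
    · intro h k
      have := h k k.isLt
      rwa [dif_pos k.isLt] at this
  rw [h1]
  unfold sampleLaw
  rw [Measure.infinitePi_pi, Finset.prod_range]
  · refine Finset.prod_congr rfl fun k _ => ?_
    rw [dif_pos k.isLt]
  · intro k hk
    split_ifs
    · exact hB _
    · exact .univ

lemma map_apply_sampleLaw (θ : H) (k : ℕ) : (sampleLaw law θ).map (fun s => s k) = law θ :=
  Measure.infinitePi_map_eval _ k

variable {law}

omit [∀ θ, IsProbabilityMeasure (law θ)] in
lemma RegularModel.klDiv_ne_top (hlaw : RegularModel law) {θ θ' : H}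
    (hθ : mean law θ < mean law θ') : InformationTheory.klDiv (law θ) (law θ') ≠ ⊤ :=
  (hlaw.kl_finite θ θ' hθ).ne

omit [∀ θ, IsProbabilityMeasure (law θ)] in
lemma RegularModel.kl_toReal_pos (hlaw : RegularModel law) {θ θ' : H}
    (hθ : mean law θ < mean law θ') : 0 < kl law θ θ' :=
  ENNReal.toReal_pos (hlaw.kl_pos θ θ' hθ).ne' (hlaw.klDiv_ne_top hθ)

/-- The weak law of large numbers for the log-likelihood ratio. -/
lemma tendsto_prob_llr (hlaw : RegularModel law) {θ θ' : H} (hθ : mean law θ < mean law θ')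
    {a : ℝ} (ha : kl law θ θ' < a) :
    Tendsto (fun K : ℕ => (sampleLaw law θ).real
      {s | a * K ≤ ∑ k ∈ Finset.range K, llr (law θ) (law θ') (s k)}) atTop (𝓝 0) := by
  obtain ⟨hac, hint⟩ := InformationTheory.klDiv_ne_top_iff.1 (hlaw.klDiv_ne_top hθ)
  have hkl : kl law θ θ' = ∫ s, llr (law θ) (law θ') s ∂(law θ) :=
    InformationTheory.toReal_klDiv_of_measure_eq hac (by simp)
  have hm : Measurable (llr (law θ) (law θ')) := measurable_llr _ _
  set X : ℕ → (ℕ → ℝ) → ℝ := fun k s => llr (law θ) (law θ') (s k) with hX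
  have hmX : ∀ k, Measurable (X k) := fun k => hm.comp (measurable_pi_apply k)
  have hmap : ∀ k, (sampleLaw law θ).map (X k) = (law θ).map (llr (law θ) (law θ')) := by
    intro k
    have h1 := Measure.map_map (μ := sampleLaw law θ) hm (measurable_pi_apply k)
    rw [map_apply_sampleLaw] at h1
    exact h1.symm
  have hint0 : Integrable (X 0) (sampleLaw law θ) := by
    have h1 : Integrable (llr (law θ) (law θ')) ((sampleLaw law θ).map fun s => s 0) := by
      rw [map_apply_sampleLaw]; exact hint
    exact h1.comp_measurable (measurable_pi_apply 0)
  have hE : ∫ s, X 0 s ∂(sampleLaw law θ) = kl law θ θ' := by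
    have h1 := integral_map (μ := sampleLaw law θ) (φ := fun s : ℕ → ℝ => s 0)
      (measurable_pi_apply 0).aemeasurable (f := llr (law θ) (law θ')) hm.aestronglyMeasurable
    rw [map_apply_sampleLaw] at h1
    rw [hkl, h1]
  have hslln := strong_law_ae_real X hint0
    (fun j k hjk => (iIndepFun_infinitePi (P := fun _ : ℕ => law θ)
      (X := fun _ => llr (law θ) (law θ')) fun _ => hm).indepFun hjk)
    (fun k => ⟨(hmX k).aemeasurable, (hmX 0).aemeasurable, by rw [hmap, hmap]⟩)
  rw [hE] at hslln
  have hmeas := tendstoInMeasure_of_tendsto_ae (μ := sampleLaw law θ)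
    (f := fun (K : ℕ) s => (∑ k ∈ Finset.range K, X k s) / K) (g := fun _ => kl law θ θ')
    (fun K => ((Finset.measurable_sum _ fun k _ => hmX k).div_const _).aestronglyMeasurable) hslln
  rw [tendstoInMeasure_iff_measureReal_dist] at hmeas
  refine tendsto_of_tendsto_of_tendsto_of_le_of_le' tendsto_const_nhds
    (hmeas (a - kl law θ θ') (by linarith)) (Eventually.of_forall fun _ => measureReal_nonneg) ?_
  filter_upwards [eventually_ge_atTop 1] with K hK
  refine measureReal_mono ?_
  intro s hs
  have hK' : (0 : ℝ) < K := by exact_mod_cast hK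
  have h1 : a ≤ (∑ k ∈ Finset.range K, X k s) / K := (le_div_iff₀ hK').2 hs
  change a - kl law θ θ' ≤ dist _ _
  rw [Real.dist_eq]
  exact le_trans (by linarith) (le_abs_self _)

lemma real_firstObs_le (hlaw : RegularModel law) {θ θ' : H} (hθ : mean law θ < mean law θ')
    {K : ℕ} {A : Set (Fin K → ℝ)} (hA : MeasurableSet A) (c : ℝ) :
    (sampleLaw law θ).real (firstObs K ⁻¹' A) ≤
      Real.exp c * (sampleLaw law θ').real (firstObs K ⁻¹' A) +
        (sampleLaw law θ).real {s | c < ∑ k ∈ Finset.range K, llr (law θ) (law θ') (s k)} := by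
  obtain ⟨hac, hint⟩ := InformationTheory.klDiv_ne_top_iff.1 (hlaw.klDiv_ne_top hθ)
  have h1 := pi_le_exp_mul_pi hac hA c
  have hB : MeasurableSet {y : Fin K → ℝ | c < ∑ k, llr (law θ) (law θ') (y k)} :=
    measurableSet_lt measurable_const
      (Finset.measurable_sum _ fun k _ => (measurable_llr _ _).comp (measurable_pi_apply k))
  have h2 : {s : ℕ → ℝ | c < ∑ k ∈ Finset.range K, llr (law θ) (law θ') (s k)} =
      firstObs K ⁻¹' {y : Fin K → ℝ | c < ∑ k, llr (law θ) (law θ') (y k)} := by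
    ext s
    simp [Finset.sum_range, firstObs]
  rw [← map_firstObs law θ, ← map_firstObs law θ', Measure.map_apply (measurable_firstObs K) hA,
    Measure.map_apply (measurable_firstObs K) hA, Measure.map_apply (measurable_firstObs K) hB,
    ← h2] at h1
  unfold Measure.real
  have h3 := ENNReal.toReal_mono (by finiteness) h1
  rwa [ENNReal.toReal_add (by finiteness) (by finiteness), ENNReal.toReal_mul,
    ENNReal.toReal_ofReal (Real.exp_pos c).le] at h3

end SampleLaw

/-! ### Persistence of the upper bounds up to logarithmically many observations -/

section Statistics

variable {H : Type*} {law : H → Measure ℝ} [∀ θ, IsProbabilityMeasure (law θ)]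
  {h : (k : ℕ) → (Fin k → ℝ) → ℝ} {g : ℕ → (k : ℕ) → (Fin k → ℝ) → EReal}

lemma eventually_mul_log_lt (κ : ℝ) : ∀ᶠ t : ℕ in atTop, κ * Real.log t < t := by
  have h1 : (fun t : ℕ => κ * Real.log t) =o[atTop] fun t : ℕ => (t : ℝ) :=
    (Real.isLittleO_log_id_atTop.comp_tendsto tendsto_natCast_atTop_atTop).const_mul_left κ
  filter_upwards [h1.bound (show (0 : ℝ) < 1 / 2 by norm_num), eventually_ge_atTop 1] with t ht h1t
  have h2 : (1 : ℝ) ≤ t := by exact_mod_cast h1t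
  rw [Real.norm_eq_abs, Real.norm_eq_abs, abs_of_nonneg (by linarith : (0 : ℝ) ≤ t)] at ht
  have := le_abs_self (κ * Real.log t)
  linarith

lemma tendsto_log_nat : Tendsto (fun t : ℕ => Real.log t) atTop atTop :=
  Real.tendsto_log_atTop.comp tendsto_natCast_atTop_atTop

/-- The upper bounds of an arm stay above `r < μ(θ')` as long as there are at most
`κ log t` observations, `κ < 1 / I(θ, θ')`. -/
lemma tendsto_prob_exists_upper_lt (hlaw : RegularModel law) (hstat : AdmissibleStatistics law h g)
    {θ θ' : H} (hθ : mean law θ < mean law θ') {r κ : ℝ} (hr : r < mean law θ') (hκ : 0 < κ)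
    (hκI : κ < 1 / kl law θ θ') :
    Tendsto (fun t : ℕ => (sampleLaw law θ).real
      {s | ∃ k : ℕ, 1 ≤ k ∧ (k : ℝ) ≤ κ * Real.log t ∧ g t k (firstObs k s) < (r : EReal)})
      atTop (𝓝 0) := by
  have hI := hlaw.kl_toReal_pos hθ
  set K : ℕ → ℕ := fun t => ⌊κ * Real.log t⌋₊ with hK
  have hKtop : Tendsto K atTop atTop :=
    tendsto_nat_floor_atTop.comp (tendsto_log_nat.const_mul_atTop hκ)
  have ha : kl law θ θ' < 1 / κ := by
    rw [lt_div_iff₀ hκ]; rw [lt_div_iff₀ hI] at hκI; linarith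
  have hA := (tendsto_prob_llr hlaw hθ ha).comp hKtop
  have hB : Tendsto (fun t : ℕ => (t : ℝ) * (1 - (sampleLaw law θ').real
      {s | ∀ k, 1 ≤ k → k < t → (r : EReal) ≤ g t k (firstObs k s)})) atTop (𝓝 0) := by
    have h1 := (hstat.upper θ' r hr).tendsto_div_nhds_zero
    refine h1.congr' (Eventually.of_forall fun t => ?_)
    rw [div_inv_eq_mul, mul_comm]
  have hAB := hB.add hA
  rw [add_zero] at hAB
  refine tendsto_of_tendsto_of_tendsto_of_le_of_le' tendsto_const_nhds hAB
    (Eventually.of_forall fun _ => measureReal_nonneg) ?_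
  filter_upwards [eventually_mul_log_lt κ, eventually_ge_atTop 2] with t ht h2t
  have hlog : 0 ≤ Real.log t := Real.log_natCast_nonneg t
  have htpos : (0 : ℝ) < t := by positivity
  -- All counts in question are at most `K t`, so the event is determined by the first `K t`
  -- observations and the change of measure applies to it.
  set A : Set (Fin (K t) → ℝ) := ⋃ k : Fin (K t + 1),
    {y | 1 ≤ (k : ℕ) ∧ g t k (fun j : Fin k => y ⟨j, by omega⟩) < (r : EReal)} with hAdef
  have hAm : MeasurableSet A := MeasurableSet.iUnion fun k => by
    by_cases hk : 1 ≤ (k : ℕ)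
    · simp only [hk, true_and]
      exact measurableSet_lt ((hstat.measurable_g t k).comp
        (measurable_pi_lambda _ fun j => measurable_pi_apply _)) measurable_const
    · simp [hk]
  have hmemA : ∀ s : ℕ → ℝ, s ∈ firstObs (K t) ⁻¹' A ↔
      ∃ k : ℕ, 1 ≤ k ∧ (k : ℝ) ≤ κ * Real.log t ∧ g t k (firstObs k s) < (r : EReal) := by
    intro s
    simp only [hAdef, Set.mem_preimage, Set.mem_iUnion]
    constructor
    · rintro ⟨k, hk, hlt⟩
      refine ⟨k, hk, ?_, hlt⟩
      exact (Nat.le_floor_iff (by positivity)).1 (Nat.lt_succ_iff.1 k.isLt)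
    · rintro ⟨k, hk, hkt, hlt⟩
      exact ⟨⟨k, Nat.lt_succ_of_le ((Nat.le_floor_iff (by positivity)).2 hkt)⟩, hk, hlt⟩
  have hset : {s | ∃ k : ℕ, 1 ≤ k ∧ (k : ℝ) ≤ κ * Real.log t ∧ g t k (firstObs k s) < (r : EReal)} =
      firstObs (K t) ⁻¹' A := Set.ext fun s => (hmemA s).symm
  rw [hset]
  -- The threshold `log t` gives the factor `t`, which the probability `o(1 / t)` of the event under
  -- `θ'` absorbs. The log-likelihood ratio of at most `κ log t` observations exceeds `log t` with
  -- vanishing probability, because its mean per observation is `kl law θ θ' < 1 / κ`.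
  refine (real_firstObs_le hlaw hθ hAm (Real.log t)).trans ?_
  rw [Real.exp_log htpos]
  have hKle : (K t : ℝ) ≤ κ * Real.log t := Nat.floor_le (by positivity)
  refine add_le_add (mul_le_mul_of_nonneg_left ?_ htpos.le) (measureReal_mono ?_)
  · have hGm : MeasurableSet {s : ℕ → ℝ | ∀ k, 1 ≤ k → k < t → (r : EReal) ≤ g t k (firstObs k s)} := by
      simp only [Set.ofPred_forall]
      exact MeasurableSet.iInter fun k => MeasurableSet.iInter fun _ => MeasurableSet.iInter fun _ =>
        measurableSet_le measurable_const ((hstat.measurable_g t k).comp (measurable_firstObs k))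
    rw [← probReal_compl_eq_one_sub hGm]
    refine measureReal_mono fun s hs hall => ?_
    obtain ⟨k, hk, hkt, hlt⟩ := (hmemA s).1 hs
    exact absurd (hall k hk (by exact_mod_cast hkt.trans_lt ht)) (not_le.2 hlt)
  · intro s hs
    have hs' : Real.log t < ∑ k ∈ Finset.range (K t), llr (law θ) (law θ') (s k) := hs
    refine le_trans ?_ hs'.le
    rw [one_div, inv_mul_le_iff₀ hκ]
    exact hKle

end Statistics

/-! ### Consequences of the conditions on the statistics -/

section Statistics

/-- The harmonic series diverges, so the little-o relation passes to partial sums, and harmonic sums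
are `O(log T)`. -/
lemma isLittleO_sum_of_isLittleO_inv {f : ℕ → ℝ} (hf : f =o[atTop] fun t : ℕ => (t : ℝ)⁻¹) :
    (fun T : ℕ => ∑ m ∈ Finset.Icc 1 T, f m) =o[atTop] fun T : ℕ => Real.log T := by
  have hf' : (fun t => f (t + 1)) =o[atTop] fun t : ℕ => 1 / ((t : ℝ) + 1) := by
    have h1 := hf.comp_tendsto (tendsto_add_atTop_nat 1)
    refine h1.congr (fun t => rfl) fun t => ?_
    simp
  have h1 := hf'.sum_range (fun t => by positivity) Real.tendsto_sum_range_one_div_nat_succ_atTop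
  have h2 : (fun T : ℕ => ∑ t ∈ Finset.range T, 1 / ((t : ℝ) + 1)) =O[atTop]
      fun T : ℕ => Real.log T := by
    refine IsBigO.of_bound 2 ?_
    filter_upwards [tendsto_log_nat.eventually_ge_atTop 1] with T hT
    have h3 := harmonic_le_one_add_log T
    have h4 : ((harmonic T : ℚ) : ℝ) = ∑ t ∈ Finset.range T, 1 / ((t : ℝ) + 1) := by
      unfold harmonic; push_cast; simp
    rw [h4] at h3
    rw [Real.norm_eq_abs, Real.norm_eq_abs, abs_of_nonneg (Finset.sum_nonneg fun t _ => by
      positivity), abs_of_nonneg (by linarith)]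
    linarith
  refine (h1.trans_isBigO h2).congr_left fun T => ?_
  rw [Finset.range_eq_Ico, Finset.sum_Ico_add' f 0 T 1, zero_add]
  rfl

variable {H : Type*} (law : H → Measure ℝ)
  (h : (k : ℕ) → (Fin k → ℝ) → ℝ) (g : ℕ → (k : ℕ) → (Fin k → ℝ) → EReal)

/-- The sample sequences for which the point estimates or the upper bounds of an arm are
inaccurate at some level from `m` on. -/
def badSet (θ : H) (ε : ℝ) (m : ℕ) : Set (ℕ → ℝ) :=
  {s | (∃ k, m ≤ k ∧ ε < |h k (firstObs k s) - mean law θ|) ∨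
    ∃ k, 1 ≤ k ∧ g m k (firstObs k s) < ((mean law θ - ε : ℝ) : EReal)}

variable {law h g} [∀ θ, IsProbabilityMeasure (law θ)]

lemma AdmissibleStatistics.measurable_est (hstat : AdmissibleStatistics law h g) (k : ℕ) :
    Measurable fun s : ℕ → ℝ => h k (firstObs k s) :=
  (hstat.measurable_h k).comp (measurable_firstObs k)

lemma AdmissibleStatistics.measurable_upper (hstat : AdmissibleStatistics law h g) (t k : ℕ) :
    Measurable fun s : ℕ → ℝ => g t k (firstObs k s) :=
  (hstat.measurable_g t k).comp (measurable_firstObs k)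

lemma measurableSet_badSet (hstat : AdmissibleStatistics law h g) (θ : H) (ε : ℝ) (m : ℕ) :
    MeasurableSet (badSet law h g θ ε m) := by
  unfold badSet
  simp only [Set.ofPred_or, Set.ofPred_exists, Set.ofPred_and]
  refine MeasurableSet.union (MeasurableSet.iUnion fun k => MeasurableSet.inter (.const _) ?_)
    (MeasurableSet.iUnion fun k => MeasurableSet.inter (.const _) ?_)
  · exact measurableSet_lt measurable_const
      (continuous_abs.measurable.comp ((hstat.measurable_est k).sub_const _))
  · exact measurableSet_lt (hstat.measurable_upper m k) measurable_const

/-- The bad set looks at the upper bounds at the single time `m`; monotonicity in time extends their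
accuracy to all later times. -/
lemma concentratedFrom_of_notMem_badSet {N : ℕ} (hstat : AdmissibleStatistics law h g)
    {Θ : Fin N → H} {ξ : Fin N → ℕ → ℝ} {ε : ℝ} {m : ℕ} (hm : 1 ≤ m)
    (hξ : ∀ n, ξ n ∉ badSet law h g (Θ n) ε m) :
    ConcentratedFrom h g (fun n => mean law (Θ n)) ξ ε m where
  est n k hk := by
    by_contra! hlt
    exact hξ n (Or.inl ⟨k, hk, hlt⟩)
  upper n t k ht hk := by
    refine le_trans ?_ (hstat.mono k hk _ m t hm ht)
    by_contra! hlt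
    exact hξ n (Or.inr ⟨k, hk, hlt⟩)

lemma badSet_antitone (hstat : AdmissibleStatistics law h g) (θ : H) (ε : ℝ) {m m' : ℕ}
    (hm : 1 ≤ m) (hmm : m ≤ m') : badSet law h g θ ε m' ⊆ badSet law h g θ ε m := by
  rintro s (⟨k, hk, hlt⟩ | ⟨k, hk, hlt⟩)
  · exact Or.inl ⟨k, hmm.trans hk, hlt⟩
  · exact Or.inr ⟨k, hk, (hstat.mono k hk _ m m' hm hmm).trans_lt hlt⟩

/-- The point estimates from level `m` on are accurate with probability `1 - o(1 / m)`. -/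
lemma isLittleO_prob_exists_est (hstat : AdmissibleStatistics law h g) (θ : H) {ε : ℝ}
    (hε : 0 < ε) :
    (fun m : ℕ => (sampleLaw law θ).real
      {s | ∃ k, m ≤ k ∧ ε < |h k (firstObs k s) - mean law θ|}) =o[atTop]
      fun m : ℕ => (m : ℝ)⁻¹ := by
  have hu := hstat.consistent θ ε hε (1 / 2) (by norm_num) (by norm_num)
  rw [isLittleO_iff] at hu ⊢
  intro c hc
  obtain ⟨t₀, ht₀⟩ := eventually_atTop.1 (hu hc)
  filter_upwards [eventually_ge_atTop (max 1 t₀)] with m hm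
  have hm1 : 1 ≤ m := le_of_max_le_left hm
  have hmt : t₀ ≤ m := le_of_max_le_right hm
  have hm0 : (0 : ℝ) < m := by exact_mod_cast hm1
  -- Dyadic covering: the counts `k ≥ m` lie in the blocks `[2 ^ j * m, 2 ^ (j + 1) * m]`, the block
  -- `j` being the window of the consistency condition with `d = 1 / 2` at time `2 ^ (j + 1) * m`.
  -- The bounds `c / (2 ^ (j + 1) * m)` sum to `c / m`.
  set U : ℕ → Set (ℕ → ℝ) := fun t =>
    {s | ∃ k : ℕ, 1 / 2 * (t : ℝ) ≤ k ∧ k ≤ t ∧ ε < |h k (firstObs k s) - mean law θ|} with hU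
  have hsub : {s | ∃ k, m ≤ k ∧ ε < |h k (firstObs k s) - mean law θ|} ⊆
      ⋃ j : ℕ, U (2 ^ (j + 1) * m) := by
    rintro s ⟨k, hk, hlt⟩
    have hkm : k / m ≠ 0 := (Nat.div_pos hk hm1).ne'
    have h1 := Nat.pow_log_le_self 2 hkm
    have h2 := Nat.lt_pow_succ_log_self (b := 2) (by norm_num) (k / m)
    refine Set.mem_iUnion.2 ⟨Nat.log 2 (k / m), k, ?_, ?_, hlt⟩
    · have h3 : 2 ^ Nat.log 2 (k / m) * m ≤ k :=
        (Nat.mul_le_mul_right m h1).trans (Nat.div_mul_le_self k m)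
      have h4 : ((2 ^ Nat.log 2 (k / m) * m : ℕ) : ℝ) ≤ k := by exact_mod_cast h3
      push_cast at h4 ⊢
      rw [pow_succ]
      linarith
    · exact ((Nat.div_lt_iff_lt_mul hm1).1 h2).le
  have hU' : ∀ j : ℕ, sampleLaw law θ (U (2 ^ (j + 1) * m)) ≤
      ENNReal.ofReal (c / m / 2 / 2 ^ j) := by
    intro j
    have h1 := ht₀ (2 ^ (j + 1) * m) (hmt.trans (Nat.le_mul_of_pos_left m (by positivity)))
    rw [Real.norm_eq_abs, abs_of_nonneg measureReal_nonneg, Real.norm_eq_abs,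
      abs_of_nonneg (by positivity)] at h1
    rw [← ofReal_measureReal]
    refine ENNReal.ofReal_le_ofReal (h1.trans_eq ?_)
    push_cast
    rw [pow_succ]
    field_simp
  have hle : sampleLaw law θ {s | ∃ k, m ≤ k ∧ ε < |h k (firstObs k s) - mean law θ|} ≤
      ENNReal.ofReal (c / m) := by
    refine (measure_mono hsub).trans ((measure_iUnion_le _).trans ?_)
    refine (ENNReal.tsum_le_tsum hU').trans ?_
    rw [← ENNReal.ofReal_tsum_of_nonneg (fun j => by positivity) (summable_geometric_two' _),
      tsum_geometric_two']
  rw [Real.norm_eq_abs, abs_of_nonneg measureReal_nonneg, Real.norm_eq_abs,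
    abs_of_nonneg (by positivity), ← div_eq_mul_inv]
  exact ENNReal.toReal_le_of_le_ofReal (by positivity) hle

lemma isLittleO_prob_badSet (hstat : AdmissibleStatistics law h g) (θ : H) {ε : ℝ} (hε : 0 < ε) :
    (fun m : ℕ => (sampleLaw law θ).real (badSet law h g θ ε m)) =o[atTop]
      fun m : ℕ => (m : ℝ)⁻¹ := by
  have h1 := (isLittleO_prob_exists_est hstat θ hε).add
    (hstat.upper θ (mean law θ - ε) (by linarith))
  refine IsBigO.trans_isLittleO (IsBigO.of_bound 1 ?_) h1
  filter_upwards [eventually_ge_atTop 1] with m hm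
  rw [Real.norm_eq_abs, abs_of_nonneg measureReal_nonneg, one_mul]
  refine le_trans ?_ (le_abs_self _)
  have hGm : MeasurableSet {s : ℕ → ℝ | ∀ k, 1 ≤ k → k < m →
      ((mean law θ - ε : ℝ) : EReal) ≤ g m k (firstObs k s)} := by
    simp only [Set.ofPred_forall]
    exact MeasurableSet.iInter fun k => MeasurableSet.iInter fun _ => MeasurableSet.iInter fun _ =>
      measurableSet_le measurable_const (hstat.measurable_upper m k)
  rw [← probReal_compl_eq_one_sub hGm]
  refine (measureReal_mono ?_).trans (measureReal_union_le _ _)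
  rintro s (hs | ⟨k, hk, hlt⟩)
  · exact Or.inl hs
  -- The condition on the upper bounds covers only `k < m`. For `k ≥ m` an upper bound below `μ - ε`
  -- forces the point estimate below `μ - ε` too, which is an estimation error.
  · by_cases hkm : k < m
    · exact Or.inr fun hall => absurd (hall k hk hkm) (not_le.2 hlt)
    · refine Or.inl ⟨k, not_lt.1 hkm, ?_⟩
      have h2 := EReal.coe_lt_coe_iff.1 ((hstat.le_upper m k hm hk _).trans_lt hlt)
      rw [lt_abs]
      right
      linarith

/-- The expected number of levels at which the statistics of some arm are inaccurate. -/
lemma isLittleO_sum_badSet {N : ℕ} (hstat : AdmissibleStatistics law h g) (Θ : Fin N → H) {ε : ℝ}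
    (hε : 0 < ε) :
    (fun T : ℕ => ∑ m ∈ Finset.Icc 1 T, ∑ n, (sampleLaw law (Θ n)).real
      (badSet law h g (Θ n) ε m)) =o[atTop] fun T : ℕ => Real.log T :=
  isLittleO_sum_of_isLittleO_inv (by
    simpa only [Finset.sum_fn] using
      IsLittleO.sum (s := Finset.univ) fun n _ => isLittleO_prob_badSet hstat (Θ n) hε)

variable (law g) in
/-- The probability that the upper bound in slot `t` with `k` observations is at least `r`. -/
noncomputable def upperProb (θ : H) (r : ℝ) (t k : ℕ) : ℝ :=
  (sampleLaw law θ).real {s | (r : EReal) ≤ g t k (firstObs k s)}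

lemma upperProb_nonneg (θ : H) (r : ℝ) (t k : ℕ) :
    0 ≤ upperProb law g θ r t k := measureReal_nonneg

lemma exists_sum_upperProb_le (hstat : AdmissibleStatistics law h g) {θ θ' : H}
    (hθ : mean law θ < mean law θ') {η : ℝ} (hη : 0 < η) :
    ∃ ε₀ : ℝ, 0 < ε₀ ∧ ∀ ε, 0 < ε → ε < ε₀ → ∀ᶠ T : ℕ in atTop,
      ∑ k ∈ Finset.Ico 1 T, upperProb law g θ (mean law θ' - ε) T k ≤
        (1 / kl law θ θ' + η) * Real.log T := by
  obtain ⟨L, hL, hLle⟩ := hstat.sharp θ θ' hθ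
  have h1 : L < ((1 / kl law θ θ' + η : ℝ) : EReal) :=
    hLle.trans_lt (EReal.coe_lt_coe_iff.2 (by linarith))
  obtain ⟨ε₀, hε₀, hsub⟩ := mem_nhdsGT_iff_exists_Ioo_subset.1 (hL.eventually_lt_const h1)
  refine ⟨ε₀, hε₀, fun ε hε hεε => ?_⟩
  have h0 : limsup (fun t : ℕ => (((∑ k ∈ Finset.Ico 1 t, (sampleLaw law θ).real
      {s | ((mean law θ' - ε : ℝ) : EReal) ≤ g t k (firstObs k s)}) / Real.log t : ℝ) : EReal))
      atTop < ((1 / kl law θ θ' + η : ℝ) : EReal) := hsub ⟨hε, hεε⟩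
  have h2 := eventually_lt_of_limsup_lt h0
  filter_upwards [h2, tendsto_log_nat.eventually_gt_atTop 0] with T hT hlog
  have h3 := (EReal.coe_lt_coe_iff.1 hT).le
  rw [div_le_iff₀ hlog] at h3
  exact h3

/-- The expected number of observation counts beyond `log T / I(θ, θ')` for which the upper bound
exceeds `μ(θ') - ε` is negligible. -/
lemma exists_sum_upperProb_tail_le (hlaw : RegularModel law) (hstat : AdmissibleStatistics law h g)
    {θ θ' : H} (hθ : mean law θ < mean law θ') {η : ℝ} (hη : 0 < η) :
    ∃ ε₀ : ℝ, 0 < ε₀ ∧ ∀ ε, 0 < ε → ε < ε₀ → ∀ᶠ T : ℕ in atTop,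
      ∑ k ∈ (Finset.Ico 1 T).filter (fun k : ℕ => 1 / kl law θ θ' * Real.log T < k),
        upperProb law g θ (mean law θ' - ε) T k ≤ η * Real.log T := by
  have hI := hlaw.kl_toReal_pos hθ
  set ι := 1 / kl law θ θ' with hι
  have hι0 : 0 < ι := by positivity
  -- The final comparison loses four terms of size at most `η' log T`: the excess of the full sum,
  -- the gap between `κ` and `ι`, the rounding in `K`, and the defect of the head terms from `1`.
  set η' := min η ι / 4 with hη'
  have hmin : 0 < min η ι := lt_min hη hι0
  have hη'0 : 0 < η' := by positivity
  have hη'η : 4 * η' ≤ η := by rw [hη']; linarith [min_le_left η ι]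
  have hη'ι : 4 * η' ≤ ι := by rw [hη']; linarith [min_le_right η ι]
  obtain ⟨ε₀, hε₀, hsum⟩ := exists_sum_upperProb_le hstat hθ hη'0
  refine ⟨ε₀, hε₀, fun ε hε hεε => ?_⟩
  set κ := ι - η' with hκ
  have hκ0 : 0 < κ := by linarith
  have hp := tendsto_prob_exists_upper_lt hlaw hstat hθ (r := mean law θ' - ε) (by linarith) hκ0
    (by linarith : κ < ι)
  filter_upwards [hsum ε hε hεε, hp.eventually_lt_const (show (0 : ℝ) < η' / ι by positivity),
    eventually_mul_log_lt κ, tendsto_log_nat.eventually_ge_atTop (1 / η'),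
    eventually_ge_atTop 2] with T hT hpT hκT hlog hT2
  set p := (sampleLaw law θ).real {s | ∃ k : ℕ, 1 ≤ k ∧ (k : ℝ) ≤ κ * Real.log T ∧
    g T k (firstObs k s) < ((mean law θ' - ε : ℝ) : EReal)}
  have hlog0 : 0 < Real.log T := lt_of_lt_of_le (by positivity) hlog
  have hlog1 : 1 ≤ η' * Real.log T := by
    rw [div_le_iff₀ hη'0] at hlog; linarith
  set K := ⌊κ * Real.log T⌋₊ with hK
  have hKle : (K : ℝ) ≤ κ * Real.log T := Nat.floor_le (by positivity)
  have hKT : K < T := by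
    have : (K : ℝ) < T := hKle.trans_lt hκT
    exact_mod_cast this
  -- Up to `κ log T` observations the bound stays high with probability close to `1`. The head thus
  -- already uses up nearly all of the total allowed by the sharpness condition, leaving little for
  -- the tail.
  have hhead : ∀ k ∈ Finset.Icc 1 K, 1 - η' / ι ≤ upperProb law g θ (mean law θ' - ε) T k := by
    intro k hk
    rw [Finset.mem_Icc] at hk
    have h1 : 1 - upperProb law g θ (mean law θ' - ε) T k ≤ p := by
      unfold upperProb
      rw [← probReal_compl_eq_one_sub (measurableSet_le measurable_const
        (hstat.measurable_upper T k))]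
      refine measureReal_mono fun s hs => ⟨k, hk.1, ?_, not_le.1 hs⟩
      exact le_trans (by exact_mod_cast hk.2) hKle
    linarith
  have hheadsum : K * (1 - η' / ι) ≤
      ∑ k ∈ Finset.Icc 1 K, upperProb law g θ (mean law θ' - ε) T k := by
    have := Finset.card_nsmul_le_sum _ _ _ hhead
    simpa using this
  have hdisj : Disjoint (Finset.Icc 1 K)
      ((Finset.Ico 1 T).filter (fun k : ℕ => ι * Real.log T < k)) := by
    rw [Finset.disjoint_left]
    intro k hk hk'
    rw [Finset.mem_Icc] at hk
    have h1 := (Finset.mem_filter.1 hk').2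
    have h2 : (k : ℝ) ≤ K := by exact_mod_cast hk.2
    have h3 : κ * Real.log T ≤ ι * Real.log T := by gcongr; linarith
    linarith
  have htot : ∑ k ∈ Finset.Icc 1 K, upperProb law g θ (mean law θ' - ε) T k +
      ∑ k ∈ (Finset.Ico 1 T).filter (fun k : ℕ => ι * Real.log T < k),
        upperProb law g θ (mean law θ' - ε) T k ≤
      ∑ k ∈ Finset.Ico 1 T, upperProb law g θ (mean law θ' - ε) T k := by
    rw [← Finset.sum_union hdisj]
    refine Finset.sum_le_sum_of_subset_of_nonneg (fun k hk => ?_)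
      fun k _ _ => upperProb_nonneg _ _ _ _
    rcases Finset.mem_union.1 hk with hk | hk
    · rw [Finset.mem_Icc] at hk
      exact Finset.mem_Ico.2 ⟨hk.1, by omega⟩
    · exact (Finset.mem_filter.1 hk).1
  have hKge : κ * Real.log T - 1 ≤ K := (Nat.sub_one_lt_floor _).le
  have hfrac : η' / ι ≤ 1 := by rw [div_le_one hι0]; linarith
  have h5 : (κ * Real.log T - 1) * (1 - η' / ι) ≤ K * (1 - η' / ι) :=
    mul_le_mul_of_nonneg_right hKge (by linarith)
  have h6 : κ * Real.log T * (η' / ι) ≤ η' * Real.log T := by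
    have : κ * (η' / ι) ≤ η' := by
      rw [mul_div_assoc', div_le_iff₀ hι0]; nlinarith
    nlinarith
  have h7 : 0 ≤ η' / ι := by positivity
  have h8 : 4 * η' * Real.log T ≤ η * Real.log T := mul_le_mul_of_nonneg_right hη'η hlog0.le
  have h9 : (ι + η') * Real.log T = κ * Real.log T + 2 * (η' * Real.log T) := by rw [hκ]; ring
  nlinarith

end Statistics

/-! ### Expected numbers of plays -/

section Expectation

variable {Ω : Type*}

lemma card_filter_eq_sum_indicator (s : Finset ℕ) (R : Ω → ℕ → Prop)
    [∀ ω, DecidablePred (R ω)] (ω : Ω) : (((s.filter (R ω)).card : ℕ) : ℝ) =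
      ∑ t ∈ s, {ω | R ω t}.indicator (fun _ => (1 : ℝ)) ω := by
  rw [Finset.card_filter]
  push_cast
  refine Finset.sum_congr rfl fun t _ => ?_
  simp only [Set.indicator_apply, Set.mem_ofPred_eq]

variable [MeasurableSpace Ω] {P : Measure Ω} [IsProbabilityMeasure P]

lemma integrable_card_filter (s : Finset ℕ) (R : Ω → ℕ → Prop) [∀ ω, DecidablePred (R ω)]
    (hR : ∀ t ∈ s, MeasurableSet {ω | R ω t}) :
    Integrable (fun ω => (((s.filter (R ω)).card : ℕ) : ℝ)) P := by
  simp only [card_filter_eq_sum_indicator]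
  exact integrable_finsetSum _ fun t ht => (integrable_const _).indicator (hR t ht)

lemma integral_card_filter (s : Finset ℕ) (R : Ω → ℕ → Prop) [∀ ω, DecidablePred (R ω)]
    (hR : ∀ t ∈ s, MeasurableSet {ω | R ω t}) :
    ∫ ω, (((s.filter (R ω)).card : ℕ) : ℝ) ∂P = ∑ t ∈ s, P.real {ω | R ω t} := by
  simp only [card_filter_eq_sum_indicator]
  rw [integral_finsetSum _ fun t ht => (integrable_const _).indicator (hR t ht)]
  refine Finset.sum_congr rfl fun t ht => ?_
  rw [integral_indicator (hR t ht)]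
  simp

lemma integrable_idx (R : Ω → ℕ → Prop) [∀ ω, DecidablePred (R ω)]
    (hR : ∀ t, MeasurableSet {ω | R ω t}) (T : ℕ) :
    Integrable (fun ω => (idx (R ω) T : ℝ)) P :=
  integrable_card_filter _ _ fun t _ => hR t

omit [IsProbabilityMeasure P] in
/-- A nonnegative quantity whose expectation is `O(log T)` is rarely of order `T`. -/
lemma tendsto_prob_ge_of_isBigO_log {V : ℕ → Ω → ℝ} (hV0 : ∀ T ω, 0 ≤ V T ω)
    (hVi : ∀ T, Integrable (V T) P)
    (hV : (fun T => ∫ ω, V T ω ∂P) =O[atTop] fun T : ℕ => Real.log T) {c : ℝ} (hc : 0 < c) :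
    Tendsto (fun T : ℕ => P.real {ω | c * T ≤ V T ω}) atTop (𝓝 0) := by
  have h1 : Tendsto (fun T : ℕ => (∫ ω, V T ω ∂P) / (T : ℝ)) atTop (𝓝 0) :=
    (hV.trans_isLittleO (Real.isLittleO_log_id_atTop.comp_tendsto
      tendsto_natCast_atTop_atTop)).tendsto_div_nhds_zero
  have h2 := h1.const_mul (1 / c)
  rw [mul_zero] at h2
  refine tendsto_of_tendsto_of_tendsto_of_le_of_le' tendsto_const_nhds h2
    (Eventually.of_forall fun _ => measureReal_nonneg) ?_
  filter_upwards [eventually_gt_atTop 0] with T hT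
  have hT' : (0 : ℝ) < T := by exact_mod_cast hT
  have h3 := mul_meas_ge_le_integral_of_nonneg (Eventually.of_forall (hV0 T)) (hVi T) (c * T)
  rw [div_mul_div_comm, one_mul, le_div_iff₀ (by positivity)]
  linarith

/-- A function that grows by `o(log T)` between `T ^ ρ` and `T` is `o(log T)`. -/
lemma isLittleO_log_of_recursion {f : ℕ → ℝ} (hf0 : ∀ T, 0 ≤ f T)
    (hf : f =O[atTop] fun T : ℕ => Real.log T) {τ : ℕ → ℕ} (hτ : Tendsto τ atTop atTop)
    {ρ : ℝ} (hρ0 : 0 ≤ ρ) (hρ : ρ < 1) (hτρ : ∀ᶠ T : ℕ in atTop, Real.log (τ T) ≤ ρ * Real.log T)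
    (hrec : ∀ η : ℝ, 0 < η → ∀ᶠ T : ℕ in atTop, f T ≤ f (τ T) + η * Real.log T) :
    f =o[atTop] fun T : ℕ => Real.log T := by
  obtain ⟨C, hC0, hC⟩ := hf.exists_nonneg
  -- Each passage from `T` to `τ T` shrinks the logarithm by the factor `ρ`, so a fixed but large
  -- number of iterations makes the initial constant `C` negligible.
  have hiter : ∀ k : ℕ, ∀ η : ℝ, 0 < η → ∀ᶠ T : ℕ in atTop, f T ≤ (ρ ^ k * C + η) * Real.log T := by
    intro k
    induction k with
    | zero =>
      intro η hη
      filter_upwards [hC.bound, tendsto_log_nat.eventually_ge_atTop 0] with T hT hlog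
      rw [Real.norm_eq_abs, Real.norm_eq_abs, abs_of_nonneg (hf0 T), abs_of_nonneg hlog] at hT
      nlinarith
    | succ k ih =>
      intro η hη
      filter_upwards [hτ.eventually (ih (η / 2) (by positivity)), hτρ, hrec (η / 2) (by positivity),
        tendsto_log_nat.eventually_ge_atTop 0] with T h1 h2 h3 hlog
      have h4 : (ρ ^ k * C + η / 2) * Real.log (τ T) ≤ (ρ ^ k * C + η / 2) * (ρ * Real.log T) :=
        mul_le_mul_of_nonneg_left h2 (by positivity)
      have h5 : η / 2 * (ρ * Real.log T) ≤ η / 2 * Real.log T := by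
        apply mul_le_mul_of_nonneg_left _ (by positivity)
        nlinarith
      rw [pow_succ]
      nlinarith
  rw [isLittleO_iff]
  intro c hc
  have hlim : Tendsto (fun k : ℕ => ρ ^ k * C) atTop (𝓝 (0 * C)) :=
    (tendsto_pow_atTop_nhds_zero_of_lt_one hρ0 hρ).mul_const C
  rw [zero_mul] at hlim
  obtain ⟨k, hk⟩ := (hlim.eventually_lt_const (show (0 : ℝ) < c / 2 by positivity)).exists
  filter_upwards [hiter k (c / 2) (by positivity), tendsto_log_nat.eventually_ge_atTop 0]
    with T hT hlog
  rw [Real.norm_eq_abs, Real.norm_eq_abs, abs_of_nonneg (hf0 T), abs_of_nonneg hlog]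
  nlinarith

end Expectation

/-! ### The random counts of a player and their measurability -/

/-- A multi-armed bandit with `M` players that use the time division fair sharing policy: the
constants of the policy, the parameters of the arms, their order, and the arm states. -/
structure System {H : Type*} (law : H → Measure ℝ) [∀ θ, IsProbabilityMeasure (law θ)]
    (h : (k : ℕ) → (Fin k → ℝ) → ℝ) (g : ℕ → (k : ℕ) → (Fin k → ℝ) → EReal) (M N : ℕ) [NeZero N]
    {Ω : Type*} [MeasurableSpace Ω] (P : Measure Ω) where
  δ : ℝ
  tie : Finset (Fin N) → Fin N
  Θ : Fin N → H
  σ : Equiv.Perm (Fin N)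
  S : ℕ → Ω → Fin N → ℝ
  model : RegularModel law
  stat : AdmissibleStatistics law h g
  lt : M < N
  δ_pos : 0 < δ
  δ_lt : δ < 1 / N
  tie_mem : ∀ A : Finset (Fin N), A.Nonempty → tie A ∈ A
  mean_lt : ∀ n₀ n, (σ.symm n₀ : ℕ) < M → (σ.symm n₀ : ℕ) < σ.symm n →
    mean law (Θ n) < mean law (Θ n₀)
  kl_lt : ∀ n j m, (σ.symm m : ℕ) + 1 = M → (σ.symm j : ℕ) < σ.symm m →
    (σ.symm m : ℕ) < σ.symm n → kl law (Θ n) (Θ m) < kl law (Θ n) (Θ j)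
  measurable_S : ∀ t, Measurable (S t)
  indep : iIndepFun (fun t => S (t + 1)) P
  dist : ∀ t, 1 ≤ t → ∀ n, P.map (fun ω => S t ω n) = law (Θ n)

namespace System

variable {H : Type*} {law : H → Measure ℝ} [∀ θ, IsProbabilityMeasure (law θ)]
  {h : (k : ℕ) → (Fin k → ℝ) → ℝ} {g : ℕ → (k : ℕ) → (Fin k → ℝ) → EReal} {M N : ℕ} [NeZero N]
  {Ω : Type*} [MeasurableSpace Ω] {P : Measure Ω} (E : System law h g M N P) (i : Fin M)

/-- The policy of player `i`. -/
noncomputable abbrev policy : LocalPolicy N := tdfs E.δ h g E.tie i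

/-- The states of the arms in all slots. -/
abbrev path (ω : Ω) : ℕ → Fin N → ℝ := fun s => E.S s ω

/-- The rank of arm `n`, counted from `0`. -/
abbrev pos (n : Fin N) : ℕ := E.σ.symm n

/-- The mean of arm `n`. -/
noncomputable abbrev μ (n : Fin N) : ℝ := mean law (E.Θ n)

/-- The number of slots up to `T` in which player `i` targets at rank `q` and plays another arm. -/
noncomputable def wrong (q T : ℕ) (ω : Ω) : ℕ :=
  idx (Wrong E.δ h g E.tie i (E.path ω) E.σ q) T

/-- The number of slots up to `T` in which player `i` targets at rank `q` and plays an arm of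
smaller rank. -/
noncomputable def wrongBetter (q T : ℕ) (ω : Ω) : ℕ :=
  idx (fun t => rank i t = q ∧ E.pos (action (E.policy i) (E.path ω) t) < q) T

/-- The number of slots up to `T` in which player `i` targets at rank `q` and plays arm `n`. -/
noncomputable def playsAt (q : ℕ) (n : Fin N) (T : ℕ) (ω : Ω) : ℕ :=
  idx (fun t => rank i t = q ∧ action (E.policy i) (E.path ω) t = n) T

open Classical in
/-- The number of levels up to `T` at which the statistics of some arm are inaccurate. -/
noncomputable def badLevels (ε : ℝ) (T : ℕ) (ω : Ω) : ℕ :=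
  ((Finset.Icc 1 T).filter (fun m => ∃ n, sample (E.policy i) (E.path ω) n T ∈
    badSet law h g (E.Θ n) ε m)).card

open Classical in
/-- The number of observation counts `k ∈ s` for which the upper bound of arm `n` in slot `T` is at
least `r`. -/
noncomputable def upperCount (n : Fin N) (r : ℝ) (T : ℕ) (s : Finset ℕ) (ω : Ω) : ℕ :=
  (s.filter (fun k => (r : EReal) ≤
    g T k (firstObs k (sample (E.policy i) (E.path ω) n T)))).card

lemma measurable_action_policy (t : ℕ) :
    Measurable fun x : ℕ → Fin N → ℝ => action (E.policy i) x t :=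
  measurable_tdfs_action E.stat.measurable_h E.stat.measurable_g _ _ _ t

lemma measurable_action (t : ℕ) : Measurable fun ω => action (E.policy i) (E.path ω) t :=
  (E.measurable_action_policy i t).comp (measurable_path E.measurable_S)

lemma measurable_sample (n : Fin N) (T : ℕ) :
    Measurable fun ω => sample (E.policy i) (E.path ω) n T :=
  DecMAB.measurable_sample E.measurable_S (E.measurable_action_policy i) n T

lemma measurableSet_action (t : ℕ) (R : Fin N → Prop) :
    MeasurableSet {ω | R (action (E.policy i) (E.path ω) t)} :=
  E.measurable_action i t (MeasurableSet.of_discrete (s := {n | R n}))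

lemma measurableSet_rank_action (q t : ℕ) (R : Fin N → Prop) :
    MeasurableSet {ω | rank i t = q ∧ R (action (E.policy i) (E.path ω) t)} :=
  (MeasurableSet.const _).inter (E.measurableSet_action i t R)

variable [IsProbabilityMeasure P]

lemma prob_sample (n : Fin N) (T : ℕ) {B : Set (ℕ → ℝ)} (hB : MeasurableSet B) :
    P.real {ω | sample (E.policy i) (E.path ω) n T ∈ B} = (sampleLaw law (E.Θ n)).real B := by
  have h1 := map_sample E.measurable_S E.indep E.dist (E.measurable_action_policy i) n T
  unfold Measure.real
  rw [← h1, Measure.map_apply (E.measurable_sample i n T) hB]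
  rfl

lemma integrable_wrong (q T : ℕ) : Integrable (fun ω => (E.wrong i q T ω : ℝ)) P := by
  unfold wrong
  refine integrable_idx (fun ω => Wrong E.δ h g E.tie i (E.path ω) E.σ q) (fun t => ?_) T
  unfold Wrong
  exact E.measurableSet_rank_action i q t fun n => (E.σ.symm n : ℕ) ≠ q

lemma integrable_wrongBetter (q T : ℕ) :
    Integrable (fun ω => (E.wrongBetter i q T ω : ℝ)) P := by
  unfold wrongBetter
  exact integrable_idx
    (fun ω t => rank i t = q ∧ E.pos (action (E.policy i) (E.path ω) t) < q)
    (fun t => E.measurableSet_rank_action i q t fun n => E.pos n < q) T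

lemma integrable_playsAt (q : ℕ) (n : Fin N) (T : ℕ) :
    Integrable (fun ω => (E.playsAt i q n T ω : ℝ)) P := by
  unfold playsAt
  exact integrable_idx (fun ω t => rank i t = q ∧ action (E.policy i) (E.path ω) t = n)
    (fun t => E.measurableSet_rank_action i q t fun n' => n' = n) T

omit [IsProbabilityMeasure P] in
lemma measurableSet_badLevel (ε : ℝ) (T m : ℕ) : MeasurableSet {ω | ∃ n,
    sample (E.policy i) (E.path ω) n T ∈ badSet law h g (E.Θ n) ε m} := by
  simp only [Set.ofPred_exists]
  exact MeasurableSet.iUnion fun n =>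
    E.measurable_sample i n T (measurableSet_badSet E.stat (E.Θ n) ε m)

lemma integrable_badLevels (ε : ℝ) (T : ℕ) : Integrable (fun ω => (E.badLevels i ε T ω : ℝ)) P := by
  classical
  exact integrable_card_filter _ _ fun m _ => E.measurableSet_badLevel i ε T m

lemma integral_badLevels_le (ε : ℝ) (T : ℕ) : ∫ ω, (E.badLevels i ε T ω : ℝ) ∂P ≤
    ∑ m ∈ Finset.Icc 1 T, ∑ n, (sampleLaw law (E.Θ n)).real (badSet law h g (E.Θ n) ε m) := by
  classical
  unfold badLevels
  rw [integral_card_filter _ _ fun m _ => E.measurableSet_badLevel i ε T m]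
  refine Finset.sum_le_sum fun m _ => ?_
  simp only [Set.ofPred_exists]
  refine (measureReal_iUnion_fintype_le _).trans (Finset.sum_le_sum fun n _ => ?_)
  exact (E.prob_sample i n T (measurableSet_badSet E.stat (E.Θ n) ε m)).le

lemma isLittleO_badLevels {ε : ℝ} (hε : 0 < ε) :
    (fun T => ∫ ω, (E.badLevels i ε T ω : ℝ) ∂P) =o[atTop] fun T : ℕ => Real.log T := by
  refine IsBigO.trans_isLittleO (IsBigO.of_bound 1 (Eventually.of_forall fun T => ?_))
    (isLittleO_sum_badSet E.stat E.Θ hε)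
  rw [Real.norm_eq_abs, abs_of_nonneg (integral_nonneg fun _ => Nat.cast_nonneg _), one_mul]
  exact (E.integral_badLevels_le i ε T).trans (le_abs_self _)

omit [IsProbabilityMeasure P] in
lemma measurableSet_upper (n : Fin N) (r : ℝ) (T k : ℕ) : MeasurableSet {ω | (r : EReal) ≤
    g T k (firstObs k (sample (E.policy i) (E.path ω) n T))} :=
  measurableSet_le measurable_const
    ((E.stat.measurable_upper T k).comp (E.measurable_sample i n T))

lemma integrable_upperCount (n : Fin N) (r : ℝ) (T : ℕ) (s : Finset ℕ) :
    Integrable (fun ω => (E.upperCount i n r T s ω : ℝ)) P := by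
  classical
  exact integrable_card_filter _ _ fun k _ => E.measurableSet_upper i n r T k

lemma integral_upperCount (n : Fin N) (r : ℝ) (T : ℕ) (s : Finset ℕ) :
    ∫ ω, (E.upperCount i n r T s ω : ℝ) ∂P = ∑ k ∈ s, upperProb law g (E.Θ n) r T k := by
  classical
  unfold upperCount
  rw [integral_card_filter _ _ fun k _ => E.measurableSet_upper i n r T k]
  refine Finset.sum_congr rfl fun k _ => ?_
  exact E.prob_sample i n T (measurableSet_le measurable_const (E.stat.measurable_upper T k))

omit [IsProbabilityMeasure P] in
/-- The statistics are accurate from the level after the bad ones on. -/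
lemma concentratedFrom_badLevels (ε : ℝ) (T : ℕ) (ω : Ω) (hT : E.badLevels i ε T ω + 1 ≤ T) :
    ConcentratedFrom h g E.μ (fun n => sample (E.policy i) (E.path ω) n T) ε
      (E.badLevels i ε T ω + 1) := by
  classical
  refine concentratedFrom_of_notMem_badSet E.stat (by omega) fun n hn => ?_
  have h1 : Finset.Icc 1 (E.badLevels i ε T ω + 1) ⊆ (Finset.Icc 1 T).filter (fun m => ∃ n,
      sample (E.policy i) (E.path ω) n T ∈ badSet law h g (E.Θ n) ε m) := by
    intro m hm
    rw [Finset.mem_Icc] at hm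
    refine Finset.mem_filter.2 ⟨Finset.mem_Icc.2 ⟨hm.1, hm.2.trans hT⟩, n, ?_⟩
    exact badSet_antitone E.stat _ _ hm.1 hm.2 hn
  have h2 := Finset.card_le_card h1
  rw [Nat.card_Icc] at h2
  unfold badLevels at h2
  omega

end System

/-! ### Logarithmic bounds for the numbers of wrong plays -/

namespace System

variable {H : Type*} {law : H → Measure ℝ} [∀ θ, IsProbabilityMeasure (law θ)]
  {h : (k : ℕ) → (Fin k → ℝ) → ℝ} {g : ℕ → (k : ℕ) → (Fin k → ℝ) → EReal} {M N : ℕ} [NeZero N]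
  {Ω : Type*} [MeasurableSpace Ω] {P : Measure Ω} (E : System law h g M N P) (i : Fin M)

/-- The number `ε` is small compared with the differences between the means of the best arms. -/
def Gap (ε : ℝ) : Prop :=
  ∀ n₀ n, E.pos n₀ < M → E.pos n₀ < E.pos n → E.μ n + ε < E.μ n₀ - ε

lemma eventually_gap : ∀ᶠ ε in 𝓝[>] (0 : ℝ), E.Gap ε := by
  simp only [Gap, eventually_all]
  intro n₀ n h1 h2
  have h3 := E.mean_lt n₀ n h1 h2
  have h4 : 0 < (E.μ n₀ - E.μ n) / 2 := by linarith
  filter_upwards [Ioo_mem_nhdsGT h4] with ε hε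
  linarith [hε.2]

/-- A constant such that the procedure is mature in the slots with number at least `C G`. -/
noncomputable def matureConst : ℕ := (exists_isMature (N := N) E.δ_pos E.δ_lt).choose

lemma one_le_matureConst : 1 ≤ E.matureConst :=
  (exists_isMature (N := N) E.δ_pos E.δ_lt).choose_spec.1

lemma matureConst_spec : ∀ G m, 1 ≤ G → E.matureConst * G ≤ m →
    ∃ m₁, IsMature N E.δ G m₁ m :=
  (exists_isMature (N := N) E.δ_pos E.δ_lt).choose_spec.2

/-- A bound for the number of slots with target of rank `q` in which the arm of rank `q` is not
known to be the leader of the procedure. -/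
noncomputable def overhead (ε : ℝ) (q T : ℕ) (ω : Ω) : ℕ :=
  N + ∑ q' ∈ Finset.range q, E.wrong i q' T ω + E.matureConst * (E.badLevels i ε T ω + 1)

/-- In late slots the arms better than the target have been removed, so playing one of them can only
happen in the overhead. -/
lemma wrongBetter_le {ε : ℝ} (hε : E.Gap ε) {q : ℕ} (hq : q < M) (T : ℕ) (ω : Ω) :
    E.wrongBetter i q T ω ≤ E.overhead i ε q T ω := by
  have h1 := idx_rank_le E.δ h g E.tie i (E.path ω) E.σ hq
    (E.matureConst * (E.badLevels i ε T ω + 1)) T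
    (fun t => E.pos (action (E.policy i) (E.path ω) t) < q)
  set n₀ : Fin N := E.σ ⟨q, hq.trans E.lt⟩ with hn₀
  have hpos : (E.σ.symm n₀ : ℕ) = q := by simp [hn₀]
  have h2 : idx (fun t => LateSlot E.δ h g E.tie i (E.path ω) E.σ q
      (E.matureConst * (E.badLevels i ε T ω + 1)) t ∧
      E.pos (action (E.policy i) (E.path ω) t) < q) T = 0 := by
    unfold idx
    rw [Finset.card_eq_zero, Finset.filter_eq_empty_iff]
    rintro t ht ⟨hl, hlt⟩
    rw [Finset.mem_Icc] at ht
    have h3 : q < E.pos (action (E.policy i) (E.path ω) t) :=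
      (le_upper_of_action_ne E.δ_pos E.δ_lt E.tie_mem E.matureConst_spec
        E.one_le_matureConst (by omega) (E.concentratedFrom_badLevels i ε T ω) hpos
        (fun n hn => hε n₀ n (by rw [pos, hpos]; exact hq) (by rw [pos, hpos]; exact hn)) ht.1 ht.2
        hl rfl (fun heq => by
          change action (E.policy i) (E.path ω) t = n₀ at heq
          rw [heq, pos, hpos] at hlt; omega)).1
    omega
  rw [h2, add_zero] at h1
  exact h1

/-- Late plays after `T₁` are charged to distinct observation counts at which the upper bound is
still high. Counts above `K` are collected in `upperCount`. Counts up to `K` can occur only if the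
arm had at most `K` observations at time `T₁`, and that event will be made improbable. -/
lemma playsAt_le {ε : ℝ} (hε : E.Gap ε) {n₀ n : Fin N} (hq : E.pos n₀ < M)
    (hn : E.pos n₀ < E.pos n) (T T₁ K : ℕ) (ω : Ω) :
    E.playsAt i (E.pos n₀) n T ω ≤ E.overhead i ε (E.pos n₀) T ω + E.playsAt i (E.pos n₀) n T₁ ω +
      E.upperCount i n (E.μ n₀ - ε) T ((Finset.Ico 1 T).filter (fun k => K < k)) ω +
      if plays (E.policy i) (E.path ω) n T₁ ≤ K then K else 0 := by
  classical
  set q := E.pos n₀ with hqdef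
  set m := E.matureConst * (E.badLevels i ε T ω + 1) with hm
  have h1 := idx_rank_le E.δ h g E.tie i (E.path ω) E.σ hq m T
    (fun t => action (E.policy i) (E.path ω) t = n)
  have h2 := card_lateSlot_le E.δ_pos E.δ_lt E.tie_mem E.stat.mono E.matureConst_spec
      E.one_le_matureConst (by omega) (E.concentratedFrom_badLevels i ε T ω) (q := q) (n₀ := n₀) rfl
      (fun n hn => hε n₀ n hq hn) (n := n) (by rintro rfl; omega) T₁
  rw [← hm] at h2
  have h3 : idx (fun t => LateSlot E.δ h g E.tie i (E.path ω) E.σ q m t ∧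
      action (E.policy i) (E.path ω) t = n) T ≤ E.playsAt i q n T₁ ω +
      ((Finset.Ioc T₁ T).filter (fun t => LateSlot E.δ h g E.tie i (E.path ω) E.σ q m t ∧
        action (E.policy i) (E.path ω) t = n)).card := by
    unfold playsAt idx
    refine le_trans (Finset.card_le_card fun t ht => ?_) (Finset.card_union_le _ _)
    rw [Finset.mem_filter, Finset.mem_Icc] at ht
    rw [Finset.mem_union, Finset.mem_filter, Finset.mem_filter, Finset.mem_Icc, Finset.mem_Ioc]
    rcases Nat.lt_or_ge T₁ t with h4 | h4
    · exact Or.inr ⟨⟨h4, ht.1.2⟩, ht.2⟩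
    · exact Or.inl ⟨⟨ht.1.1, h4⟩, ht.2.1.1.1, ht.2.2⟩
  have h4 : ((Finset.Ico (max 1 (plays (E.policy i) (E.path ω) n T₁)) T).filter
      (fun k => ((E.μ n₀ - ε : ℝ) : EReal) ≤
        g T k (firstObs k (sample (E.policy i) (E.path ω) n T)))).card ≤
      E.upperCount i n (E.μ n₀ - ε) T ((Finset.Ico 1 T).filter (fun k => K < k)) ω +
      if plays (E.policy i) (E.path ω) n T₁ ≤ K then K else 0 := by
    unfold upperCount
    split_ifs with hK
    · refine (le_trans (Finset.card_le_card (t := (((Finset.Ico 1 T).filter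
        (fun k => K < k)).filter (fun k => ((E.μ n₀ - ε : ℝ) : EReal) ≤
          g T k (firstObs k (sample (E.policy i) (E.path ω) n T)))) ∪ Finset.Icc 1 K)
          fun k hk => ?_) (Finset.card_union_le _ _)).trans_eq (by rw [Nat.card_Icc]; rfl)
      rw [Finset.mem_filter, Finset.mem_Ico] at hk
      rw [Finset.mem_union, Finset.mem_filter, Finset.mem_filter, Finset.mem_Ico,
        Finset.mem_Icc]
      rcases Nat.lt_or_ge K k with h5 | h5
      · exact Or.inl ⟨⟨⟨by omega, hk.1.2⟩, h5⟩, hk.2⟩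
      · exact Or.inr ⟨by omega, h5⟩
    · rw [add_zero]
      refine Finset.card_le_card fun k hk => ?_
      rw [Finset.mem_filter, Finset.mem_Ico] at hk
      rw [Finset.mem_filter, Finset.mem_filter, Finset.mem_Ico]
      exact ⟨⟨⟨by omega, hk.1.2⟩, by omega⟩, hk.2⟩
  have h5 : E.playsAt i q n T ω ≤ E.overhead i ε q T ω + idx (fun t =>
      LateSlot E.δ h g E.tie i (E.path ω) E.σ q m t ∧
      action (E.policy i) (E.path ω) t = n) T := h1
  have h6 : ((Finset.Ioc T₁ T).filter (fun t => LateSlot E.δ h g E.tie i (E.path ω) E.σ q m t ∧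
        action (E.policy i) (E.path ω) t = n)).card ≤ _ := h2.trans h4
  calc _ ≤ _ := h5.trans (Nat.add_le_add_left (h3.trans (Nat.add_le_add_left h6 _)) _)
    _ = _ := by ring

lemma wrong_le (q T : ℕ) (ω : Ω) : E.wrong i q T ω ≤ E.wrongBetter i q T ω +
    ∑ n ∈ Finset.univ.filter (fun n => q < E.pos n), E.playsAt i q n T ω := by
  classical
  unfold wrong wrongBetter playsAt idx
  refine le_trans (Finset.card_le_card (t := _ ∪ (Finset.univ.filter
    (fun n => q < E.pos n)).biUnion fun n => (Finset.Icc 1 T).filter (fun t => rank i t = q ∧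
      action (E.policy i) (E.path ω) t = n)) fun t ht => ?_) ((Finset.card_union_le _ _).trans
      (Nat.add_le_add le_rfl Finset.card_biUnion_le))
  obtain ⟨htT, hr, hne⟩ := Finset.mem_filter.1 ht
  rw [Finset.mem_union]
  rcases lt_or_gt_of_ne hne with hlt | hlt
  · exact Or.inl (Finset.mem_filter.2 ⟨htT, hr, hlt⟩)
  · exact Or.inr (Finset.mem_biUnion.2 ⟨_, Finset.mem_filter.2 ⟨Finset.mem_univ _, hlt⟩,
      Finset.mem_filter.2 ⟨htT, hr, rfl⟩⟩)

variable [IsProbabilityMeasure P]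

lemma integrable_overhead (ε : ℝ) (q T : ℕ) :
    Integrable (fun ω => (E.overhead i ε q T ω : ℝ)) P := by
  unfold overhead
  push_cast
  exact ((integrable_const _).add (integrable_finsetSum _ fun q' _ =>
    E.integrable_wrong i q' T)).add
    (((E.integrable_badLevels i ε T).add (integrable_const _)).const_mul _)

lemma integral_overhead (ε : ℝ) (q T : ℕ) :
    ∫ ω, (E.overhead i ε q T ω : ℝ) ∂P = N + ∑ q' ∈ Finset.range q, ∫ ω, (E.wrong i q' T ω : ℝ) ∂P +
      E.matureConst * (∫ ω, (E.badLevels i ε T ω : ℝ) ∂P + 1) := by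
  unfold overhead
  push_cast
  rw [integral_add, integral_add, integral_const_mul, integral_add, integral_finsetSum]
  · simp
  · exact fun q' _ => E.integrable_wrong i q' T
  · exact E.integrable_badLevels i ε T
  · exact integrable_const _
  · exact integrable_const _
  · exact integrable_finsetSum _ fun q' _ => E.integrable_wrong i q' T
  · exact (integrable_const _).add (integrable_finsetSum _ fun q' _ => E.integrable_wrong i q' T)
  · exact ((E.integrable_badLevels i ε T).add (integrable_const _)).const_mul _

omit [IsProbabilityMeasure P] in
lemma measurableSet_plays_le (n : Fin N) (T : ℕ) (K : ℕ) :
    MeasurableSet {ω | plays (E.policy i) (E.path ω) n T ≤ K} :=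
  (measurable_plays (fun s _ _ => E.measurable_action_policy i s) n).comp
    (measurable_path E.measurable_S) (MeasurableSet.of_discrete (s := {k | k ≤ K}))

lemma integral_playsAt_le {ε : ℝ} (hε : E.Gap ε) {n₀ n : Fin N} (hq : E.pos n₀ < M)
    (hn : E.pos n₀ < E.pos n) (T T₁ K : ℕ) :
    ∫ ω, (E.playsAt i (E.pos n₀) n T ω : ℝ) ∂P ≤ ∫ ω, (E.overhead i ε (E.pos n₀) T ω : ℝ) ∂P +
      ∫ ω, (E.playsAt i (E.pos n₀) n T₁ ω : ℝ) ∂P +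
      ∑ k ∈ (Finset.Ico 1 T).filter (fun k => K < k),
        upperProb law g (E.Θ n) (E.μ n₀ - ε) T k +
      K * P.real {ω | plays (E.policy i) (E.path ω) n T₁ ≤ K} := by
  have hmeas := E.measurableSet_plays_le i n T₁ K
  have hle : ∀ ω, (E.playsAt i (E.pos n₀) n T ω : ℝ) ≤ ((E.overhead i ε (E.pos n₀) T ω : ℝ) +
      E.playsAt i (E.pos n₀) n T₁ ω +
      E.upperCount i n (E.μ n₀ - ε) T ((Finset.Ico 1 T).filter (fun k => K < k)) ω) +
      {ω | plays (E.policy i) (E.path ω) n T₁ ≤ K}.indicator (fun _ => (K : ℝ)) ω := by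
    intro ω
    have h1 := E.playsAt_le i hε hq hn T T₁ K ω
    simp only [Set.indicator_apply, Set.mem_ofPred_eq]
    exact_mod_cast h1
  have i1 := E.integrable_overhead i ε (E.pos n₀) T
  have i2 := E.integrable_playsAt i (E.pos n₀) n T₁
  have i3 := E.integrable_upperCount i n (E.μ n₀ - ε) T ((Finset.Ico 1 T).filter (fun k => K < k))
  have i4 : Integrable ({ω | plays (E.policy i) (E.path ω) n T₁ ≤ K}.indicator
    (fun _ => (K : ℝ))) P := (integrable_const _).indicator hmeas
  refine (integral_mono (E.integrable_playsAt i _ n T) (((i1.add i2).add i3).add i4) hle).trans_eq ?_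
  have e1 := integral_add ((i1.add i2).add i3) i4
  have e2 := integral_add (i1.add i2) i3
  have e3 := integral_add i1 i2
  simp only [Pi.add_apply] at e1 e2 e3 ⊢
  rw [e1, e2, e3, E.integral_upperCount, integral_indicator hmeas]
  simp [mul_comm]

lemma integral_wrongBetter_le {ε : ℝ} (hε : E.Gap ε) {q : ℕ} (hq : q < M) (T : ℕ) :
    ∫ ω, (E.wrongBetter i q T ω : ℝ) ∂P ≤ ∫ ω, (E.overhead i ε q T ω : ℝ) ∂P :=
  integral_mono (E.integrable_wrongBetter i q T) (E.integrable_overhead i ε q T)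
    fun ω => Nat.cast_le.2 (E.wrongBetter_le i hε hq T ω)

lemma integral_wrong_le (q T : ℕ) :
    ∫ ω, (E.wrong i q T ω : ℝ) ∂P ≤ ∫ ω, (E.wrongBetter i q T ω : ℝ) ∂P +
      ∑ n ∈ Finset.univ.filter (fun n => q < E.pos n), ∫ ω, (E.playsAt i q n T ω : ℝ) ∂P := by
  rw [← integral_finsetSum _ fun n _ => E.integrable_playsAt i q n T, ← integral_add
    (E.integrable_wrongBetter i q T) (integrable_finsetSum _ fun n _ => E.integrable_playsAt i q n T)]
  refine integral_mono (E.integrable_wrong i q T) ((E.integrable_wrongBetter i q T).add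
    (integrable_finsetSum _ fun n _ => E.integrable_playsAt i q n T)) fun ω => ?_
  have := E.wrong_le i q T ω
  simp only
  exact_mod_cast this

lemma isLittleO_const_log (c : ℝ) : (fun _ : ℕ => c) =o[atTop] fun T : ℕ => Real.log T :=
  isLittleO_const_left.2 (Or.inr (tendsto_norm_atTop_atTop.comp tendsto_log_nat))

lemma isBigO_of_nonneg_of_le {f f' l : ℕ → ℝ} (hf : ∀ T, 0 ≤ f T)
    (hff : ∀ᶠ T in atTop, f T ≤ f' T) (hf' : f' =O[atTop] l) : f =O[atTop] l := by
  refine (IsBigO.of_bound 1 ?_).trans hf'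
  filter_upwards [hff] with T hT
  rw [Real.norm_eq_abs, abs_of_nonneg (hf T), one_mul]
  exact hT.trans (le_abs_self _)

lemma isLittleO_of_nonneg_of_le {f f' l : ℕ → ℝ} (hf : ∀ T, 0 ≤ f T)
    (hff : ∀ᶠ T in atTop, f T ≤ f' T) (hf' : f' =o[atTop] l) : f =o[atTop] l := by
  refine (IsBigO.of_bound 1 ?_).trans_isLittleO hf'
  filter_upwards [hff] with T hT
  rw [Real.norm_eq_abs, abs_of_nonneg (hf T), one_mul]
  exact hT.trans (le_abs_self _)

lemma isBigO_overhead {ε : ℝ} (hε : 0 < ε) {q : ℕ} (hW : ∀ q' < q,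
    (fun T => ∫ ω, (E.wrong i q' T ω : ℝ) ∂P) =O[atTop] fun T : ℕ => Real.log T) :
    (fun T => ∫ ω, (E.overhead i ε q T ω : ℝ) ∂P) =O[atTop] fun T : ℕ => Real.log T := by
  simp only [integral_overhead]
  refine ((isLittleO_const_log _).isBigO.add ?_).add
    (((E.isLittleO_badLevels i hε).add (isLittleO_const_log 1)).const_mul_left _).isBigO
  simpa only [Finset.sum_fn] using IsBigO.sum fun q' hq' => hW q' (Finset.mem_range.1 hq')

lemma isLittleO_overhead {ε : ℝ} (hε : 0 < ε) {q : ℕ} (hW : ∀ q' < q,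
    (fun T => ∫ ω, (E.wrong i q' T ω : ℝ) ∂P) =o[atTop] fun T : ℕ => Real.log T) :
    (fun T => ∫ ω, (E.overhead i ε q T ω : ℝ) ∂P) =o[atTop] fun T : ℕ => Real.log T := by
  simp only [integral_overhead]
  refine ((isLittleO_const_log _).add ?_).add
    (((E.isLittleO_badLevels i hε).add (isLittleO_const_log 1)).const_mul_left _)
  simpa only [Finset.sum_fn] using IsLittleO.sum fun q' hq' => hW q' (Finset.mem_range.1 hq')

omit [IsProbabilityMeasure P] in
lemma eventually_sum_upperProb_le {n₀ n : Fin N} (hq : E.pos n₀ < M) (hn : E.pos n₀ < E.pos n)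
    {η : ℝ} (hη : 0 < η) : ∀ᶠ ε in 𝓝[>] (0 : ℝ), ∀ᶠ T : ℕ in atTop,
      ∑ k ∈ Finset.Ico 1 T, upperProb law g (E.Θ n) (E.μ n₀ - ε) T k ≤
        (1 / kl law (E.Θ n) (E.Θ n₀) + η) * Real.log T := by
  obtain ⟨ε₀, hε₀, hsum⟩ := exists_sum_upperProb_le E.stat (E.mean_lt n₀ n hq hn) hη
  filter_upwards [Ioo_mem_nhdsGT hε₀] with ε hε
  exact hsum ε hε.1 hε.2

/-- With `T₁ = K = 0` nothing is assumed about earlier exploration, which gives the classical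
logarithmic upper bound. -/
lemma integral_playsAt_le_sum {ε : ℝ} (hε : E.Gap ε) {n₀ n : Fin N} (hq : E.pos n₀ < M)
    (hn : E.pos n₀ < E.pos n) (T : ℕ) :
    ∫ ω, (E.playsAt i (E.pos n₀) n T ω : ℝ) ∂P ≤ ∫ ω, (E.overhead i ε (E.pos n₀) T ω : ℝ) ∂P +
      ∑ k ∈ Finset.Ico 1 T, upperProb law g (E.Θ n) (E.μ n₀ - ε) T k := by
  refine (E.integral_playsAt_le i hε hq hn T 0 0).trans_eq ?_
  have h1 : ∀ ω, E.playsAt i (E.pos n₀) n 0 ω = 0 := fun ω => by simp [playsAt, idx]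
  simp only [h1, Nat.cast_zero, integral_zero, zero_mul, add_zero]
  congr 1
  refine Finset.sum_congr (Finset.filter_true_of_mem fun k hk => ?_) fun _ _ => rfl
  exact (Finset.mem_Ico.1 hk).1

/-- The expected number of wrong plays is `O(log T)`. -/
theorem isBigO_wrong {q : ℕ} (hq : q < M) :
    (fun T => ∫ ω, (E.wrong i q T ω : ℝ) ∂P) =O[atTop] fun T : ℕ => Real.log T := by
  induction q using Nat.strong_induction_on with
  | _ q ih =>
  set n₀ : Fin N := E.σ ⟨q, hq.trans E.lt⟩ with hn₀
  have hpos : E.pos n₀ = q := by simp [hn₀, pos]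
  have hev : ∀ᶠ ε in 𝓝[>] (0 : ℝ), ∀ n, E.pos n₀ < E.pos n → ∀ᶠ T : ℕ in atTop,
      ∑ k ∈ Finset.Ico 1 T, upperProb law g (E.Θ n) (E.μ n₀ - ε) T k ≤
        (1 / kl law (E.Θ n) (E.Θ n₀) + 1) * Real.log T := by
    simp only [eventually_all]
    exact fun n hn => E.eventually_sum_upperProb_le (hpos ▸ hq) hn one_pos
  obtain ⟨ε, ⟨hgap, hsum⟩, hε⟩ := ((E.eventually_gap.and hev).and self_mem_nhdsWithin).exists
  -- The overhead contains the wrong plays at all smaller ranks; this is where the induction on the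
  -- rank enters.
  have hover := E.isBigO_overhead i hε fun q' hq' => ih q' hq' (hq'.trans hq)
  refine isBigO_of_nonneg_of_le (fun T => integral_nonneg fun _ => Nat.cast_nonneg _)
    (Eventually.of_forall fun T => E.integral_wrong_le i q T) (IsBigO.add ?_ ?_)
  · exact isBigO_of_nonneg_of_le (fun T => integral_nonneg fun _ => Nat.cast_nonneg _)
      (Eventually.of_forall fun T => E.integral_wrongBetter_le i hgap hq T) hover
  · have h1 : ∀ n ∈ Finset.univ.filter (fun n => q < E.pos n),
        (fun T => ∫ ω, (E.playsAt i q n T ω : ℝ) ∂P) =O[atTop] fun T : ℕ => Real.log T := by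
      intro n hn
      have hn' : E.pos n₀ < E.pos n := by rw [hpos]; exact (Finset.mem_filter.1 hn).2
      have h2 : (fun T => ∑ k ∈ Finset.Ico 1 T, upperProb law g (E.Θ n) (E.μ n₀ - ε) T k)
          =O[atTop] fun T : ℕ => Real.log T :=
        isBigO_of_nonneg_of_le (fun T => Finset.sum_nonneg fun k _ => upperProb_nonneg _ _ _ _)
          (hsum n hn') (isBigO_const_mul_self _ _ _)
      refine isBigO_of_nonneg_of_le (fun T => integral_nonneg fun _ => Nat.cast_nonneg _)
        (Eventually.of_forall fun T => ?_) (hover.add h2)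
      have h3 := E.integral_playsAt_le_sum i hgap (hpos ▸ hq) hn' T
      rwa [hpos] at h3
    simpa only [Finset.sum_fn] using IsBigO.sum h1

end System

/-- The change of measure needs an alternative whose mean lies strictly above the target mean.
Denseness supplies one slightly better than `θ₀`, and continuity keeps its distance from `θ` so
close that a constant larger than `κ` remains admissible. -/
lemma RegularModel.exists_lt_one_div_kl {H : Type*} {law : H → Measure ℝ}
    [∀ θ, IsProbabilityMeasure (law θ)] (hlaw : RegularModel law) {θ θ₀ : H}
    (hmean : mean law θ < mean law θ₀) {κ : ℝ} (hκ : κ < 1 / kl law θ θ₀) :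
    ∃ κ' θ', κ < κ' ∧ mean law θ₀ < mean law θ' ∧ κ' < 1 / kl law θ θ' := by
  have hI := hlaw.kl_toReal_pos hmean
  obtain ⟨κ₁, hκ₁, hκ₁I⟩ := exists_between (max_lt hκ (one_div_pos.2 hI))
  have hκ₁0 : 0 < κ₁ := (le_max_right _ _).trans_lt hκ₁
  have hI' : kl law θ θ₀ < 1 / κ₁ := by
    rw [lt_div_iff₀ hI] at hκ₁I; rw [lt_div_iff₀ hκ₁0]; linarith
  obtain ⟨d, hd, hcont⟩ := hlaw.kl_continuous (1 / κ₁ - kl law θ θ₀) (by linarith) _ _ hmean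
  obtain ⟨θ', hθ', hθ'd⟩ := hlaw.dense θ₀ d hd
  have hkl := abs_lt.1 (hcont θ' hθ'.le hθ'd.le)
  refine ⟨κ₁, θ', (le_max_left _ _).trans_lt hκ₁, hθ', ?_⟩
  have hlt : kl law θ θ' < 1 / κ₁ := by linarith
  rw [lt_div_iff₀ hκ₁0] at hlt
  rw [lt_div_iff₀ (hlaw.kl_toReal_pos (hmean.trans hθ'))]
  linarith

/-! ### Forced exploration and the sharp rates -/

namespace System

variable {H : Type*} {law : H → Measure ℝ} [∀ θ, IsProbabilityMeasure (law θ)]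
  {h : (k : ℕ) → (Fin k → ℝ) → ℝ} {g : ℕ → (k : ℕ) → (Fin k → ℝ) → EReal} {M N : ℕ} [NeZero N]
  {Ω : Type*} [MeasurableSpace Ω] {P : Measure Ω} (E : System law h g M N P) (i : Fin M)

lemma measurableSet_plays_le_real (n : Fin N) (T : ℕ) (c : ℝ) :
    MeasurableSet {ω | (plays (E.policy i) (E.path ω) n T : ℝ) ≤ c} :=
  (measurable_plays (fun s _ _ => E.measurable_action_policy i s) n).comp
    (measurable_path E.measurable_S) (MeasurableSet.of_discrete (s := {k : ℕ | (k : ℝ) ≤ c}))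

/-- An arm whose upper bounds stay high throughout the second half of the horizon is played at
nearly every round-robin turn there. Few plays then force an overhead of order `T`. Using only slots
after `T / 2` allows all these bounds to be controlled through time `T / 2` and monotonicity. -/
lemma le_overhead_of_plays_le {ε : ℝ} (hε : E.Gap ε) {n₀ n : Fin N} (hq : E.pos n₀ < M)
    (hn : E.pos n₀ < E.pos n) {T K : ℕ} {ω : Ω}
    (hplays : plays (E.policy i) (E.path ω) n T ≤ K)
    (hforce : ∀ t, T / 2 < t → t ≤ T → ∀ k, 1 ≤ k → k ≤ K → ((E.μ n₀ + ε : ℝ) : EReal) ≤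
      g t k (firstObs k (sample (E.policy i) (E.path ω) n T))) :
    (T : ℝ) ≤ 2 * M * (N + E.overhead i ε (E.pos n₀) T ω + N * (K + 1) + 1) := by
  have hM : (0 : ℝ) < M := by exact_mod_cast Fin.pos i
  have h1 := lt_plays_or_div_le E.δ_pos E.δ_lt E.tie_mem E.matureConst_spec
    E.one_le_matureConst (by omega) (E.concentratedFrom_badLevels i ε T ω) (n₀ := n₀)
    (q := E.pos n₀) rfl (fun n hn => hε n₀ n hq hn) hq hn (K := K) (T₁ := T / 2) hforce
  have h2 : ((T - T / 2) / M - (N + E.overhead i ε (E.pos n₀) T ω)) / N ≤ K := by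
    refine (h1.resolve_left (not_lt.2 hplays)).trans' (le_of_eq ?_)
    congr 2
    unfold overhead wrong
    ring
  have h3 := Nat.lt_mul_div_succ ((T - T / 2) / M - (N + E.overhead i ε (E.pos n₀) T ω))
    (NeZero.pos N)
  have h4 := Nat.lt_mul_div_succ (T - T / 2) (Fin.pos i)
  have h5 : (T - T / 2) / M ≤ N + E.overhead i ε (E.pos n₀) T ω + N * (K + 1) := by
    have := Nat.mul_le_mul_left N (Nat.add_le_add_right h2 1)
    omega
  have h6 : T ≤ 2 * (T - T / 2) := by omega
  have h7 : (T : ℝ) ≤ 2 * ((T - T / 2 : ℕ) : ℝ) := by exact_mod_cast h6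
  have h8 : ((T - T / 2 : ℕ) : ℝ) < M * (((T - T / 2) / M : ℕ) + 1) := by exact_mod_cast h4
  have h9 : (((T - T / 2) / M : ℕ) : ℝ) ≤ N + E.overhead i ε (E.pos n₀) T ω + N * (K + 1) := by
    exact_mod_cast h5
  have h10 := mul_le_mul_of_nonneg_left h9 hM.le
  linarith

variable [IsProbabilityMeasure P]

/-- The best arms are played more than `κ log T` times, for every `κ`. -/
lemma tendsto_prob_plays_le_of_pos_lt {n : Fin N} (hn : E.pos n < M) (κ : ℝ) :
    Tendsto (fun T : ℕ => P.real {ω | (plays (E.policy i) (E.path ω) n T : ℝ) ≤ κ * Real.log T})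
      atTop (𝓝 0) := by
  have hM : (0 : ℝ) < M := by exact_mod_cast Fin.pos i
  have h1 := tendsto_prob_ge_of_isBigO_log (V := fun T ω => (E.wrong i (E.pos n) T ω : ℝ))
    (fun _ _ => Nat.cast_nonneg _) (E.integrable_wrong i (E.pos n)) (E.isBigO_wrong i hn)
    (c := 1 / (2 * M)) (by positivity)
  refine tendsto_of_tendsto_of_tendsto_of_le_of_le' tendsto_const_nhds h1
    (Eventually.of_forall fun _ => measureReal_nonneg) ?_
  filter_upwards [eventually_mul_log_lt (2 * M * (1 + κ)), tendsto_log_nat.eventually_ge_atTop 1]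
    with T hT hlog
  refine measureReal_mono fun ω hω => ?_
  rw [Set.mem_ofPred_eq] at hω ⊢
  have h2 : T / M ≤ E.wrong i (E.pos n) T ω + plays (E.policy i) (E.path ω) n T :=
    div_le_wrong_add_plays E.δ h g E.tie i (E.path ω) E.σ hn rfl T
  have h3 : (T : ℝ) < M * ((T / M : ℕ) + 1) := by
    exact_mod_cast Nat.lt_mul_div_succ T (Fin.pos i)
  have h4 : ((T / M : ℕ) : ℝ) ≤ E.wrong i (E.pos n) T ω + plays (E.policy i) (E.path ω) n T := by
    exact_mod_cast h2
  rw [div_mul_eq_mul_div, one_mul, div_le_iff₀ (by positivity)]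
  nlinarith

/-- An arm is played more than `κ log T` times if `κ < 1 / I`, where `I` is its distance to a
target. -/
lemma tendsto_prob_plays_le {n₀ n : Fin N} (hq : E.pos n₀ < M) (hn : E.pos n₀ < E.pos n)
    {κ : ℝ} (hκ : 0 < κ) (hκI : κ < 1 / kl law (E.Θ n) (E.Θ n₀)) :
    Tendsto (fun T : ℕ => P.real {ω | (plays (E.policy i) (E.path ω) n T : ℝ) ≤ κ * Real.log T})
      atTop (𝓝 0) := by
  have hM : (0 : ℝ) < M := by exact_mod_cast Fin.pos i
  have hN : (0 : ℝ) < N := by exact_mod_cast NeZero.pos N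
  have hmean := E.mean_lt n₀ n hq hn
  -- The gap between `κ` and `κ₁` is spent on passing from `log T` to `log (T / 2)`, the gap between
  -- the means of `θ'` and the target on the tolerance `ε`.
  obtain ⟨κ₁, θ', hκ₁, hθ', hκ₁θ⟩ := E.model.exists_lt_one_div_kl hmean hκI
  have hκ₁0 : 0 < κ₁ := hκ.trans hκ₁
  obtain ⟨ε, hgap, hε0, hε⟩ := (E.eventually_gap.and
    (Ioo_mem_nhdsGT (show 0 < mean law θ' - mean law (E.Θ n₀) by linarith))).exists
  have hA := (tendsto_prob_exists_upper_lt E.model E.stat (hmean.trans hθ')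
    (r := E.μ n₀ + ε) (by linarith) hκ₁0 hκ₁θ).comp
    (Nat.tendsto_div_const_atTop (two_ne_zero))
  have hB := tendsto_prob_ge_of_isBigO_log
    (V := fun T ω => (N : ℝ) + (E.overhead i ε (E.pos n₀) T ω : ℝ)) (P := P)
    (fun _ _ => by positivity)
    (fun T => (integrable_const _).add (E.integrable_overhead i ε (E.pos n₀) T)) (by
      have : ∀ T, ∫ ω, ((N : ℝ) + (E.overhead i ε (E.pos n₀) T ω : ℝ)) ∂P =
          N + ∫ ω, (E.overhead i ε (E.pos n₀) T ω : ℝ) ∂P := fun T => by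
        rw [integral_add (integrable_const _) (E.integrable_overhead i ε (E.pos n₀) T)]; simp
      simp only [this]
      exact (isLittleO_const_log _).isBigO.add (E.isBigO_overhead i hε0 fun q' hq' =>
        E.isBigO_wrong i (hq'.trans hq)))
    (c := 1 / (4 * M)) (by positivity)
  have hAB := hA.add hB
  rw [add_zero] at hAB
  refine tendsto_of_tendsto_of_tendsto_of_le_of_le' tendsto_const_nhds hAB
    (Eventually.of_forall fun _ => measureReal_nonneg) ?_
  filter_upwards [eventually_mul_log_lt (4 * M * (2 + N * (1 + κ))),
    tendsto_log_nat.eventually_ge_atTop 1,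
    tendsto_log_nat.eventually_ge_atTop (κ₁ * Real.log 3 / (κ₁ - κ)), eventually_ge_atTop 3]
    with T hT hlog hlog' hT3
  have hhalf : κ * Real.log T ≤ κ₁ * Real.log (T / 2 : ℕ) := by
    rw [div_le_iff₀ (by linarith)] at hlog'
    have h1 : Real.log T ≤ Real.log (3 * (T / 2 : ℕ)) := by
      apply Real.log_le_log (by positivity)
      exact_mod_cast (by omega : T ≤ 3 * (T / 2))
    have h2 : (0 : ℝ) < (T / 2 : ℕ) := by exact_mod_cast (by omega : 0 < T / 2)
    rw [Real.log_mul (by norm_num) h2.ne'] at h1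
    nlinarith
  set B : Set (ℕ → ℝ) := {s | ∃ k : ℕ, 1 ≤ k ∧ (k : ℝ) ≤ κ₁ * Real.log (T / 2 : ℕ) ∧
    g (T / 2) k (firstObs k s) < ((E.μ n₀ + ε : ℝ) : EReal)} with hBdef
  have hBm : MeasurableSet B := by
    simp only [hBdef, Set.ofPred_exists, Set.ofPred_and]
    exact MeasurableSet.iUnion fun k => (MeasurableSet.const _).inter ((MeasurableSet.const _).inter
      (measurableSet_lt (E.stat.measurable_upper _ k) measurable_const))
  have hprob := E.prob_sample i n T hBm
  simp only [Function.comp_apply]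
  rw [← hBdef, ← hprob]
  refine le_trans (measureReal_mono fun ω hω => ?_) (measureReal_union_le _ _)
  rw [Set.mem_ofPred_eq] at hω
  rw [Set.mem_union, Set.mem_ofPred_eq, Set.mem_ofPred_eq]
  by_cases hs : sample (E.policy i) (E.path ω) n T ∈ B
  · exact Or.inl hs
  right
  set K := ⌊κ * Real.log T⌋₊ with hK
  have hKle : (K : ℝ) ≤ κ * Real.log T := Nat.floor_le (by positivity)
  have hplays : plays (E.policy i) (E.path ω) n T ≤ K := Nat.le_floor hω
  have h10 := E.le_overhead_of_plays_le i hgap hq hn hplays (by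
    intro t ht htT k hk1 hkK
    refine le_trans ?_ (E.stat.mono k hk1 _ (T / 2) t (by omega) ht.le)
    by_contra! hcon
    refine hs ⟨k, hk1, ?_, hcon⟩
    have : (k : ℝ) ≤ K := by exact_mod_cast hkK
    linarith)
  -- The logarithmic terms of `h10` take at most half of `T`, so the overhead would have to be at
  -- least `T / (4 * M)`. Its expectation is `O(log T)`, which makes this improbable by Markov's
  -- inequality.
  rw [Set.mem_ofPred_eq, div_mul_eq_mul_div, one_mul, div_le_iff₀ (by positivity)]
  set V : ℝ := N + (E.overhead i ε (E.pos n₀) T ω : ℝ) with hV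
  have h11 : (N : ℝ) * (K + 1) + 1 ≤ (2 + N * (1 + κ)) * Real.log T := by nlinarith
  have h12 : 2 * (M : ℝ) * (N * (K + 1) + 1) ≤ 2 * M * ((2 + N * (1 + κ)) * Real.log T) :=
    mul_le_mul_of_nonneg_left h11 (by positivity)
  nlinarith

/-- The exploration of `n` for all targets together exceeds `log T / I`, where `I` is its distance
to the target `n₀`, already at a time `T ^ ρ` with some `ρ < 1`. From then on only the negligible
tail of observation counts can cause plays of `n` for this target. Hence the expected number of
these plays grows by `o(log T)` between `T ^ ρ` and `T`, and iterating this gives the claim. -/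
lemma isLittleO_playsAt {n₀ n : Fin N} (hq : E.pos n₀ < M) (hn : E.pos n₀ < E.pos n)
    (hW : ∀ q' < E.pos n₀,
      (fun T => ∫ ω, (E.wrong i q' T ω : ℝ) ∂P) =o[atTop] fun T : ℕ => Real.log T)
    {κ : ℝ} (hκ : 1 / kl law (E.Θ n) (E.Θ n₀) < κ)
    (hrare : Tendsto (fun T : ℕ => P.real {ω | (plays (E.policy i) (E.path ω) n T : ℝ) ≤
      κ * Real.log T}) atTop (𝓝 0)) :
    (fun T => ∫ ω, (E.playsAt i (E.pos n₀) n T ω : ℝ) ∂P) =o[atTop] fun T : ℕ => Real.log T := by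
  have hmean := E.mean_lt n₀ n hq hn
  have hI := E.model.kl_toReal_pos hmean
  set ι := 1 / kl law (E.Θ n) (E.Θ n₀) with hι
  have hι0 : 0 < ι := by positivity
  have hκ0 : 0 < κ := hι0.trans hκ
  -- The choice `ι / κ < ρ < 1` ensures that `κ log (T ^ ρ)` exceeds `ι log T`, with room for
  -- rounding down `T ^ ρ`.
  obtain ⟨ρ, hρι, hρ1⟩ := exists_between ((div_lt_one hκ0).2 hκ)
  have hρ0 : 0 < ρ := (div_pos hι0 hκ0).trans hρι
  have hκρ : ι < κ * ρ := by rw [div_lt_iff₀ hκ0] at hρι; linarith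
  set τ : ℕ → ℕ := fun T => ⌊(T : ℝ) ^ ρ⌋₊ with hτdef
  have hpow : Tendsto (fun T : ℕ => (T : ℝ) ^ ρ) atTop atTop :=
    (tendsto_rpow_atTop hρ0).comp tendsto_natCast_atTop_atTop
  have hτ : Tendsto τ atTop atTop := tendsto_nat_floor_atTop.comp hpow
  have hlogpow : ∀ᶠ T : ℕ in atTop, Real.log ((T : ℝ) ^ ρ) = ρ * Real.log T := by
    filter_upwards [eventually_gt_atTop 0] with T hT
    exact Real.log_rpow (by exact_mod_cast hT) ρ
  have hplays0 : (fun T => ∫ ω, (E.playsAt i (E.pos n₀) n T ω : ℝ) ∂P) =O[atTop]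
      fun T : ℕ => Real.log T := by
    refine isBigO_of_nonneg_of_le (fun T => integral_nonneg fun _ => Nat.cast_nonneg _)
      (Eventually.of_forall fun T => integral_mono (E.integrable_playsAt i _ n T)
        (E.integrable_wrong i (E.pos n₀) T) fun ω => Nat.cast_le.2 ?_) (E.isBigO_wrong i hq)
    unfold playsAt wrong idx
    refine Finset.card_le_card fun t ht => ?_
    obtain ⟨htT, hr, ha⟩ := Finset.mem_filter.1 ht
    refine Finset.mem_filter.2 ⟨htT, hr, ?_⟩
    change E.pos (action (E.policy i) (E.path ω) t) ≠ _
    rw [ha]; omega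
  refine isLittleO_log_of_recursion (fun T => integral_nonneg fun _ => Nat.cast_nonneg _) hplays0
    hτ hρ0.le hρ1 ?_ ?_
  · filter_upwards [hlogpow, hτ.eventually_gt_atTop 0] with T h1 h2
    rw [← h1]
    exact Real.log_le_log (by exact_mod_cast h2) (Nat.floor_le (by positivity))
  intro η hη
  obtain ⟨ε₀, hε₀, htail⟩ := exists_sum_upperProb_tail_le E.model E.stat hmean
    (show 0 < η / 3 by positivity)
  obtain ⟨ε, hgap, hε0, hε⟩ := (E.eventually_gap.and (Ioo_mem_nhdsGT hε₀)).exists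
  have hover := (E.isLittleO_overhead i hε0 hW).bound (show 0 < η / 3 by positivity)
  have hrare' := (hrare.comp hτ).eventually_le_const (show 0 < η / (3 * ι) by positivity)
  filter_upwards [htail ε hε0 hε, hover, hrare', hlogpow, tendsto_log_nat.eventually_ge_atTop 0,
    tendsto_log_nat.eventually_ge_atTop (κ * Real.log 2 / (κ * ρ - ι)),
    hpow.eventually_ge_atTop 1] with T h1 h2 h3 h4 hlog hlog' hp
  have hlogτ : ι * Real.log T ≤ κ * Real.log (τ T) := by
    have h5 : (T : ℝ) ^ ρ < τ T + 1 := Nat.lt_floor_add_one _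
    have h6 : (1 : ℝ) ≤ τ T := by exact_mod_cast Nat.le_floor (by exact_mod_cast hp)
    have h7 : Real.log ((T : ℝ) ^ ρ) ≤ Real.log (2 * τ T) :=
      Real.log_le_log (by linarith) (by linarith)
    rw [h4, Real.log_mul (by norm_num) (by linarith)] at h7
    rw [div_le_iff₀ (by linarith)] at hlog'
    nlinarith
  set K := ⌊ι * Real.log T⌋₊ with hK
  have hKle : (K : ℝ) ≤ ι * Real.log T := Nat.floor_le (by positivity)
  -- With the cut at `τ T` and the level `K` near `ι log T`, the three errors (overhead, tail of the
  -- upper bounds, insufficient earlier exploration) are each at most `η / 3 * log T`.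
  have h8 := E.integral_playsAt_le i hgap hq hn T (τ T) K
  have h9 : (Finset.Ico 1 T).filter (fun k => K < k) =
      (Finset.Ico 1 T).filter (fun k : ℕ => ι * Real.log T < k) :=
    Finset.filter_congr fun k _ => Nat.floor_lt (by positivity)
  rw [h9] at h8
  have h10 : P.real {ω | plays (E.policy i) (E.path ω) n (τ T) ≤ K} ≤ η / (3 * ι) := by
    refine le_trans (measureReal_mono fun ω hω => ?_) h3
    rw [Set.mem_ofPred_eq] at hω ⊢
    have : (plays (E.policy i) (E.path ω) n (τ T) : ℝ) ≤ K := by exact_mod_cast hω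
    linarith
  have h11 : K * P.real {ω | plays (E.policy i) (E.path ω) n (τ T) ≤ K} ≤ η / 3 * Real.log T := by
    calc _ ≤ ι * Real.log T * (η / (3 * ι)) :=
          mul_le_mul hKle h10 measureReal_nonneg (by positivity)
      _ = _ := by field_simp
  rw [Real.norm_eq_abs, Real.norm_eq_abs, abs_of_nonneg hlog] at h2
  have h12 := le_abs_self (∫ ω, (E.overhead i ε (E.pos n₀) T ω : ℝ) ∂P)
  linarith

lemma isLittleO_wrongBetter_of_wrong {q : ℕ} (hq : q < M) (hW : ∀ q' < q,
    (fun T => ∫ ω, (E.wrong i q' T ω : ℝ) ∂P) =o[atTop] fun T : ℕ => Real.log T) :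
    (fun T => ∫ ω, (E.wrongBetter i q T ω : ℝ) ∂P) =o[atTop] fun T : ℕ => Real.log T := by
  obtain ⟨ε, hgap, hε0⟩ := (E.eventually_gap.and self_mem_nhdsWithin).exists
  exact isLittleO_of_nonneg_of_le (fun T => integral_nonneg fun _ => Nat.cast_nonneg _)
    (Eventually.of_forall fun T => E.integral_wrongBetter_le i hgap hq T)
    (E.isLittleO_overhead i hε0 hW)

/-- The expected number of wrong plays in slots with target of rank less than `M - 1` is
`o(log T)`. -/
theorem isLittleO_wrong {q : ℕ} (hq : q + 1 < M) :
    (fun T => ∫ ω, (E.wrong i q T ω : ℝ) ∂P) =o[atTop] fun T : ℕ => Real.log T := by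
  induction q using Nat.strong_induction_on with
  | _ q ih =>
  have hW := fun q' (hq' : q' < q) => ih q' hq' (by omega)
  have hMN := E.lt
  set n₀ : Fin N := E.σ ⟨q, by omega⟩ with hn₀
  set m₀ : Fin N := E.σ ⟨M - 1, by omega⟩ with hm₀
  have hpos : E.pos n₀ = q := by simp [hn₀, pos]
  have hposm : E.pos m₀ = M - 1 := by simp [hm₀, pos]
  refine isLittleO_of_nonneg_of_le (fun T => integral_nonneg fun _ => Nat.cast_nonneg _)
    (Eventually.of_forall fun T => E.integral_wrong_le i q T)
    ((E.isLittleO_wrongBetter_of_wrong i (by omega) hW).add ?_)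
  have h1 : ∀ n ∈ Finset.univ.filter (fun n => q < E.pos n),
      (fun T => ∫ ω, (E.playsAt i q n T ω : ℝ) ∂P) =o[atTop] fun T : ℕ => Real.log T := by
    intro n hn
    have hn' : E.pos n₀ < E.pos n := by rw [hpos]; exact (Finset.mem_filter.1 hn).2
    -- An arm among the `M` best is itself a target and is played more than any multiple of `log T`.
    -- For any other arm, the smaller distance to the `M`-th best arm leaves room for `κ` between
    -- the two reciprocal distances.
    have h2 : ∃ κ, 1 / kl law (E.Θ n) (E.Θ n₀) < κ ∧
        Tendsto (fun T : ℕ => P.real {ω | (plays (E.policy i) (E.path ω) n T : ℝ) ≤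
          κ * Real.log T}) atTop (𝓝 0) := by
      by_cases hnM : E.pos n < M
      · exact ⟨_, lt_add_one _, E.tendsto_prob_plays_le_of_pos_lt i hnM _⟩
      have hm : E.pos m₀ < E.pos n := by omega
      have h3 := E.kl_lt n n₀ m₀ (by change E.pos m₀ + 1 = M; omega)
        (by change E.pos n₀ < E.pos m₀; omega) hm
      have h4 := E.model.kl_toReal_pos (E.mean_lt m₀ n (by change E.pos m₀ < M; omega) hm)
      have h5 := E.model.kl_toReal_pos (E.mean_lt n₀ n (by change E.pos n₀ < M; omega) hn')
      obtain ⟨κ, hκ1, hκ2⟩ := exists_between (one_div_lt_one_div_of_lt h4 h3)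
      exact ⟨κ, hκ1, E.tendsto_prob_plays_le i (by omega) hm
        ((one_div_pos.2 h5).trans hκ1) hκ2⟩
    obtain ⟨κ, hκ, hrare⟩ := h2
    have h6 := E.isLittleO_playsAt i (by omega) hn' (by rwa [hpos]) hκ hrare
    rwa [hpos] at h6
  simpa only [Finset.sum_fn] using IsLittleO.sum h1

lemma isLittleO_wrongBetter {q : ℕ} (hq : q < M) :
    (fun T => ∫ ω, (E.wrongBetter i q T ω : ℝ) ∂P) =o[atTop] fun T : ℕ => Real.log T :=
  E.isLittleO_wrongBetter_of_wrong i hq fun q' hq' => E.isLittleO_wrong i (by omega)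

omit [IsProbabilityMeasure P] in
lemma plays_le_sum_playsAt {n : Fin N} (hn : M ≤ E.pos n) (T : ℕ) (ω : Ω) :
    plays (E.policy i) (E.path ω) n T ≤ ∑ q ∈ Finset.range (M - 1), E.wrong i q T ω +
      E.playsAt i (M - 1) n T ω := by
  classical
  rw [plays_eq_idx]
  unfold wrong playsAt idx
  refine le_trans (Finset.card_le_card (t := ((Finset.range (M - 1)).biUnion fun q =>
    (Finset.Icc 1 T).filter (Wrong E.δ h g E.tie i (E.path ω) E.σ q)) ∪ (Finset.Icc 1 T).filter
      (fun t => rank i t = M - 1 ∧ action (E.policy i) (E.path ω) t = n)) fun t ht => ?_)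
      ((Finset.card_union_le _ _).trans (Nat.add_le_add_right Finset.card_biUnion_le _))
  obtain ⟨htT, ha⟩ := Finset.mem_filter.1 ht
  have hr := rank_lt i t
  rw [Finset.mem_union]
  by_cases hrM : rank i t = M - 1
  · exact Or.inr (Finset.mem_filter.2 ⟨htT, hrM, ha⟩)
  · refine Or.inl (Finset.mem_biUnion.2 ⟨rank i t, Finset.mem_range.2 (by omega),
      Finset.mem_filter.2 ⟨htT, rfl, ?_⟩⟩)
    change E.pos (action (E.policy i) (E.path ω) t) ≠ _
    rw [ha]; omega

/-- The expected number of plays of an arm of rank at least `M` in slots with target of rank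
`M - 1`. -/
theorem tendsto_playsAt_div_log {n₀ n : Fin N} (hn₀ : E.pos n₀ + 1 = M) (hn : M ≤ E.pos n) :
    Tendsto (fun T : ℕ => (∫ ω, (E.playsAt i (M - 1) n T ω : ℝ) ∂P) / Real.log T) atTop
      (𝓝 (1 / kl law (E.Θ n) (E.Θ n₀))) := by
  have hq : E.pos n₀ < M := by omega
  have hlt : E.pos n₀ < E.pos n := by omega
  have hposq : E.pos n₀ = M - 1 := by omega
  have hI := E.model.kl_toReal_pos (E.mean_lt n₀ n hq hlt)
  set ι := 1 / kl law (E.Θ n) (E.Θ n₀) with hι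
  have hι0 : 0 < ι := by positivity
  have hW : ∀ q' < E.pos n₀, (fun T => ∫ ω, (E.wrong i q' T ω : ℝ) ∂P) =o[atTop]
      fun T : ℕ => Real.log T := fun q' hq' => E.isLittleO_wrong i (by omega)
  refine tendsto_order.2 ⟨fun a ha => ?_, fun b hb => ?_⟩
  -- Lower bound: the arm is played more than `κ log T` times with probability tending to one, and
  -- all but an expected `o(log T)` of its plays occur at the last target.
  · obtain ⟨κ, hκ, hκι⟩ := exists_between (max_lt ha hι0)
    have hκ0 : 0 < κ := (le_max_right _ _).trans_lt hκ
    have haκ : a < κ := (le_max_left _ _).trans_lt hκ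
    have hrare := E.tendsto_prob_plays_le i hq hlt hκ0 hκι
    have hWs : (fun T => ∑ q ∈ Finset.range (M - 1), ∫ ω, (E.wrong i q T ω : ℝ) ∂P) =o[atTop]
        fun T : ℕ => Real.log T := by
      simpa only [Finset.sum_fn] using IsLittleO.sum fun q (hq : q ∈ Finset.range (M - 1)) =>
        E.isLittleO_wrong i (q := q) (by rw [Finset.mem_range] at hq; omega)
    have h1 : Tendsto (fun T : ℕ => κ * (1 - P.real {ω |
        (plays (E.policy i) (E.path ω) n T : ℝ) ≤ κ * Real.log T}) -
        (∑ q ∈ Finset.range (M - 1), ∫ ω, (E.wrong i q T ω : ℝ) ∂P) / Real.log T) atTop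
        (𝓝 (κ * (1 - 0) - 0)) :=
      ((hrare.const_sub 1).const_mul κ).sub hWs.tendsto_div_nhds_zero
    rw [sub_zero, sub_zero, mul_one] at h1
    filter_upwards [h1.eventually_const_lt haκ, tendsto_log_nat.eventually_gt_atTop 0] with T hT hlog
    refine hT.trans_le ?_
    have hm := E.measurableSet_plays_le_real i n T (κ * Real.log T)
    have h2 : ∫ ω, ({ω | (plays (E.policy i) (E.path ω) n T : ℝ) ≤ κ * Real.log T}ᶜ).indicator
        (fun _ => κ * Real.log T) ω ∂P ≤
        ∫ ω, (∑ q ∈ Finset.range (M - 1), (E.wrong i q T ω : ℝ)) + E.playsAt i (M - 1) n T ω ∂P := by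
      refine integral_mono ((integrable_const _).indicator hm.compl)
        ((integrable_finsetSum _ fun q _ => E.integrable_wrong i q T).add
          (E.integrable_playsAt i (M - 1) n T)) fun ω => ?_
      have h3 : (plays (E.policy i) (E.path ω) n T : ℝ) ≤
          (∑ q ∈ Finset.range (M - 1), (E.wrong i q T ω : ℝ)) + E.playsAt i (M - 1) n T ω := by
        exact_mod_cast E.plays_le_sum_playsAt i hn T ω
      refine le_trans (Set.indicator_apply_le' (fun hω => ?_) fun _ => Nat.cast_nonneg _) h3
      rw [Set.mem_compl_iff, Set.mem_ofPred_eq, not_le] at hω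
      exact hω.le
    rw [integral_indicator hm.compl, setIntegral_const, probReal_compl_eq_one_sub hm, integral_add
      (integrable_finsetSum _ fun q _ => E.integrable_wrong i q T)
      (E.integrable_playsAt i (M - 1) n T), integral_finsetSum _ fun q _ => E.integrable_wrong i q T,
      smul_eq_mul] at h2
    rw [sub_le_iff_le_add, ← add_div, le_div_iff₀ hlog]
    linarith
  -- Upper bound: the overhead is `o(log T)` now that the wrong plays at all smaller ranks are, so
  -- only the sharp sum of upper-bound probabilities matters.
  · obtain ⟨c, hc, hcb⟩ := exists_between hb
    have hη : 0 < (c - ι) / 2 := by linarith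
    obtain ⟨ε, ⟨hgap, hsum⟩, hε0⟩ := ((E.eventually_gap.and
      (E.eventually_sum_upperProb_le hq hlt hη)).and self_mem_nhdsWithin).exists
    have hover := (E.isLittleO_overhead i hε0 hW).bound hη
    filter_upwards [hsum, hover, tendsto_log_nat.eventually_gt_atTop 0] with T h1 h2 hlog
    have h3 := E.integral_playsAt_le_sum i hgap hq hlt T
    rw [← hposq]
    rw [Real.norm_eq_abs, Real.norm_eq_abs, abs_of_pos hlog] at h2
    have h12 := le_abs_self (∫ ω, (E.overhead i ε (E.pos n₀) T ω : ℝ) ∂P)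
    rw [div_lt_iff₀ hlog]
    nlinarith

end System

/-! ### Rewards -/

section Division

variable {M N : ℕ}

lemma load_pos (b : Fin M → Fin N) (i : Fin M) : 1 ≤ load b (b i) :=
  Finset.card_pos.2 ⟨i, by simp⟩

lemma exists_ne_of_load_ne_one {b : Fin M → Fin N} {i : Fin M} (hb : load b (b i) ≠ 1) :
    ∃ i', i' ≠ i ∧ b i' = b i := by
  have h1 : 1 < load b (b i) := lt_of_le_of_ne (load_pos b i) hb.symm
  obtain ⟨i', hi', hne⟩ := Finset.exists_mem_ne h1 i
  exact ⟨i', hne, (Finset.mem_filter.1 hi').2⟩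

/-- The rewards of the players add up to the total reward. -/
lemma IsDivision.sum_eq {c : CollisionModel} {b : Fin M → Fin N} {y : Fin N → ℝ} {z : Fin M → ℝ}
    (hz : IsDivision c b y z) : ∑ i, z i = totalReward c b y := by
  rw [← Finset.sum_fiberwise_of_maps_to (s := Finset.univ) (t := Finset.univ) (g := b)
    (fun _ _ => Finset.mem_univ _)]
  cases c with
  | share =>
    refine Finset.sum_congr rfl fun n _ => ?_
    split_ifs with hn
    · exact hz n hn
    · have h0 : Finset.univ.filter (fun i => b i = n) = ∅ := by
        rw [← Finset.card_eq_zero]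
        change ¬ 1 ≤ (Finset.univ.filter (fun i => b i = n)).card at hn
        omega
      rw [h0, Finset.sum_empty]
  | none =>
    refine Finset.sum_congr rfl fun n _ => ?_
    have h1 : ∀ i ∈ Finset.univ.filter (fun i => b i = n), z i = if load b n = 1 then y n else 0 := by
      intro i hi
      rw [hz i, (Finset.mem_filter.1 hi).2]
    rw [Finset.sum_congr rfl h1, Finset.sum_const]
    change load b n • _ = _
    split_ifs with hn
    · rw [hn, one_smul]
    · rw [smul_zero]

end Division

/-! ### Expected rewards under fairness -/

section Fair

variable {Ω : Type*} [MeasurableSpace Ω] {P : Measure Ω} {M N : ℕ} {c : CollisionModel}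
  {a : ℕ → Ω → Fin M → Fin N} {S : ℕ → Ω → Fin N → ℝ} {Y : Fin M → ℕ → Ω → ℝ}

/-- The expected reward of a player, given the action profile. -/
lemma FairRewards.exists_setIntegral_eq (hY : FairRewards P c a S Y) {t : ℕ} (ht : 1 ≤ t)
    (b : Fin M → Fin N) (i : Fin M) (hb : MeasurableSet {ω | a t ω = b}) {m : ℝ}
    (hm : ∫ ω in {ω | a t ω = b}, S t ω (b i) ∂P = m * P.real {ω | a t ω = b}) :
    ∃ v, |v| ≤ |m| ∧ (load b (b i) = 1 → v = m) ∧
      ∫ ω in {ω | a t ω = b}, Y i t ω ∂P = v * P.real {ω | a t ω = b} := by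
  have hdiv := hY.division t ht
  cases c with
  | share =>
    have hload : (1 : ℝ) ≤ load b (b i) := by exact_mod_cast load_pos b i
    -- The rewards on an arm add up to its state, and by fairness each of the players there has the
    -- same integral, so each expects an equal share.
    refine ⟨m / load b (b i), ?_, fun h1 => by rw [h1]; simp, ?_⟩
    · rw [abs_div, abs_of_pos (by linarith : (0 : ℝ) < load b (b i))]
      exact div_le_self (abs_nonneg _) hload
    have h1 : ∫ ω in {ω | a t ω = b}, ∑ i' with b i' = b i, Y i' t ω ∂P =
        m * P.real {ω | a t ω = b} := by
      rw [← hm]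
      refine setIntegral_congr_ae hb ?_
      filter_upwards [hdiv] with ω hω (hab : a t ω = b)
      rw [hab] at hω
      exact hω (b i) (load_pos b i)
    rw [integral_finsetSum _ fun i' _ => (hY.integrable i' t ht).integrableOn,
      Finset.sum_congr rfl fun i' hi' => hY.fair t ht b i' i (Finset.mem_filter.1 hi').2,
      Finset.sum_const, nsmul_eq_mul] at h1
    change (load b (b i) : ℝ) * _ = _ at h1
    rw [div_mul_eq_mul_div, eq_div_iff (by linarith), mul_comm]
    exact h1
  | none =>
    refine ⟨if load b (b i) = 1 then m else 0, by split_ifs <;> simp, fun h1 => if_pos h1, ?_⟩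
    have h1 : ∫ ω in {ω | a t ω = b}, Y i t ω ∂P = ∫ ω in {ω | a t ω = b},
        if load b (b i) = 1 then S t ω (b i) else 0 ∂P := by
      refine setIntegral_congr_ae hb ?_
      filter_upwards [hdiv] with ω hω (hab : a t ω = b)
      rw [hab] at hω
      exact hω i
    rw [h1]
    split_ifs
    · exact hm
    · simp

/-- The system regret is the sum of the local regrets. -/
lemma FairRewards.systemRegret_eq_sum (hY : FairRewards P c a S Y) (hM : 1 ≤ M) (best : ℝ) (T : ℕ) :
    systemRegret P c a S best T = ∑ i, localRegret P Y best i T := by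
  have hM' : (M : ℝ) ≠ 0 := by positivity
  unfold systemRegret localRegret
  have h1 : ∫ ω, ∑ t ∈ Finset.Icc 1 T, totalReward c (a t ω) (S t ω) ∂P =
      ∫ ω, ∑ i, ∑ t ∈ Finset.Icc 1 T, Y i t ω ∂P := by
    refine integral_congr_ae ?_
    have h2 : ∀ᵐ ω ∂P, ∀ t ∈ Finset.Icc 1 T, IsDivision c (a t ω) (S t ω) (fun i => Y i t ω) :=
      (Finset.eventually_all _).2 fun t ht => hY.division t (Finset.mem_Icc.1 ht).1
    filter_upwards [h2] with ω hω
    rw [Finset.sum_comm]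
    exact Finset.sum_congr rfl fun t ht => ((hω t ht).sum_eq).symm
  rw [h1, integral_finsetSum _ fun i _ => integrable_finsetSum _ fun t ht =>
    hY.integrable i t (Finset.mem_Icc.1 ht).1, Finset.sum_sub_distrib, Finset.sum_const,
    Finset.card_univ, Fintype.card_fin, nsmul_eq_mul]
  field_simp

end Fair

/-! ### Rotation of the targets -/

section RankSum

variable {M : ℕ} (i : Fin M)

lemma rank_add_period {t : ℕ} (ht : 1 ≤ t) : rank i (t + M) = rank i t := by
  unfold rank
  rw [show t + M - 1 + (M - i) = t - 1 + (M - i) + M by omega, Nat.add_mod_right]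

lemma rank_injective {i' : Fin M} {t : ℕ} (h : rank i t = rank i' t) : i = i' := by
  unfold rank at h
  have h1 : M - (i : ℕ) ≡ M - i' [MOD M] := Nat.ModEq.add_left_cancel' _ h
  rcases Nat.eq_zero_or_pos (i : ℕ) with h2 | h2 <;> rcases Nat.eq_zero_or_pos (i' : ℕ) with h3 | h3
  · exact Fin.ext (h2.trans h3.symm)
  · rw [h2, Nat.sub_zero, Nat.ModEq, Nat.mod_self, Nat.mod_eq_of_lt (by omega)] at h1
    have := i'.isLt; omega
  · rw [h3, Nat.sub_zero, Nat.ModEq, Nat.mod_self, Nat.mod_eq_of_lt (by omega)] at h1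
    have := i.isLt; omega
  · rw [Nat.ModEq, Nat.mod_eq_of_lt (by omega), Nat.mod_eq_of_lt (by omega)] at h1
    have := i'.isLt; have := i.isLt
    exact Fin.ext (by omega)

lemma sum_rank_period (f : ℕ → ℝ) :
    ∑ t ∈ Finset.Icc 1 M, f (rank i t) = ∑ q ∈ Finset.range M, f q := by
  have hmaps : Set.MapsTo (rank i) (Finset.Icc 1 M) (Finset.range M) := fun t _ => by
    simpa using rank_lt i t
  have hinj : Set.InjOn (rank i) (Finset.Icc 1 M) := by
    intro s hs t ht hst
    rw [Finset.coe_Icc, Set.mem_Icc] at hs ht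
    have h1 : s - 1 ≡ t - 1 [MOD M] := Nat.ModEq.add_right_cancel' _ hst
    rw [Nat.ModEq, Nat.mod_eq_of_lt (by omega), Nat.mod_eq_of_lt (by omega)] at h1
    omega
  exact Finset.sum_nbij (rank i) hmaps hinj
    (Finset.surjOn_of_injOn_of_card_le _ hmaps hinj (by simp)) fun _ _ => rfl

/-- The target of a player runs periodically through all ranks. -/
lemma exists_abs_sum_rank_le (f : ℕ → ℝ) : ∃ C, ∀ T : ℕ,
    |1 / M * T * ∑ q ∈ Finset.range M, f q - ∑ t ∈ Finset.Icc 1 T, f (rank i t)| ≤ C := by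
  have hM : (M : ℝ) ≠ 0 := by exact_mod_cast (Fin.pos i).ne'
  set D : ℕ → ℝ := fun T =>
    1 / M * T * ∑ q ∈ Finset.range M, f q - ∑ t ∈ Finset.Icc 1 T, f (rank i t) with hD
  -- Over a full period the targets run once through all ranks, so the discrepancy is periodic and
  -- hence bounded by the sum of its absolute values over one period.
  have hper : Function.Periodic D M := by
    intro T
    induction T with
    | zero =>
      simp only [hD, zero_add, sum_rank_period]
      simp [hM]
    | succ T ih =>
      simp only [hD] at ih ⊢
      rw [show T + 1 + M = T + M + 1 by omega, Finset.sum_Icc_succ_top (by omega),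
        Finset.sum_Icc_succ_top (by omega), show T + M + 1 = T + 1 + M by omega,
        rank_add_period i (by omega)]
      push_cast at ih ⊢
      linarith
  refine ⟨∑ r ∈ Finset.range M, |D r|, fun T => ?_⟩
  change |D T| ≤ _
  rw [← hper.map_mod_nat]
  exact Finset.single_le_sum (f := fun r => |D r|) (fun _ _ => abs_nonneg _)
    (Finset.mem_range.2 (Nat.mod_lt _ (Fin.pos i)))

end RankSum

/-! ### From wrong plays to regret -/

namespace System

variable {H : Type*} {law : H → Measure ℝ} [∀ θ, IsProbabilityMeasure (law θ)]
  {h : (k : ℕ) → (Fin k → ℝ) → ℝ} {g : ℕ → (k : ℕ) → (Fin k → ℝ) → EReal} {M N : ℕ} [NeZero N]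
  {Ω : Type*} [MeasurableSpace Ω] {P : Measure Ω} (E : System law h g M N P) (i : Fin M)

/-- In slot `t`, player `i` plays an arm of smaller rank than the target, or it plays an arm of
larger rank while the target is not the last one. -/
abbrev Stray (t : ℕ) (ω : Ω) : Prop :=
  E.pos (action (E.policy i) (E.path ω) t) < rank i t ∨
    (rank i t + 1 < M ∧ rank i t < E.pos (action (E.policy i) (E.path ω) t))

/-- The number of slots up to `T` in which player `i` strays. -/
noncomputable def strays (T : ℕ) (ω : Ω) : ℕ := idx (fun t => E.Stray i t ω) T

lemma measurableSet_stray (t : ℕ) : MeasurableSet {ω | E.Stray i t ω} :=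
  E.measurableSet_action i t fun n => E.pos n < rank i t ∨ (rank i t + 1 < M ∧ rank i t < E.pos n)

lemma strays_le (T : ℕ) (ω : Ω) : E.strays i T ω ≤
    ∑ q ∈ Finset.range (M - 1), E.wrong i q T ω + E.wrongBetter i (M - 1) T ω := by
  classical
  unfold strays wrong wrongBetter idx
  refine le_trans (Finset.card_le_card (t := ((Finset.range (M - 1)).biUnion fun q =>
    (Finset.Icc 1 T).filter (Wrong E.δ h g E.tie i (E.path ω) E.σ q)) ∪ (Finset.Icc 1 T).filter
      (fun t => rank i t = M - 1 ∧ E.pos (action (E.policy i) (E.path ω) t) < M - 1))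
      fun t ht => ?_)
      ((Finset.card_union_le _ _).trans (Nat.add_le_add_right Finset.card_biUnion_le _))
  obtain ⟨htT, hs⟩ := Finset.mem_filter.1 ht
  have hr := rank_lt i t
  rw [Finset.mem_union]
  by_cases hrM : rank i t = M - 1
  · exact Or.inr (Finset.mem_filter.2 ⟨htT, hrM, by omega⟩)
  · refine Or.inl (Finset.mem_biUnion.2 ⟨rank i t, Finset.mem_range.2 (by omega),
      Finset.mem_filter.2 ⟨htT, rfl, ?_⟩⟩)
    change E.pos (action (E.policy i) (E.path ω) t) ≠ _
    omega

/-- Players collide only if some player strays. -/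
lemma exists_stray_of_load_ne_one {t : ℕ} {ω : Ω} {b : Fin M → Fin N}
    (hb : ∀ i, b i = action (E.policy i) (E.path ω) t) {i : Fin M} (hload : load b (b i) ≠ 1) :
    ∃ i', E.Stray i' t ω := by
  obtain ⟨i', hne, heq⟩ := exists_ne_of_load_ne_one hload
  by_contra! hcon
  have h1 := hcon i
  have h2 := hcon i'
  rw [← hb] at h1 h2
  rw [heq] at h2
  -- A player that does not stray plays its target, or, if its target is the last one, possibly a
  -- worse arm. Since targets differ, only one player can do the latter, and its arm is not a target
  -- of the others.
  have h3 : rank i' t ≠ rank i t := fun h => hne (rank_injective _ h)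
  have h4 := rank_lt i t
  have h5 := rank_lt i' t
  omega

/-- A bound for the means of the arms. -/
noncomputable def meanBound : ℝ := ∑ n, |E.μ n|

lemma abs_μ_le (n : Fin N) : |E.μ n| ≤ E.meanBound :=
  Finset.single_le_sum (f := fun n => |E.μ n|) (fun _ _ => abs_nonneg _) (Finset.mem_univ n)

lemma meanBound_nonneg : 0 ≤ E.meanBound := Finset.sum_nonneg fun _ _ => abs_nonneg _

/-- The mean of the arm of rank `q`. -/
noncomputable def rankMean (q : ℕ) : ℝ := if hq : q < N then E.μ (E.σ ⟨q, hq⟩) else 0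

lemma rankMean_pos (n : Fin N) : E.rankMean (E.pos n) = E.μ n := by
  unfold rankMean
  rw [dif_pos (E.σ.symm n).isLt]
  simp

lemma abs_rankMean_le (q : ℕ) : |E.rankMean q| ≤ E.meanBound := by
  unfold rankMean
  split_ifs
  · exact E.abs_μ_le _
  · rw [abs_zero]; exact E.meanBound_nonneg

/-- Compared slot by slot: without straying, the loss is zero on target and `μ n₀ - μ n` when the
last target is missed in favour of `n`, and both are matched exactly by the second sum. A stray slot
contributes at most twice the bound for the means. -/
lemma abs_loss_sub_le {n₀ : Fin N} (hn₀ : E.pos n₀ + 1 = M) (T : ℕ) (ω : Ω) :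
    |∑ t ∈ Finset.Icc 1 T, (E.rankMean (rank i t) - E.μ (action (E.policy i) (E.path ω) t)) -
      ∑ n with M ≤ E.pos n, (E.μ n₀ - E.μ n) * (E.playsAt i (M - 1) n T ω : ℝ)| ≤
      2 * E.meanBound * E.strays i T ω := by
  unfold playsAt strays idx
  simp only [Finset.card_filter, Nat.cast_sum, Nat.cast_ite, Nat.cast_one, Nat.cast_zero,
    Finset.mul_sum]
  rw [Finset.sum_comm, ← Finset.sum_sub_distrib]
  refine (Finset.abs_sum_le_sum_abs _ _).trans (Finset.sum_le_sum fun t _ => ?_)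
  set n := action (E.policy i) (E.path ω) t with hn
  have hr := rank_lt i t
  have hC := E.meanBound_nonneg
  by_cases hcase : rank i t = M - 1 ∧ M ≤ E.pos n
  · have h1 : ∑ n' with M ≤ E.pos n', (E.μ n₀ - E.μ n') * (if rank i t = M - 1 ∧ n = n' then
        (1 : ℝ) else 0) = E.μ n₀ - E.μ n := by
      rw [Finset.sum_eq_single_of_mem n (Finset.mem_filter.2 ⟨Finset.mem_univ _, hcase.2⟩)]
      · rw [if_pos ⟨hcase.1, rfl⟩, mul_one]
      · intro n' _ hne
        rw [if_neg fun h => hne h.2.symm, mul_zero]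
    have h2 : E.rankMean (rank i t) = E.μ n₀ := by
      rw [hcase.1, ← E.rankMean_pos n₀]; congr 1; omega
    rw [h1, h2, sub_self, abs_zero]
    split_ifs <;> simp [hC]
  · have h1 : ∑ n' with M ≤ E.pos n', (E.μ n₀ - E.μ n') * (if rank i t = M - 1 ∧ n = n' then
        (1 : ℝ) else 0) = 0 := by
      refine Finset.sum_eq_zero fun n' hn' => ?_
      rw [if_neg, mul_zero]
      rintro ⟨h1, rfl⟩
      exact hcase ⟨h1, (Finset.mem_filter.1 hn').2⟩
    rw [h1, sub_zero]
    split_ifs with hs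
    · rw [mul_one]
      have h2 := abs_sub (E.rankMean (rank i t)) (E.μ n)
      linarith [E.abs_rankMean_le (rank i t), E.abs_μ_le n]
    · have h2 : rank i t = E.pos n := by
        change ¬ (E.pos n < rank i t ∨ (rank i t + 1 < M ∧ rank i t < E.pos n)) at hs
        omega
      rw [h2, E.rankMean_pos, sub_self, abs_zero, mul_zero]

variable [IsProbabilityMeasure P]

lemma integrable_strays (T : ℕ) : Integrable (fun ω => (E.strays i T ω : ℝ)) P := by
  unfold strays
  exact integrable_idx (fun ω t => E.Stray i t ω) (E.measurableSet_stray i) T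

lemma integral_strays (T : ℕ) : ∫ ω, (E.strays i T ω : ℝ) ∂P =
    ∑ t ∈ Finset.Icc 1 T, P.real {ω | E.Stray i t ω} := by
  unfold strays idx
  exact integral_card_filter _ (fun ω t => E.Stray i t ω) fun t _ => E.measurableSet_stray i t

lemma isLittleO_strays :
    (fun T => ∫ ω, (E.strays i T ω : ℝ) ∂P) =o[atTop] fun T : ℕ => Real.log T := by
  have hM := Fin.pos i
  have h1 : (fun T => ∑ q ∈ Finset.range (M - 1), ∫ ω, (E.wrong i q T ω : ℝ) ∂P +
      ∫ ω, (E.wrongBetter i (M - 1) T ω : ℝ) ∂P) =o[atTop] fun T : ℕ => Real.log T := by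
    refine IsLittleO.add ?_ (E.isLittleO_wrongBetter i (by omega))
    simpa only [Finset.sum_fn] using IsLittleO.sum fun q (hq : q ∈ Finset.range (M - 1)) =>
      E.isLittleO_wrong i (q := q) (by rw [Finset.mem_range] at hq; omega)
  refine isLittleO_of_nonneg_of_le (fun T => integral_nonneg fun _ => Nat.cast_nonneg _)
    (Eventually.of_forall fun T => ?_) h1
  rw [← integral_finsetSum _ fun q _ => E.integrable_wrong i q T, ← integral_add
    (integrable_finsetSum _ fun q _ => E.integrable_wrong i q T)
    (E.integrable_wrongBetter i (M - 1) T)]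
  refine integral_mono (E.integrable_strays i T) ((integrable_finsetSum _ fun q _ =>
    E.integrable_wrong i q T).add (E.integrable_wrongBetter i (M - 1) T)) fun ω => ?_
  have := E.strays_le i T ω
  simp only
  exact_mod_cast this

lemma integrable_μ_action (t : ℕ) :
    Integrable (fun ω => E.μ (action (E.policy i) (E.path ω) t)) P := by
  refine Integrable.of_bound ((measurable_of_finite E.μ).comp
    (E.measurable_action i t)).aestronglyMeasurable E.meanBound (Eventually.of_forall fun ω => ?_)
  exact E.abs_μ_le _

variable {a : ℕ → Ω → Fin M → Fin N}
  (ha : ∀ t ω i, a t ω i = action (E.policy i) (E.path ω) t)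
include ha

omit [IsProbabilityMeasure P] in
lemma measurableSet_profile (t : ℕ) (b : Fin M → Fin N) : MeasurableSet {ω | a t ω = b} := by
  simp only [funext_iff, ha, Set.ofPred_forall]
  exact MeasurableSet.iInter fun i => E.measurableSet_action i t fun n => n = b i

omit [IsProbabilityMeasure P] in
/-- The state of an arm is independent of the actions in the same slot. -/
lemma setIntegral_state {t : ℕ} (ht : 1 ≤ t) (b : Fin M → Fin N) (n : Fin N) :
    ∫ ω in {ω | a t ω = b}, E.S t ω n ∂P = E.μ n * P.real {ω | a t ω = b} := by
  obtain ⟨s, rfl⟩ : ∃ s, t = s + 1 := ⟨t - 1, by omega⟩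
  have hind := indepFun_past_future E.measurable_S E.indep s
  rw [IndepFun_iff_Indep] at hind
  have hXm : Measurable fun ω => past s (E.path ω) :=
    (measurable_past s).comp (measurable_path E.measurable_S)
  have hFm : Measurable fun ω k => E.S (s + 1 + k) ω := measurable_pi_lambda _ fun k =>
    E.measurable_S _
  have hA : MeasurableSet[MeasurableSpace.comap (fun ω => past s (E.path ω)) inferInstance]
      {ω | a (s + 1) ω = b} := by
    refine ⟨{x | ∀ i, action (E.policy i) x (s + 1) = b i}, ?_, ?_⟩
    · simp only [Set.ofPred_forall]
      exact MeasurableSet.iInter fun i => E.measurable_action_policy i (s + 1)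
        (measurableSet_singleton (b i))
    · ext ω
      simp only [Set.mem_preimage, Set.mem_ofPred_eq, funext_iff, ha]
      exact forall_congr' fun i => by rw [action_past _ le_rfl]
  have hproj : Measurable fun y : ℕ → Fin N → ℝ => y 0 n :=
    (measurable_pi_apply n).comp (measurable_pi_apply 0)
  have h1 := hind.setIntegral_eq_mul hXm.comap_le hFm.aemeasurable hA
    (f := fun y : ℕ → Fin N → ℝ => y 0 n) hproj.aestronglyMeasurable
  simp only [add_zero] at h1
  rw [h1, mul_comm]
  congr 1
  have h2 := integral_map (μ := P) (φ := fun ω => E.S (s + 1) ω n) (f := fun x : ℝ => x)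
    ((measurable_pi_apply n).comp (E.measurable_S _)).aemeasurable
    measurable_id.aestronglyMeasurable
  rw [E.dist _ ht] at h2
  exact h2.symm

omit [IsProbabilityMeasure P] in
lemma integral_eq_sum_profile {f : Ω → ℝ} (hf : Integrable f P) (t : ℕ) :
    ∫ ω, f ω ∂P = ∑ b, ∫ ω in {ω | a t ω = b}, f ω ∂P := by
  rw [← integral_iUnion_fintype (E.measurableSet_profile ha t) ?_ fun b => hf.integrableOn]
  · have : ⋃ b, {ω | a t ω = b} = Set.univ := Set.eq_univ_of_forall fun ω =>
      Set.mem_iUnion.2 ⟨a t ω, rfl⟩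
    rw [this, setIntegral_univ]
  · intro b b' hne
    exact Set.disjoint_left.2 fun ω (h1 : a t ω = b) (h2 : a t ω = b') => hne (h1.symm.trans h2)

variable {c : CollisionModel} {Y : Fin M → ℕ → Ω → ℝ} (hY : FairRewards P c a E.S Y)
include hY

/-- Given the action profile, a player alone on its arm expects the mean of that arm. Sharing or
losing a reward requires a collision, hence a stray player, and then the difference is at most twice
the bound for the means. -/
lemma abs_integral_reward_sub_le {t : ℕ} (ht : 1 ≤ t) :
    |∫ ω, E.μ (action (E.policy i) (E.path ω) t) ∂P - ∫ ω, Y i t ω ∂P| ≤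
      2 * E.meanBound * ∑ i', P.real {ω | E.Stray i' t ω} := by
  have hC := E.meanBound_nonneg
  set Z : Set Ω := ⋃ i', {ω | E.Stray i' t ω} with hZ
  have hZm : MeasurableSet Z := MeasurableSet.iUnion fun i' => E.measurableSet_stray i' t
  have hZint : Integrable (Z.indicator (fun _ => (1 : ℝ))) P := (integrable_const _).indicator hZm
  have hZle : ∫ ω, Z.indicator (fun _ => (1 : ℝ)) ω ∂P ≤ ∑ i', P.real {ω | E.Stray i' t ω} := by
    rw [integral_indicator hZm]
    simp only [integral_const, smul_eq_mul, mul_one, measureReal_restrict_apply_univ]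
    exact measureReal_iUnion_fintype_le _
  refine le_trans ?_ (mul_le_mul_of_nonneg_left hZle (by positivity))
  rw [E.integral_eq_sum_profile ha (E.integrable_μ_action i t) t,
    E.integral_eq_sum_profile ha (hY.integrable i t ht) t, E.integral_eq_sum_profile ha hZint t,
    ← Finset.sum_sub_distrib, Finset.mul_sum]
  refine (Finset.abs_sum_le_sum_abs _ _).trans (Finset.sum_le_sum fun b _ => ?_)
  have hbm := E.measurableSet_profile ha t b
  obtain ⟨v, hv, hv1, hvY⟩ := hY.exists_setIntegral_eq ht b i hbm (E.setIntegral_state ha ht b (b i))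
  have h1 : ∫ ω in {ω | a t ω = b}, E.μ (action (E.policy i) (E.path ω) t) ∂P =
      E.μ (b i) * P.real {ω | a t ω = b} := by
    rw [setIntegral_congr_fun (g := fun _ => E.μ (b i)) hbm fun ω (hω : a t ω = b) => by
      rw [← ha, hω], setIntegral_const, smul_eq_mul, mul_comm]
  rw [h1, hvY, ← sub_mul, abs_mul, abs_of_nonneg (measureReal_nonneg (s := {ω | a t ω = b}))]
  by_cases hload : load b (b i) = 1
  · rw [hv1 hload, sub_self, abs_zero, zero_mul]
    exact mul_nonneg (by positivity) (integral_nonneg fun ω =>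
      Set.indicator_nonneg (fun _ _ => zero_le_one) _)
  · have h2 : ∫ ω in {ω | a t ω = b}, Z.indicator (fun _ => (1 : ℝ)) ω ∂P =
        P.real {ω | a t ω = b} := by
      rw [setIntegral_congr_fun (g := fun _ => (1 : ℝ)) hbm fun ω (hω : a t ω = b) => ?_,
        setIntegral_const, smul_eq_mul, mul_one]
      refine Set.indicator_of_mem (Set.mem_iUnion.2 ?_) _
      exact E.exists_stray_of_load_ne_one (fun i => by rw [← hω, ha]) hload
    rw [h2]
    refine mul_le_mul_of_nonneg_right ?_ measureReal_nonneg
    have h3 := abs_sub (E.μ (b i)) v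
    linarith [E.abs_μ_le (b i)]

/-- The local regret of every player is asymptotic to `C log T`, where `C` does not depend on the
player. -/
theorem tendsto_localRegret_div_log {n₀ : Fin N} (hn₀ : E.pos n₀ + 1 = M) {best : ℝ}
    (hbest : best = ∑ q ∈ Finset.range M, E.rankMean q) :
    Tendsto (fun T : ℕ => localRegret P Y best i T / Real.log T) atTop
      (𝓝 (∑ n with M ≤ E.pos n, (E.μ n₀ - E.μ n) * (1 / kl law (E.Θ n) (E.Θ n₀)))) := by
  set main : ℕ → ℝ := fun T => ∑ n with M ≤ E.pos n, (E.μ n₀ - E.μ n) *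
    ∫ ω, (E.playsAt i (M - 1) n T ω : ℝ) ∂P with hmain
  obtain ⟨C, hC⟩ := exists_abs_sum_rank_le i E.rankMean
  have hbound : ∀ T, |localRegret P Y best i T - main T| ≤ C + 2 * E.meanBound *
      ∫ ω, (E.strays i T ω : ℝ) ∂P + 2 * E.meanBound * ∑ i', ∫ ω, (E.strays i' T ω : ℝ) ∂P := by
    intro T
    have hint : ∀ t, Integrable
        (fun ω => E.rankMean (rank i t) - E.μ (action (E.policy i) (E.path ω) t)) P :=
      fun t => (integrable_const _).sub (E.integrable_μ_action i t)
    have hint2 : Integrable (fun ω => ∑ n with M ≤ E.pos n,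
        (E.μ n₀ - E.μ n) * (E.playsAt i (M - 1) n T ω : ℝ)) P :=
      integrable_finsetSum _ fun n _ => (E.integrable_playsAt i _ n T).const_mul _
    have h1 : |(∑ t ∈ Finset.Icc 1 T, (E.rankMean (rank i t) -
        ∫ ω, E.μ (action (E.policy i) (E.path ω) t) ∂P)) - main T| ≤
        2 * E.meanBound * ∫ ω, (E.strays i T ω : ℝ) ∂P := by
      have e1 : (∑ t ∈ Finset.Icc 1 T, (E.rankMean (rank i t) -
          ∫ ω, E.μ (action (E.policy i) (E.path ω) t) ∂P)) = ∫ ω, ∑ t ∈ Finset.Icc 1 T,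
          (E.rankMean (rank i t) - E.μ (action (E.policy i) (E.path ω) t)) ∂P := by
        rw [integral_finsetSum _ fun t _ => hint t]
        refine Finset.sum_congr rfl fun t _ => ?_
        rw [integral_sub (integrable_const _) (E.integrable_μ_action i t)]
        simp
      have e2 : main T = ∫ ω, ∑ n with M ≤ E.pos n,
          (E.μ n₀ - E.μ n) * (E.playsAt i (M - 1) n T ω : ℝ) ∂P := by
        rw [integral_finsetSum _ fun n _ => (E.integrable_playsAt i _ n T).const_mul _]
        simp only [integral_const_mul, hmain]
      rw [e1, e2, ← integral_sub (integrable_finsetSum _ fun t _ => hint t) hint2,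
        ← integral_const_mul]
      exact (abs_integral_le_integral_abs).trans (integral_mono
        ((integrable_finsetSum _ fun t _ => hint t).sub hint2).abs
        ((E.integrable_strays i T).const_mul _) fun ω => E.abs_loss_sub_le i hn₀ T ω)
    have h2 : |∑ t ∈ Finset.Icc 1 T, (∫ ω, E.μ (action (E.policy i) (E.path ω) t) ∂P -
        ∫ ω, Y i t ω ∂P)| ≤ 2 * E.meanBound * ∑ i', ∫ ω, (E.strays i' T ω : ℝ) ∂P := by
      simp only [integral_strays]
      rw [Finset.sum_comm, Finset.mul_sum]
      exact (Finset.abs_sum_le_sum_abs _ _).trans (Finset.sum_le_sum fun t ht =>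
        E.abs_integral_reward_sub_le i ha hY (Finset.mem_Icc.1 ht).1)
    -- Three sources of error: the incomplete last rotation (bounded), the plays other than worse
    -- arms at the last target (paid by the strays of player `i`), and collisions (paid by the
    -- strays of all players).
    have h3 : localRegret P Y best i T - main T =
        (1 / M * T * ∑ q ∈ Finset.range M, E.rankMean q -
          ∑ t ∈ Finset.Icc 1 T, E.rankMean (rank i t)) +
        ((∑ t ∈ Finset.Icc 1 T, (E.rankMean (rank i t) -
          ∫ ω, E.μ (action (E.policy i) (E.path ω) t) ∂P)) - main T) +
        ∑ t ∈ Finset.Icc 1 T, (∫ ω, E.μ (action (E.policy i) (E.path ω) t) ∂P -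
          ∫ ω, Y i t ω ∂P) := by
      unfold localRegret
      rw [integral_finsetSum _ fun t ht => hY.integrable i t (Finset.mem_Icc.1 ht).1, hbest,
        Finset.sum_sub_distrib, Finset.sum_sub_distrib]
      ring
    rw [h3]
    exact (abs_add_three _ _ _).trans (add_le_add (add_le_add (hC T) h1) h2)
  have hsum : (fun T => ∑ i', ∫ ω, (E.strays i' T ω : ℝ) ∂P) =o[atTop]
      fun T : ℕ => Real.log T := by
    simpa only [Finset.sum_fn] using IsLittleO.sum fun i' (_ : i' ∈ Finset.univ) =>
      E.isLittleO_strays i'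
  have hsmall : (fun T => localRegret P Y best i T - main T) =o[atTop] fun T : ℕ => Real.log T :=
    (IsBigO.of_bound 1 (Eventually.of_forall fun T => by
      rw [Real.norm_eq_abs, one_mul]
      exact (hbound T).trans (le_abs_self _))).trans_isLittleO
      (((isLittleO_const_log C).add ((E.isLittleO_strays i).const_mul_left _)).add
        (hsum.const_mul_left _))
  have hlim : Tendsto (fun T : ℕ => main T / Real.log T) atTop
      (𝓝 (∑ n with M ≤ E.pos n, (E.μ n₀ - E.μ n) * (1 / kl law (E.Θ n) (E.Θ n₀)))) := by
    simp only [hmain, Finset.sum_div, mul_div_assoc]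
    exact tendsto_finsetSum _ fun n hn =>
      (E.tendsto_playsAt_div_log i hn₀ (Finset.mem_filter.1 hn).2).const_mul _
  have h4 := hsmall.tendsto_div_nhds_zero.add hlim
  rw [zero_add] at h4
  refine h4.congr fun T => ?_
  rw [← add_div, sub_add_cancel]

end System

end DecMAB

theorem theorem3
    {H : Type*} (law : H → Measure ℝ) [∀ θ, IsProbabilityMeasure (law θ)]
    (hlaw : DecMAB.RegularModel law)
    (h : (k : ℕ) → (Fin k → ℝ) → ℝ) (g : ℕ → (k : ℕ) → (Fin k → ℝ) → EReal)
    (hstat : DecMAB.AdmissibleStatistics law h g)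
    {M N : ℕ} [NeZero N] (hM : 1 ≤ M) (hMN : M < N)
    (δ : ℝ) (hδ : 0 < δ) (hδN : δ < 1 / N)
    (tie : Finset (Fin N) → Fin N) (htie : ∀ A : Finset (Fin N), A.Nonempty → tie A ∈ A)
    -- the arms, with parameters `Θ n`; `σ j` is the arm of rank `j + 1`
    (Θ : Fin N → H) (σ : Equiv.Perm (Fin N))
    (hσ : Antitone (fun j => DecMAB.mean law (Θ (σ j))))
    -- the means of the `M` best arms are nonnegative and there is no tie among or with them
    (hdistinct : ∀ j l : Fin N, (j : ℕ) < M → j < l →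
      DecMAB.mean law (Θ (σ l)) < DecMAB.mean law (Θ (σ j)))
    (hnonneg : ∀ j : Fin N, (j : ℕ) < M → 0 ≤ DecMAB.mean law (Θ (σ j)))
    -- an arm that is not among the `M` best is closer to the `M`-th best than to better arms
    (hkl : ∀ j m l : Fin N, (m : ℕ) + 1 = M → j < m → m < l →
      DecMAB.kl law (Θ (σ l)) (Θ (σ m)) < DecMAB.kl law (Θ (σ l)) (Θ (σ j)))
    -- the arm states: independent over time, `S t ω n` with the distribution of arm `n`
    {Ω : Type*} [MeasurableSpace Ω] (P : Measure Ω) [IsProbabilityMeasure P]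
    (S : ℕ → Ω → Fin N → ℝ) (hS : ∀ t, Measurable (S t))
    (hindep : iIndepFun (fun t : ℕ => S (t + 1)) P)
    (hdist : ∀ t, 1 ≤ t → ∀ n, P.map (fun ω => S t ω n) = law (Θ n))
    -- the actions of the players under the policy
    (a : ℕ → Ω → Fin M → Fin N)
    (ha : ∀ t ω i, a t ω i = DecMAB.action (DecMAB.tdfs δ h g tie i) (fun s => S s ω) t)
    -- a fair collision model
    (c : DecMAB.CollisionModel) (Y : Fin M → ℕ → Ω → ℝ) (hY : DecMAB.FairRewards P c a S Y)
    (best : ℝ) (hbest : best = ∑ j : Fin M, DecMAB.mean law (Θ (σ (Fin.castLE hMN.le j))))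
    (i : Fin M) :
    limsup (fun T : ℕ => ((DecMAB.localRegret P Y best i T / Real.log T : ℝ) : EReal)) atTop =
      ((1 / M : ℝ) : EReal) *
        limsup (fun T : ℕ =>
          ((DecMAB.systemRegret P c a S best T / Real.log T : ℝ) : EReal)) atTop := by
  let E : DecMAB.System law h g M N P :=
    { δ := δ
      tie := tie
      Θ := Θ
      σ := σ
      S := S
      model := hlaw
      stat := hstat
      lt := hMN
      δ_pos := hδ
      δ_lt := hδN
      tie_mem := htie
      mean_lt := fun n₀ n h1 h2 => by
        simpa using hdistinct (σ.symm n₀) (σ.symm n) h1 h2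
      kl_lt := fun n j m h1 h2 h3 => by
        simpa using hkl (σ.symm j) (σ.symm m) (σ.symm n) h1 h2 h3
      measurable_S := hS
      indep := hindep
      dist := hdist }
  have hM0 : (M : ℝ) ≠ 0 := by positivity
  have hn₀ : E.pos (σ ⟨M - 1, by omega⟩) + 1 = M := by
    change ((σ.symm (σ ⟨M - 1, by omega⟩) : Fin N) : ℕ) + 1 = M
    rw [Equiv.symm_apply_apply]
    exact Nat.sub_add_cancel hM
  have hbest' : best = ∑ q ∈ Finset.range M, E.rankMean q := by
    rw [hbest, Finset.sum_range]
    refine Finset.sum_congr rfl fun j _ => ?_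
    have hj : (j : ℕ) < N := j.isLt.trans hMN
    unfold DecMAB.System.rankMean
    rw [dif_pos hj]
    rfl
  have hlocal := fun i => E.tendsto_localRegret_div_log i ha hY hn₀ hbest'
  set C := ∑ n with M ≤ E.pos n, (E.μ (σ ⟨M - 1, by omega⟩) - E.μ n) *
    (1 / DecMAB.kl law (E.Θ n) (E.Θ (σ ⟨M - 1, by omega⟩)))
  have hsystem : Tendsto (fun T : ℕ => DecMAB.systemRegret P c a S best T / Real.log T) atTop
      (𝓝 (M * C)) := by
    have h1 := tendsto_finsetSum Finset.univ fun i (_ : i ∈ Finset.univ) => hlocal i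
    rw [Finset.sum_const, Finset.card_univ, Fintype.card_fin, nsmul_eq_mul] at h1
    refine h1.congr fun T => ?_
    rw [hY.systemRegret_eq_sum hM, Finset.sum_div]
  -- Both normalized regrets converge to finite limits, so the upper limits in the extended reals
  -- are the images of `C` and `M * C`.
  have hlocal' : limsup (fun T : ℕ =>
      ((DecMAB.localRegret P Y best i T / Real.log T : ℝ) : EReal)) atTop = (C : EReal) :=
    ((continuous_coe_real_ereal.tendsto _).comp (hlocal i)).limsup_eq
  have hsystem' : limsup (fun T : ℕ =>
      ((DecMAB.systemRegret P c a S best T / Real.log T : ℝ) : EReal)) atTop =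
      ((M * C : ℝ) : EReal) :=
    ((continuous_coe_real_ereal.tendsto _).comp hsystem).limsup_eq
  rw [hlocal', hsystem', ← EReal.coe_mul]
  congr 1
  field_simp
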